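/- **Setting.** Observe $m$ independent vectors ${\bf y}_j=\boldsymbol\mu_j+\boldsymbol\epsilon_j\in\mathbb R^n$, $\boldsymbol\epsilon_j\sim N_n({\bf 0},\sigma^2I_n)$ i.i.d., $j=1,\dots,m$, with $\sigma>0$ known. Let $\gamma>0$ and $c(\gamma)=8(\gamma+3/4)^2$. Let $\pi_0$ be a strictly positive probability distribution on $\{0,\dots,m\}$ and $\pi_1,\dots,\pi_m$ strictly positive probability distributions on $\{1,\dots,n\}$. The sparse group MAP estimator $(\hat{\boldsymbol\mu}_1,\dots,\hat{\boldsymbol\mu}_m)$ minimizes, for almost all data, $$\sum_{j=1}^m\left\{\|{\bf y}_j-\tilde{\boldsymbol\mu}_j\|_2^2+Pen_j(\|\tilde{\boldsymbol\mu}_j\|_0)\right\}+Pen_0\left(\#\{j:\tilde{\boldsymbol\mu}_j\neq{\bf 0}\}\right)$$ over $\tilde{\boldsymbol\mu}_1,\dots,\tilde{\boldsymbol\mu}_m\in\mathbb R^n$, where $Pen_j(0)=0$, $Pen_j(h)=2\sigma^2(1+1/\gamma)\ln\left(\pi_j(h)^{-1}\binom nh(1+\gamma)^{h/2}\right)$ for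 $1\le h\le n$, and $Pen_0(k)=2\sigma^2(1+1/\gamma)\ln\left(\pi_0(k)^{-1}\binom mk\right)$ for $0\le k\le m$. A ball $\Theta[\eta]$ of standardized radius $\eta$ is one of: $l_0[\eta]=\{\boldsymbol\mu:\|\boldsymbol\mu\|_0\le\eta n\}$; for $p>0$ the strong ball $l_p[\eta]=\{\boldsymbol\mu:\frac1n\sum_i|\mu_i|^p\le\sigma^p\eta^p\}$; for $p>0$ the weak ball $m_p[\eta]=\{\boldsymbol\mu:|\mu|_{(i)}\le\sigma\eta(n/i)^{1/p},\ i=1,\dots,n\}$, with $|\mu|_{(1)}\ge\dots\ge|\mu|_{(n)}$ the ordered absolute values. The minimax risk for a single vector is $R(\Theta)=\inf_{\tilde{\boldsymbol\mu}}\sup_{\boldsymbol\mu\in\Theta}E\|\tilde{\boldsymbol\mu}-\boldsymbol\mu\|_2^2$, the infimum being over all estimators based on one observation ${\bf y}\sim N_n(\boldsymbol\mu,\sigma^2I_n)$. Call $\eta$ *not super-sparse* if $\eta\ge n^{-1}$ (for $l_0$) or $\eta\ge n^{-1/\min(p,2)}\sqrt{\ln n}$ (for $p>0$). **Theorem.**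 Let $\gamma,c_0,c_1>0$ and $c_2>c(\gamma)$. There is a constant $C_1>0$, depending only on $\gamma$ and on the constants $c_0,c_1,c_2$, such that the following holds for all $m,n,\sigma$ and all priors with 1. $\pi_0(k)\ge(k/m)^{c_0k}$ for $k=1,\dots,\lfloor m/e\rfloor$, and $\pi_0(m)\ge e^{-c_0m}$; 2. for all $j=1,\dots,m$: $\pi_j(h)\le\binom nh e^{-c(\gamma)h}$ for $h=1,\dots,n$; $\pi_j(h)\ge(h/n)^{c_1h}$ for $h=1,\dots,\lfloor ne^{-c(\gamma)}\rfloor$; and $\pi_j(n)\ge e^{-c_2n}$. For every nonempty ${\cal J}_0^c\subseteq\{1,\dots,m\}$, with $m_0=|{\cal J}_0^c|$, and all balls $\Theta_j[\eta_{jn}]$, $j\in{\cal J}_0^c$ (types and parameters $p_j$ may vary with $j$) whose radii are not super-sparse, $$\sup\ \sum_{j=1}^mE\|\hat{\boldsymbol\mu}_j-\boldsymbol\mu_j\|_2^2\ \le\ C_1\max\left(\sum_{j\in{\cal J}_0^c}R(\Theta_j[\eta_{jn}]),\ \sigma^2m_0\ln(m/m_0)\right),$$ where the supremum is over $\boldsymbol\mu_j\in\Theta_j[\eta_{jn}]$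 for $j\in{\cal J}_0^c$, with $\boldsymbol\mu_j={\bf 0}$ for $j\notin{\cal J}_0^c$. Here the minimax risks $R$ are, up to multiplying constants, as follows. For each type of ball (and each $p$) and each $\eta_0\in(0,1)$ there are constants $a,A>0$ such that for all $n\ge2$, $\sigma>0$ and all radii $\eta$ that are not super-sparse, $a\,r\le R(\Theta[\eta])\le A\,r$, where - (dense case) if $\eta\ge\eta_0$, then $r=\sigma^2n$; - (sparse case) if $\eta\le\eta_0$, then $r=\sigma^2n\eta\ln\eta^{-1}$ for $l_0[\eta]$; $r=\sigma^2n\eta^p(\ln\eta^{-p})^{1-p/2}$ for $l_p[\eta]$ and $m_p[\eta]$ with $0<p<2$; $r=\sigma^2n\eta^2$ for $l_p[\eta]$ with $p\ge2$ and for $m_p[\eta]$ with $p>2$; $r=\sigma^2n\eta^2\ln\eta^{-2}$ for $m_2[\eta]$. -/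

import Mathlib

open MeasureTheory ProbabilityTheory
open scoped ENNReal

namespace SparseGroup

noncomputable section

/-! ### The Gaussian model and quadratic risk -/

/-- The law of a single `n`-dimensional observation `y ~ N_n(μ, σ² I_n)`. -/
def vectorLaw (n : ℕ) (σ : ℝ) (μ : Fin n → ℝ) : Measure (Fin n → ℝ) :=
  Measure.pi fun i => gaussianReal (μ i) (σ ^ 2).toNNReal

/-- The law of `m` independent vectors `y_j ~ N_n(μ_j, σ² I_n)`, `j = 1, …, m`. -/
def groupLaw (m n : ℕ) (σ : ℝ) (μ : Fin m → Fin n → ℝ) : Measure (Fin m → Fin n → ℝ) :=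
  Measure.pi fun j => vectorLaw n σ (μ j)

/-- Quadratic risk `E ‖δ(y) - μ‖₂²` of an estimator `δ` of a single mean vector. -/
def vectorRisk (n : ℕ) (σ : ℝ) (δ : (Fin n → ℝ) → Fin n → ℝ) (μ : Fin n → ℝ) : ℝ≥0∞ :=
  ∫⁻ y, ENNReal.ofReal (∑ i, (δ y i - μ i) ^ 2) ∂(vectorLaw n σ μ)

/-- Global quadratic risk `∑_j E ‖δ_j(y) - μ_j‖₂²` of an estimator of `m` mean vectors. -/
def groupRisk (m n : ℕ) (σ : ℝ) (δ : (Fin m → Fin n → ℝ) → Fin m → Fin n → ℝ)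
    (μ : Fin m → Fin n → ℝ) : ℝ≥0∞ :=
  ∑ j, ∫⁻ y, ENNReal.ofReal (∑ i, (δ y j i - μ j i) ^ 2) ∂(groupLaw m n σ μ)

/-- Minimax quadratic risk `R(Θ) = inf_δ sup_{μ ∈ Θ} E ‖δ(y) - μ‖₂²` for a single mean vector,
the infimum being over all (measurable) estimators. -/
def minimaxRisk (n : ℕ) (σ : ℝ) (Θ : Set (Fin n → ℝ)) : ℝ≥0∞ :=
  ⨅ (δ : (Fin n → ℝ) → Fin n → ℝ) (_ : Measurable δ), ⨆ μ ∈ Θ, vectorRisk n σ δ μ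

/-! ### Sparsity balls -/

/-- Number of nonzero components. -/
def l0norm {n : ℕ} (v : Fin n → ℝ) : ℕ := (Finset.univ.filter fun i => v i ≠ 0).card

/-- The absolute values of the components in decreasing order: `absOrdered v i` is the
`(i + 1)`-st largest of the `|v k|` (the index `i : Fin n` starts at `0`). -/
def absOrdered {n : ℕ} (v : Fin n → ℝ) (i : Fin n) : ℝ :=
  |v (Tuple.sort (fun k => -|v k|) i)|

/-- The type of a ball: `l_0`, strong `l_p` or weak `l_p`. -/
inductive BallType where
  | l0 : BallType
  | strong (p : ℝ) : BallType
  | weak (p : ℝ) : BallType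

/-- The ball of the given type with standardized radius `η`. -/
def BallType.ball (T : BallType) (n : ℕ) (σ η : ℝ) : Set (Fin n → ℝ) :=
  match T with
  | .l0 => {v | (l0norm v : ℝ) ≤ η * n}
  | .strong p => {v | 1 / (n : ℝ) * ∑ i, |v i| ^ p ≤ σ ^ p * η ^ p}
  | .weak p => {v | ∀ i : Fin n,
      absOrdered v i ≤ σ * η * ((n : ℝ) / ((i : ℕ) + 1 : ℝ)) ^ (1 / p)}

/-- The radii that are not super-sparse: `η ≥ n^{-1}` for `p = 0`, and
`η ≥ n^{-1/min(p,2)} √(ln n)` for `p > 0`. -/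
def BallType.NotSuperSparse (T : BallType) (n : ℕ) (η : ℝ) : Prop :=
  match T with
  | .l0 => 1 / (n : ℝ) ≤ η
  | .strong p => 0 < p ∧ (n : ℝ) ^ (-(1 / min p 2)) * Real.sqrt (Real.log n) ≤ η
  | .weak p => 0 < p ∧ (n : ℝ) ^ (-(1 / min p 2)) * Real.sqrt (Real.log n) ≤ η

/-- The minimax rates for a single vector in the dense case. -/
def denseRate (n : ℕ) (σ : ℝ) : ℝ := σ ^ 2 * n

/-- The minimax rates for a single vector in the sparse case. They agree for strong and weak
`l_p`-balls except for an additional logarithm for the weak `l_2`-ball. -/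
def BallType.sparseRate (T : BallType) (n : ℕ) (σ η : ℝ) : ℝ :=
  match T with
  | .l0 => σ ^ 2 * n * η * Real.log η⁻¹
  | .strong p =>
      if p < 2 then σ ^ 2 * n * η ^ p * (Real.log (η ^ (-p))) ^ (1 - p / 2)
      else σ ^ 2 * n * η ^ 2
  | .weak p =>
      if p < 2 then σ ^ 2 * n * η ^ p * (Real.log (η ^ (-p))) ^ (1 - p / 2)
      else if p = 2 then σ ^ 2 * n * η ^ 2 * Real.log (η ^ (-2 : ℝ))
      else σ ^ 2 * n * η ^ 2

/-! ### The sparse group MAP estimator -/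

/-- The constant `c(γ) = 8 (γ + 3/4)²`. -/
def cGamma (γ : ℝ) : ℝ := 8 * (γ + 3 / 4) ^ 2

/-- The within-vector penalty for a prior `ϖ` on `{1, …, n}`. -/
def penWithin (n : ℕ) (γ σ : ℝ) (ϖ : ℕ → ℝ) (h : ℕ) : ℝ :=
  if h = 0 then 0
  else 2 * σ ^ 2 * (1 + 1 / γ) *
    Real.log ((ϖ h)⁻¹ * (n.choose h : ℝ) * (1 + γ) ^ ((h : ℝ) / 2))

/-- The between-vectors penalty for a prior `ϖ₀` on `{0, …, m}`. -/
def penBetween (m : ℕ) (γ σ : ℝ) (ϖ₀ : ℕ → ℝ) (k : ℕ) : ℝ :=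
  2 * σ ^ 2 * (1 + 1 / γ) * Real.log ((ϖ₀ k)⁻¹ * (m.choose k : ℝ))

/-- The penalized likelihood criterion
`∑_j {‖y_j - ν_j‖² + Pen_j(‖ν_j‖_0)} + Pen_0(#{j : ν_j ≠ 0})`. -/
def criterion (m n : ℕ) (γ σ : ℝ) (ϖ₀ : ℕ → ℝ) (ϖ : Fin m → ℕ → ℝ)
    (y ν : Fin m → Fin n → ℝ) : ℝ :=
  ∑ j, (∑ i, (y j i - ν j i) ^ 2 + penWithin n γ σ (ϖ j) (l0norm (ν j)))
    + penBetween m γ σ ϖ₀ (Finset.univ.filter fun j => l0norm (ν j) ≠ 0).card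

/-- `δ` is the sparse group MAP estimator: a measurable function of the data that minimizes the
penalized likelihood criterion for almost all data. (For data with some vanishing coordinate, a
null set, the infimum of the criterion need not be attained.) -/
def IsSparseGroupMAP (m n : ℕ) (γ σ : ℝ) (ϖ₀ : ℕ → ℝ) (ϖ : Fin m → ℕ → ℝ)
    (δ : (Fin m → Fin n → ℝ) → Fin m → Fin n → ℝ) : Prop :=
  Measurable δ ∧
    ∀ᵐ y : Fin m → Fin n → ℝ, ∀ ν : Fin m → Fin n → ℝ,
      criterion m n γ σ ϖ₀ ϖ y (δ y) ≤ criterion m n γ σ ϖ₀ ϖ y ν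

/-- A strictly positive probability distribution on the finite set `s` of natural numbers. -/
def IsPrior (s : Finset ℕ) (ϖ : ℕ → ℝ) : Prop :=
  (∀ k ∈ s, 0 < ϖ k) ∧ ∑ k ∈ s, ϖ k = 1

/-- The prior on the number of nonzero vectors satisfies
`ϖ₀(k) ≥ (k/m)^{c₀ k}` for `k = 1, …, ⌊m/e⌋` and `ϖ₀(m) ≥ e^{-c₀ m}`. -/
def BetweenPriorCondition (m : ℕ) (c₀ : ℝ) (ϖ₀ : ℕ → ℝ) : Prop :=
  (∀ k : ℕ, 1 ≤ k → k ≤ ⌊(m : ℝ) / Real.exp 1⌋₊ →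
      ((k : ℝ) / m) ^ (c₀ * k) ≤ ϖ₀ k) ∧
    Real.exp (-(c₀ * m)) ≤ ϖ₀ m

/-- The prior on the number of nonzero components satisfies
`ϖ(h) ≤ (n choose h) e^{-c(γ) h}` for `h = 1, …, n`,
`ϖ(h) ≥ (h/n)^{c₁ h}` for `h = 1, …, ⌊n e^{-c(γ)}⌋`, and `ϖ(n) ≥ e^{-c₂ n}`. -/
def WithinPriorCondition (n : ℕ) (γ c₁ c₂ : ℝ) (ϖ : ℕ → ℝ) : Prop :=
  (∀ h : ℕ, 1 ≤ h → h ≤ n → ϖ h ≤ (n.choose h : ℝ) * Real.exp (-(cGamma γ * h))) ∧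
    (∀ h : ℕ, 1 ≤ h → h ≤ ⌊(n : ℝ) * Real.exp (-cGamma γ)⌋₊ →
      ((h : ℝ) / n) ^ (c₁ * h) ≤ ϖ h) ∧
    Real.exp (-(c₂ * n)) ≤ ϖ n

end

end SparseGroup

/-!
The single-vector lower bounds and the risk bound of the estimator rest on one quantity: for a
vector `u` with `|u|` decreasing, the *truncated energy*
`∑ᵢ min (uᵢ², σ² (1 + log (n / i)))` (`truncEnergy`).

**Lower bound.** Cut the coordinates into blocks and put on each block, independently, the prior
"no spike with probability 1/2, one uniformly placed spike of height `τ` otherwise". On the event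
that the observation at the spike is at most `τ`, which has probability 1/2 under the spike, the
likelihood ratio of spike to no spike is at most `exp (τ² / (2σ²))`; hence a block with `N`
coordinates and `τ² ≤ σ² (1 + 2 log N)` contributes at least `τ² / 16` to the Bayes risk
(`two_point_bound`, `le_minimaxRisk_of_blocks`). The `i`-th of `n / 2` blocks may be given about
`√(n / i)` coordinates, because `∑ 1 / √i ≤ 2 √n`. So whenever a set `Θ` contains `u` and is closed
under permutation and shrinkage of coordinates, `R(Θ)` is at least a numerical constant times the
truncated energy of `u` (`IsSolid.truncEnergy_le_minimaxRisk`). All sparsity balls are solid in this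
sense, and the constant does not depend on the type of the ball or on `p`. Evaluating the truncated
energy of spikes, of constant vectors, and of the extremal vector of the weak `l₂`-ball gives every
single-vector lower bound. The matching upper bounds come from the identity, the zero estimator and
soft thresholding.

**Risk of the MAP estimator.** The penalty is `2σ² (1 + 1/γ)` times
`log (1 / π(M)) + (d_M / 2) log (1 + γ)`, where `π` is a probability distribution on supports `M`
and `d_M = |M|`. For `t = γ' / (1 + γ')` the variables `(1 - t)^{d_M / 2} exp (t ‖ε_M‖² / (2σ²))`
have mean one, so their `π`-mixture `Z` (`evidence`) has mean one as well, and
`‖ε_M‖² ≤ 2σ² (1 + 1/γ') (log (1 / π(M)) + (d_M / 2) log (1 + γ') + log Z)` simultaneously for all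
`M`. Since `log (1 / π(M)) ≥ c(γ) d_M`, with `γ' = 2γ` the right side is a fraction
`(4γ + 3) / (4γ + 4) < 1` of the penalty, plus a multiple of `σ² Z` (`sum_sq_support_le`). This
controls the noise on the random support of the estimator without any concentration inequality and
gives the oracle inequality `groupRisk_le_oracle`: the risk is at most a constant times
`‖μ - ν‖² + Pen(ν) + σ² |supp ν| + σ²` for every fixed `ν`.

It remains to choose `ν`. Keeping the `h` largest entries of `μ_j`, where `h` is the last index at
which `|μ_j|₍ᵢ₎²` exceeds `σ² (1 + log (n / i))`, costs at most a multiple of the truncated energy of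
`μ_j` plus `σ² (1 + log n)` (`exists_approximant`), and both are bounded by a multiple of
`R(Θ_j[η_j])` as the radius is not super-sparse. If `m₀ ≤ m / e` only the groups in `J` are
approximated by nonzero vectors, and `Pen₀(m₀)` is of order `σ² m₀ log (m / m₀)`. Otherwise `Pen₀(m₀)`
is not controlled, but `m ≤ e m₀`, so that all `m` groups may be given nonzero approximants, and
`Pen₀(m)` is of order `σ² m₀`.
-/

namespace SparseGroup

noncomputable section

/-! ### Gaussian laws: domination by Lebesgue measure and likelihood ratios -/

/-- Coordinatewise domination passes to product measures: by the maximality of the product outer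
measure it is enough to compare boxes. -/
theorem smul_pi_le_pi {ι : Type*} [Fintype ι] {X : ι → Type*} [∀ i, MeasurableSpace (X i)]
    {P Q : ∀ i, Measure (X i)} [∀ i, SigmaFinite (P i)] [∀ i, SigmaFinite (Q i)] (a : ι → ℝ≥0∞)
    (h : ∀ i (s : Set (X i)), a i * P i s ≤ Q i s) (s : Set (∀ i, X i)) :
    (∏ i, a i) * Measure.pi P s ≤ Measure.pi Q s := by
  have key : (∏ i, a i) • (Measure.pi P).toOuterMeasure
      ≤ OuterMeasure.pi fun i => (Q i).toOuterMeasure := by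
    rw [OuterMeasure.le_pi]
    intro s _
    simp only [FunLike.coe_smul, Pi.smul_apply, Measure.coe_toOuterMeasure, smul_eq_mul,
      Measure.pi_pi, ← Finset.prod_mul_distrib]
    exact Finset.prod_le_prod' fun i _ => h i _
  refine (key s).trans ?_
  rw [Measure.pi_def]
  exact le_toMeasure_apply _ _ _

theorem toNNReal_sq_ne_zero {σ : ℝ} (hσ : 0 < σ) : (σ ^ 2).toNNReal ≠ 0 := by
  simp; positivity

theorem coe_toNNReal_sq (σ : ℝ) : (((σ ^ 2).toNNReal : NNReal) : ℝ) = σ ^ 2 :=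
  Real.coe_toNNReal _ (sq_nonneg _)

instance (n : ℕ) (σ : ℝ) (μ : Fin n → ℝ) : IsProbabilityMeasure (vectorLaw n σ μ) := by
  unfold vectorLaw; infer_instance

instance (m n : ℕ) (σ : ℝ) (μ : Fin m → Fin n → ℝ) :
    IsProbabilityMeasure (groupLaw m n σ μ) := by
  unfold groupLaw; infer_instance

theorem pi_absolutelyContinuous {ι : Type*} [Fintype ι] {X : ι → Type*}
    [∀ i, MeasurableSpace (X i)] {P Q : ∀ i, Measure (X i)} [∀ i, SigmaFinite (P i)]
    [∀ i, SigmaFinite (Q i)] (a : ι → ℝ≥0∞) (ha : ∀ i, a i ≠ 0)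
    (h : ∀ i (s : Set (X i)), a i * P i s ≤ Q i s) : Measure.pi P ≪ Measure.pi Q := by
  intro s hs
  have := smul_pi_le_pi a h s
  rw [hs, nonpos_iff_eq_zero, mul_eq_zero] at this
  exact this.resolve_left (Finset.prod_ne_zero_iff.2 fun i _ => ha i)

theorem gaussianReal_le_smul_volume {v : NNReal} (hv : v ≠ 0) (x : ℝ) (s : Set ℝ) :
    ENNReal.ofReal (Real.sqrt (2 * Real.pi * v)) * gaussianReal x v s ≤ volume s := by
  rw [gaussianReal_apply _ hv, ← lintegral_const_mul _ (measurable_gaussianPDF _ _)]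
  calc _ ≤ ∫⁻ _ in s, 1 := by
        refine lintegral_mono fun y => ?_
        rw [gaussianPDF_def, ← ENNReal.ofReal_mul (Real.sqrt_nonneg _), ← ENNReal.ofReal_one]
        refine ENNReal.ofReal_le_ofReal ?_
        rw [gaussianPDFReal_def]
        have : 0 < Real.sqrt (2 * Real.pi * v) := by positivity
        rw [← mul_assoc, mul_inv_cancel₀ this.ne', one_mul]
        exact Real.exp_le_one_iff.2 (div_nonpos_of_nonpos_of_nonneg (by nlinarith [sq_nonneg (y - x)])
          (by positivity))
    _ = volume s := by simp

theorem groupLaw_absolutelyContinuous {m n : ℕ} {σ : ℝ} (hσ : 0 < σ) (μ : Fin m → Fin n → ℝ) :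
    groupLaw m n σ μ ≪ (volume : Measure (Fin m → Fin n → ℝ)) := by
  have h := toNNReal_sq_ne_zero hσ
  have h1 : ENNReal.ofReal (Real.sqrt (2 * Real.pi * (σ ^ 2).toNNReal)) ≠ 0 := by
    simp only [ne_eq, ENNReal.ofReal_eq_zero, not_le]; positivity
  unfold groupLaw
  refine pi_absolutelyContinuous (Q := fun _ => volume)
    (fun _ => ∏ _i : Fin n, ENNReal.ofReal (Real.sqrt (2 * Real.pi * (σ ^ 2).toNNReal)))
    (fun _ => Finset.prod_ne_zero_iff.2 fun _ _ => h1) fun j s => ?_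
  exact smul_pi_le_pi (Q := fun _ => volume) _ (fun i s => gaussianReal_le_smul_volume h _ s) s

/-- Below `τ` the density of the spike law `N(τ, σ²)` is at most `e^{1/2} M` times that of
`N(0, σ²)`. -/
theorem gaussianReal_restrict_le {σ τ M : ℝ} (hσ : 0 < σ) (hτ : 0 ≤ τ) (hM : 0 < M)
    (h : τ ^ 2 ≤ σ ^ 2 * (1 + 2 * Real.log M)) (s : Set ℝ) :
    ENNReal.ofReal (Real.exp (-(1 / 2)) / M) *
      (gaussianReal τ (σ ^ 2).toNNReal).restrict (Set.Iic τ) s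
      ≤ gaussianReal 0 (σ ^ 2).toNNReal s := by
  have hv := toNNReal_sq_ne_zero hσ
  rw [Measure.restrict_apply' measurableSet_Iic, gaussianReal_apply _ hv, gaussianReal_apply _ hv,
    ← lintegral_const_mul _ (measurable_gaussianPDF _ _)]
  refine le_trans ?_ (lintegral_mono_set (Set.inter_subset_left (t := Set.Iic τ)))
  rw [← Measure.restrict_restrict_of_subset (s := s ∩ Set.Iic τ) (t := Set.Iic τ)
    Set.inter_subset_right]
  refine lintegral_mono_ae ?_
  have : ∀ᵐ y ∂((volume.restrict (Set.Iic τ)).restrict (s ∩ Set.Iic τ)), y ∈ Set.Iic τ :=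
    ae_mono Measure.restrict_le_self (ae_restrict_mem measurableSet_Iic)
  filter_upwards [this] with y hy
  simp only [gaussianPDF_def]
  rw [← ENNReal.ofReal_mul (by positivity)]
  refine ENNReal.ofReal_le_ofReal ?_
  rw [gaussianPDFReal_def, gaussianPDFReal_def, coe_toNNReal_sq]
  have e : Real.exp (-(1 / 2)) / M = Real.exp (-(1 / 2) - Real.log M) := by
    rw [Real.exp_sub, Real.exp_log hM]
  rw [e, mul_left_comm, ← Real.exp_add]
  refine mul_le_mul_of_nonneg_left (Real.exp_le_exp.2 ?_) (by positivity)
  have hy' : y ≤ τ := hy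
  rw [← sub_nonneg]
  have : -(y - 0) ^ 2 / (2 * σ ^ 2) - (-(1 / 2) - Real.log M + -(y - τ) ^ 2 / (2 * σ ^ 2))
    = ((σ ^ 2 * (1 + 2 * Real.log M) - τ ^ 2) + 2 * τ * (τ - y)) / (2 * σ ^ 2) := by
    field_simp; ring
  rw [this]
  have := mul_nonneg hτ (sub_nonneg.2 hy')
  exact div_nonneg (by nlinarith) (by positivity)

theorem gaussianReal_Iic_self {v : NNReal} (hv : v ≠ 0) (x : ℝ) :
    gaussianReal x v (Set.Iic x) = 2⁻¹ := by
  have : NullSingletonClass (gaussianReal x v) := nullSingletonClass_gaussianReal hv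
  have h1 : gaussianReal x v (Set.Iic x) = gaussianReal x v (Set.Ici x) := by
    have e : (gaussianReal x v).map (fun y => 2 * x - y) = gaussianReal x v := by
      rw [gaussianReal_map_const_sub]; congr 1; ring
    conv_lhs => rw [← e]
    rw [Measure.map_apply (by fun_prop) measurableSet_Iic]
    congr 1
    ext y; simp only [Set.mem_preimage, Set.mem_Iic, Set.mem_Ici]
    constructor <;> intro h <;> linarith
  have h2 : gaussianReal x v (Set.Iic x) + gaussianReal x v (Set.Ioi x) = 1 := by
    rw [← measure_union (by simp) measurableSet_Ioi, Set.Iic_union_Ioi, measure_univ]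
  rw [measure_congr Ioi_ae_eq_Ici, ← h1, ← two_mul] at h2
  rw [ENNReal.eq_inv_of_mul_eq_one_left (a := gaussianReal x v (Set.Iic x)) (b := 2)]
  rw [mul_comm]; exact h2

/-! ### The block lower bound for the minimax risk -/

/-- Bayes risk of one coordinate `i` when the mean has either no spike or, with relative weight `1 / N`,
a spike of height `τ` at `i`: comparison of the two laws on `{y | y i ≤ τ}`. -/
theorem two_point_bound {n : ℕ} {σ τ : ℝ} {N : ℕ} (hσ : 0 < σ) (hτ : 0 ≤ τ) (hN : 1 ≤ N)
    (h : τ ^ 2 ≤ σ ^ 2 * (1 + 2 * Real.log N)) (μ : Fin n → ℝ) (i : Fin n) (hμ : μ i = 0)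
    (δ : (Fin n → ℝ) → ℝ) (hδ : Measurable δ) :
    ENNReal.ofReal (τ ^ 2 / (8 * N)) ≤
      (∫⁻ y, ENNReal.ofReal ((δ y - 0) ^ 2) ∂(vectorLaw n σ μ)) +
        ENNReal.ofReal (1 / N) * ∫⁻ y, ENNReal.ofReal ((δ y - τ) ^ 2)
          ∂(vectorLaw n σ (Function.update μ i τ)) := by
  have hN' : (0 : ℝ) < N := by exact_mod_cast hN
  have hv := toNNReal_sq_ne_zero hσ
  set a : ℝ≥0∞ := ENNReal.ofReal (Real.exp (-(1 / 2)) / N) with ha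
  set t : Fin n → Set ℝ := fun k => if k = i then Set.Iic τ else Set.univ with ht
  set Q : Measure (Fin n → ℝ) :=
    (vectorLaw n σ (Function.update μ i τ)).restrict (Set.univ.pi t) with hQ
  have hQ2 : a • Q ≤ vectorLaw n σ μ := by
    intro s
    rw [hQ, vectorLaw, Measure.restrict_pi_pi, Measure.smul_apply, smul_eq_mul]
    have : a = ∏ k : Fin n, if k = i then a else 1 := by simp
    rw [this]
    refine smul_pi_le_pi _ (fun k s => ?_) s
    by_cases hk : k = i
    · subst hk
      simp only [if_true, Function.update_self, hμ]
      exact gaussianReal_restrict_le hσ hτ hN' h s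
    · simp only [hk, if_false, Function.update_of_ne hk, Measure.restrict_univ, one_mul]
      exact le_rfl
  have haN : a ≤ ENNReal.ofReal (1 / N) := by
    refine ENNReal.ofReal_le_ofReal (div_le_div_of_nonneg_right ?_ hN'.le)
    exact Real.exp_le_one_iff.2 (by norm_num)
  have hQu : Q Set.univ = 2⁻¹ := by
    rw [hQ, Measure.restrict_apply_univ, vectorLaw, Measure.pi_pi,
      Finset.prod_eq_single i]
    · simp only [ht, if_true, Function.update_self]
      exact gaussianReal_Iic_self hv τ
    · intro k _ hk
      simp [ht, hk]
    · simp
  calc ENNReal.ofReal (τ ^ 2 / (8 * N)) ≤ a * (ENNReal.ofReal (τ ^ 2 / 2) * Q Set.univ) := by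
        rw [hQu, ← ENNReal.ofReal_ofNat 2, ← ENNReal.ofReal_inv_of_pos (by norm_num),
          ← ENNReal.ofReal_mul (by positivity), ← ENNReal.ofReal_mul (by positivity)]
        refine ENNReal.ofReal_le_ofReal ?_
        have : (1 : ℝ) / 2 ≤ Real.exp (-(1 / 2)) := by
          have := Real.add_one_le_exp (-(1 / 2 : ℝ)); linarith
        have e : Real.exp (-(1 / 2)) / N * (τ ^ 2 / 2 * 2⁻¹)
          = Real.exp (-(1 / 2)) * (τ ^ 2 / (4 * N)) := by field_simp; ring
        have e2 : τ ^ 2 / (8 * N) = 1 / 2 * (τ ^ 2 / (4 * N)) := by field_simp; ring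
        rw [e, e2]
        exact mul_le_mul_of_nonneg_right this (by positivity)
    _ = a * ∫⁻ _, ENNReal.ofReal (τ ^ 2 / 2) ∂Q := by rw [lintegral_const]
    _ ≤ a * ∫⁻ y, (ENNReal.ofReal ((δ y - 0) ^ 2) + ENNReal.ofReal ((δ y - τ) ^ 2)) ∂Q := by
        refine mul_le_mul_right (lintegral_mono fun y => ?_) a
        rw [← ENNReal.ofReal_add (sq_nonneg _) (sq_nonneg _)]
        refine ENNReal.ofReal_le_ofReal ?_
        nlinarith [sq_nonneg (δ y - 0 + (δ y - τ))]
    _ = a * ∫⁻ y, ENNReal.ofReal ((δ y - 0) ^ 2) ∂Q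
          + a * ∫⁻ y, ENNReal.ofReal ((δ y - τ) ^ 2) ∂Q := by
        rw [lintegral_add_left (by fun_prop), mul_add]
    _ ≤ _ := by
        refine add_le_add ?_ (mul_le_mul' haN (lintegral_mono' Measure.restrict_le_self le_rfl))
        rw [← smul_eq_mul, ← lintegral_smul_measure]
        exact lintegral_mono' hQ2 le_rfl

/-- The mean vector of a spike configuration. The map `β` assigns to each coordinate its block, and
`ω b` is the position of the spike of height `τ b` in block `b`, or `none`; positions outside the
block are ignored. -/
def spikeVector {n s : ℕ} (β : Fin n → Fin s) (τ : Fin s → ℝ) (ω : Fin s → Option (Fin n))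
    (i : Fin n) : ℝ :=
  if ω (β i) = some i then τ (β i) else 0

/-- The prior on the spike position in block `b`: no spike with weight `1/2`, otherwise uniform on the
block. -/
def spikePrior {n s : ℕ} (β : Fin n → Fin s) (b : Fin s) : Option (Fin n) → ℝ≥0∞
  | none => 2⁻¹
  | some i => if β i = b then 2⁻¹ * ENNReal.ofReal
      (1 / ((Finset.univ.filter fun k => β k = b).card : ℝ)) else 0

theorem sum_spikePrior {n s : ℕ} (β : Fin n → Fin s) (b : Fin s)
    (hb : (Finset.univ.filter fun k => β k = b).Nonempty) :
    ∑ x, spikePrior β b x = 1 := by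
  have hc : (0 : ℝ) < ((Finset.univ.filter fun k => β k = b).card : ℝ) := by
    exact_mod_cast hb.card_pos
  rw [Fintype.sum_option]
  simp only [spikePrior]
  rw [← Finset.sum_filter, Finset.sum_const, nsmul_eq_mul, mul_left_comm,
    ← ENNReal.ofReal_natCast, ← ENNReal.ofReal_mul hc.le, mul_one_div_cancel hc.ne']
  simp [ENNReal.inv_two_add_inv_two]

/-- Under a product weight, redrawing the coordinate `b` does not change weighted sums. -/
theorem sum_prod_resample {ι X : Type*} [Fintype ι] [DecidableEq ι] [Fintype X]
    (u : ι → X → ℝ≥0∞) (b : ι) (hu : ∑ x, u b x = 1) (G : (ι → X) → ℝ≥0∞) :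
    ∑ ω, (∏ k, u k (ω k)) * G ω =
      ∑ ω, (∏ k, u k (ω k)) * ∑ x, u b x * G (Function.update ω b x) := by
  classical
  have h1 : ∑ ω, (∏ k, u k (ω k)) * G ω
      = ∑ p : (ι → X) × X, (∏ k, u k (p.1 k)) * u b p.2 * G p.1 := by
    rw [Fintype.sum_prod_type]
    refine Finset.sum_congr rfl fun ω _ => ?_
    simp only
    rw [← Finset.sum_mul, ← Finset.mul_sum, hu, mul_one]
  have h2 : ∑ ω, (∏ k, u k (ω k)) * ∑ x, u b x * G (Function.update ω b x)
      = ∑ p : (ι → X) × X, (∏ k, u k (p.1 k)) * u b p.2 * G (Function.update p.1 b p.2) := by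
    rw [Fintype.sum_prod_type]
    refine Finset.sum_congr rfl fun ω _ => ?_
    rw [Finset.mul_sum]
    exact Finset.sum_congr rfl fun x _ => by rw [mul_assoc]
  rw [h1, h2]
  refine Finset.sum_nbij' (fun p => (Function.update p.1 b p.2, p.1 b))
    (fun p => (Function.update p.1 b p.2, p.1 b)) (by simp) (by simp) (by simp) (by simp) ?_
  rintro ⟨ω, x⟩ -
  simp only [Function.update_idem, Function.update_eq_self]
  congr 1
  rw [← Finset.mul_prod_erase _ _ (Finset.mem_univ b),
    ← Finset.mul_prod_erase _ (fun k => u k (Function.update ω b x k)) (Finset.mem_univ b),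
    Function.update_self]
  have : ∏ k ∈ Finset.univ.erase b, u k (Function.update ω b x k)
      = ∏ k ∈ Finset.univ.erase b, u k (ω k) :=
    Finset.prod_congr rfl fun k hk => by rw [Function.update_of_ne (Finset.ne_of_mem_erase hk)]
  rw [this]; ring

/-- If a set contains all spike configurations of a block structure, its minimax risk is at least
`1 / 16` of the sum of the squared heights. The sum over the product prior is reduced to
`two_point_bound` by redrawing one block at a time. -/
theorem le_minimaxRisk_of_blocks {n s : ℕ} {σ : ℝ} (hσ : 0 < σ) (Θ : Set (Fin n → ℝ))
    (β : Fin n → Fin s) (hβ : Function.Surjective β) (τ : Fin s → ℝ) (hτ : ∀ b, 0 ≤ τ b)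
    (h : ∀ b, τ b ^ 2 ≤ σ ^ 2 *
      (1 + 2 * Real.log ((Finset.univ.filter fun k => β k = b).card : ℝ)))
    (hΘ : ∀ ω, spikeVector β τ ω ∈ Θ) :
    ENNReal.ofReal (1 / 16 * ∑ b, τ b ^ 2) ≤ minimaxRisk n σ Θ := by
  classical
  refine le_iInf₂ fun δ hδ => ?_
  set w : (Fin s → Option (Fin n)) → ℝ≥0∞ := fun ω => ∏ b, spikePrior β b (ω b) with hw
  have hne : ∀ b, (Finset.univ.filter fun k => β k = b).Nonempty := fun b => by
    obtain ⟨i, hi⟩ := hβ b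
    exact ⟨i, by simp [hi]⟩
  have hu : ∀ b, ∑ x, spikePrior β b x = 1 := fun b => sum_spikePrior β b (hne b)
  have hw1 : ∑ ω, w ω = 1 := by
    rw [hw, ← Fintype.prod_sum (fun b x => spikePrior β b x)]
    exact Finset.prod_eq_one fun b _ => hu b
  set g : Fin n → (Fin s → Option (Fin n)) → ℝ≥0∞ := fun i ω =>
    ∫⁻ y, ENNReal.ofReal ((δ y i - spikeVector β τ ω i) ^ 2)
      ∂(vectorLaw n σ (spikeVector β τ ω)) with hg
  have hrisk : ∀ ω, vectorRisk n σ δ (spikeVector β τ ω)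
      = ∑ b, ∑ i with β i = b, g i ω := by
    intro ω
    rw [Finset.sum_fiberwise, vectorRisk, hg]
    simp only
    rw [← lintegral_finsetSum _ (fun i _ => by fun_prop)]
    refine lintegral_congr fun y => ?_
    exact ENNReal.ofReal_sum_of_nonneg fun _ _ => sq_nonneg _
  have hblock : ∀ b, ENNReal.ofReal (1 / 16 * τ b ^ 2) ≤ ∑ ω, w ω * ∑ i with β i = b, g i ω := by
    intro b
    set N := (Finset.univ.filter fun k => β k = b).card with hN
    have hN1 : 1 ≤ N := (hne b).card_pos
    have hN0 : (0 : ℝ) < N := by exact_mod_cast hN1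
    rw [hw]
    simp only
    rw [sum_prod_resample (fun b x => spikePrior β b x) b (hu b)]
    have key : ∀ ω, ENNReal.ofReal (1 / 16 * τ b ^ 2) ≤
        ∑ x, spikePrior β b x * ∑ i with β i = b, g i (Function.update ω b x) := by
      intro ω
      rw [Fintype.sum_option]
      have h2 : ∑ k, spikePrior β b (some k) *
            ∑ i with β i = b, g i (Function.update ω b (some k))
          ≥ ∑ k with β k = b, 2⁻¹ * ENNReal.ofReal (1 / N) *
              g k (Function.update ω b (some k)) := by
        rw [ge_iff_le, Finset.sum_filter]
        refine Finset.sum_le_sum fun k _ => ?_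
        simp only [spikePrior]
        split_ifs with hk
        · refine mul_le_mul_right ?_ _
          exact Finset.single_le_sum (f := fun i => g i (Function.update ω b (some k)))
            (fun _ _ => zero_le) (by simp [hk])
        · simp
      refine le_trans ?_ (add_le_add_right h2 _)
      simp only [spikePrior]
      rw [Finset.mul_sum, ← Finset.sum_add_distrib]
      have h3 : ∀ k ∈ Finset.univ.filter (fun k => β k = b),
          ENNReal.ofReal (1 / 2 * (τ b ^ 2 / (8 * N))) ≤
          2⁻¹ * g k (Function.update ω b none) + 2⁻¹ * ENNReal.ofReal (1 / N) *
              g k (Function.update ω b (some k)) := by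
        intro k hk
        have hk : β k = b := by simpa using hk
        have e0 : spikeVector β τ (Function.update ω b none) k = 0 := by
          simp [spikeVector, hk]
        have e1 : spikeVector β τ (Function.update ω b (some k)) k = τ b := by
          simp [spikeVector, hk]
        have e2 : spikeVector β τ (Function.update ω b (some k))
            = Function.update (spikeVector β τ (Function.update ω b none)) k (τ b) := by
          ext i
          by_cases hik : i = k
          · subst hik; rw [Function.update_self, e1]
          · rw [Function.update_of_ne hik]
            simp only [spikeVector]
            by_cases hib : β i = b
            · have : k ≠ i := fun h => hik h.symm
              simp [hib, this]
            · simp [Function.update_of_ne hib]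
        have := two_point_bound hσ (hτ b) hN1 (h b)
          (spikeVector β τ (Function.update ω b none)) k e0 (fun y => δ y k) (by fun_prop)
        rw [mul_assoc, ← mul_add, ENNReal.ofReal_mul (by norm_num)]
        refine mul_le_mul' ?_ ?_
        · rw [one_div, ENNReal.ofReal_inv_of_pos (by norm_num), ENNReal.ofReal_ofNat]
        · rw [hg]
          simp only
          rw [e0, e1, e2]
          exact this
      refine le_trans (le_of_eq ?_) (Finset.sum_le_sum h3)
      rw [Finset.sum_const, ← hN, nsmul_eq_mul, ← ENNReal.ofReal_natCast,
        ← ENNReal.ofReal_mul hN0.le]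
      congr 1
      field_simp; ring
    calc ENNReal.ofReal (1 / 16 * τ b ^ 2)
        = ∑ ω, w ω * ENNReal.ofReal (1 / 16 * τ b ^ 2) := by
          rw [← Finset.sum_mul, hw1, one_mul]
      _ ≤ _ := Finset.sum_le_sum fun ω _ => mul_le_mul_right (key ω) _
  calc ENNReal.ofReal (1 / 16 * ∑ b, τ b ^ 2)
      = ∑ b, ENNReal.ofReal (1 / 16 * τ b ^ 2) := by
        rw [Finset.mul_sum, ENNReal.ofReal_sum_of_nonneg fun _ _ => by positivity]
    _ ≤ ∑ b, ∑ ω, w ω * ∑ i with β i = b, g i ω := Finset.sum_le_sum fun b _ => hblock b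
    _ = ∑ ω, w ω * vectorRisk n σ δ (spikeVector β τ ω) := by
        rw [Finset.sum_comm]
        refine Finset.sum_congr rfl fun ω _ => ?_
        rw [hrisk, Finset.mul_sum]
    _ ≤ ∑ ω, w ω * ⨆ μ ∈ Θ, vectorRisk n σ δ μ :=
        Finset.sum_le_sum fun ω _ => mul_le_mul_right
          (le_iSup₂ (f := fun μ (_ : μ ∈ Θ) => vectorRisk n σ δ μ) _ (hΘ ω)) _
    _ = ⨆ μ ∈ Θ, vectorRisk n σ δ μ := by rw [← Finset.sum_mul, hw1, one_mul]

/-! ### Solid sets and the truncated energy -/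

/-- A set of vectors is solid if it contains every `v` whose nonzero entries are dominated in absolute
value by distinct entries of a member `u`. This combines closure under permutations, sign changes
and shrinkage of coordinates. -/
def IsSolid {n : ℕ} (Θ : Set (Fin n → ℝ)) : Prop :=
  ∀ u ∈ Θ, ∀ (v : Fin n → ℝ) (e : Fin n → Fin n), Set.InjOn e {i | v i ≠ 0} →
    (∀ i, v i ≠ 0 → |v i| ≤ |u (e i)|) → v ∈ Θ

/-- The truncated energy `∑ᵢ min (uᵢ², σ² (1 + log (n / i)))`, with `i` counted from one. It is meant
for vectors `u` with decreasing absolute values. -/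
def truncEnergy (n : ℕ) (σ : ℝ) (u : Fin n → ℝ) : ℝ :=
  ∑ i : Fin n, min (u i ^ 2) (σ ^ 2 * (1 + Real.log ((n : ℝ) / ((i : ℕ) + 1 : ℝ))))

/-- `n` points can be distributed over `s` fibres of prescribed sizes of total at most `n`; the
remaining points only enlarge the fibres. -/
theorem exists_map_card_fiber_ge {n s : ℕ} (hs : 0 < s) (N : Fin s → ℕ) (hN : ∑ b, N b ≤ n) :
    ∃ β : Fin n → Fin s, ∀ b, N b ≤ (Finset.univ.filter fun k => β k = b).card := by
  classical
  have : Fintype.card (Σ b, Fin (N b)) ≤ Fintype.card (Fin n) := by simpa using hN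
  obtain ⟨f⟩ := Function.Embedding.nonempty_of_card_le this
  by_cases h0 : IsEmpty (Σ b, Fin (N b))
  · refine ⟨fun _ => ⟨0, hs⟩, fun b => ?_⟩
    rcases Nat.eq_zero_or_pos (N b) with h | h
    · simp [h]
    · exact (h0.false ⟨b, ⟨0, h⟩⟩).elim
  rw [not_isEmpty_iff] at h0
  refine ⟨fun i => (Function.invFun f i).1, fun b => ?_⟩
  have hc : N b = ((Finset.univ : Finset (Fin (N b))).map
      ⟨fun k => f ⟨b, k⟩, fun k l h => by simpa using f.injective h⟩).card := by simp
  rw [hc]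
  refine Finset.card_le_card fun i hi => ?_
  simp only [Finset.mem_map, Finset.mem_univ, true_and] at hi
  obtain ⟨k, rfl⟩ := hi
  exact Finset.mem_filter.2 ⟨Finset.mem_univ _,
    congrArg Sigma.fst (Function.leftInverse_invFun f.injective ⟨b, k⟩)⟩

theorem sum_inv_sqrt_le (s : ℕ) : ∑ i ∈ Finset.range s, 1 / Real.sqrt (i + 1) ≤ 2 * Real.sqrt s := by
  induction s with
  | zero => simp
  | succ k ih =>
    rw [Finset.sum_range_succ]
    have h1 := Real.sqrt_nonneg (k : ℝ)
    have h2 : 0 < Real.sqrt ((k : ℝ) + 1) := by positivity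
    have e1 := Real.sq_sqrt (Nat.cast_nonneg (α := ℝ) k)
    have e2 := Real.sq_sqrt (by positivity : (0 : ℝ) ≤ k + 1)
    have : 1 / Real.sqrt (k + 1) ≤ 2 * (Real.sqrt (k + 1) - Real.sqrt k) := by
      rw [div_le_iff₀ h2]
      nlinarith [sq_nonneg (Real.sqrt ((k : ℝ) + 1) - Real.sqrt k)]
    push_cast
    linarith

theorem half_pos_of_two_le {n : ℕ} (hn : 2 ≤ n) : 0 < n / 2 := by omega

theorem log_div_nonneg {n : ℕ} {x : ℝ} (hx : 0 < x) (hxn : x ≤ n) :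
    0 ≤ Real.log ((n : ℝ) / x) :=
  Real.log_nonneg (by rwa [one_le_div hx])

/-- Lower bound through the first `n / 2` coordinates of a member `u`, in any order: the block that
carries a spike of the size of `u b` gets more than `√(n / (b + 1)) / 4` coordinates. -/
theorem IsSolid.le_minimaxRisk {n : ℕ} (hn : 2 ≤ n) {σ : ℝ} (hσ : 0 < σ) {Θ : Set (Fin n → ℝ)}
    (hΘ : IsSolid Θ) {u : Fin n → ℝ} (hu : u ∈ Θ) :
    ENNReal.ofReal (1 / 64 * ∑ b : Fin (n / 2), min (u (b.castLE (Nat.div_le_self n 2)) ^ 2)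
      (σ ^ 2 * (1 + Real.log ((n : ℝ) / ((b : ℕ) + 1 : ℝ))))) ≤ minimaxRisk n σ Θ := by
  classical
  have hs := half_pos_of_two_le hn
  have hn0 : (0 : ℝ) < n := by exact_mod_cast (by omega : 0 < n)
  -- The sizes `1 + ⌊√(n / (b + 1)) / 4⌋` of the `n / 2` blocks add up to at most `n / 2 + n / 2`.
  set x : Fin (n / 2) → ℝ := fun b => Real.sqrt ((n : ℝ) / ((b : ℕ) + 1)) with hx
  set N : Fin (n / 2) → ℕ := fun b => 1 + ⌊x b / 4⌋₊ with hN
  have hNsum : ∑ b, N b ≤ n := by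
    have h1 : ((∑ b, N b : ℕ) : ℝ) ≤ n := by
      push_cast [hN]
      rw [Finset.sum_add_distrib]
      have h2 : ∑ b : Fin (n / 2), ((⌊x b / 4⌋₊ : ℕ) : ℝ) ≤ ∑ b : Fin (n / 2), x b / 4 :=
        Finset.sum_le_sum fun b _ => Nat.floor_le (by positivity)
      have h3 : ∑ b : Fin (n / 2), x b / 4
          = Real.sqrt n / 4 * ∑ i ∈ Finset.range (n / 2), 1 / Real.sqrt (i + 1) := by
        rw [Finset.mul_sum, Finset.sum_range]
        refine Finset.sum_congr rfl fun b _ => ?_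
        rw [hx]
        simp only
        rw [Real.sqrt_div hn0.le]; ring
      have h4 : Real.sqrt (n / 2 : ℕ) ≤ Real.sqrt n :=
        Real.sqrt_le_sqrt (by exact_mod_cast Nat.div_le_self n 2)
      have h5 := sum_inv_sqrt_le (n / 2)
      have h6 : Real.sqrt n / 4 * ∑ i ∈ Finset.range (n / 2), 1 / Real.sqrt (i + 1) ≤ n / 2 := by
        calc _ ≤ Real.sqrt n / 4 * (2 * Real.sqrt n) :=
              mul_le_mul_of_nonneg_left (by linarith) (by positivity)
          _ = (Real.sqrt n) ^ 2 / 2 := by ring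
          _ = n / 2 := by rw [Real.sq_sqrt hn0.le]
      have h7 : ((n / 2 : ℕ) : ℝ) ≤ n / 2 := Nat.cast_div_le
      simp only [Finset.sum_const, Finset.card_univ, Fintype.card_fin, nsmul_eq_mul, mul_one]
      linarith
    exact_mod_cast h1
  obtain ⟨β, hβ⟩ := exists_map_card_fiber_ge hs N hNsum
  set a : Fin (n / 2) → ℝ := fun b => min (u (b.castLE (Nat.div_le_self n 2)) ^ 2)
      (σ ^ 2 * (1 + Real.log ((n : ℝ) / ((b : ℕ) + 1 : ℝ)))) with ha
  have hlog : ∀ b : Fin (n / 2), 0 ≤ Real.log ((n : ℝ) / ((b : ℕ) + 1 : ℝ)) := fun b => by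
    refine log_div_nonneg (by positivity) ?_
    have := b.2
    exact_mod_cast (by omega : (b : ℕ) + 1 ≤ n)
  have ha0 : ∀ b, 0 ≤ a b := fun b => le_min (sq_nonneg _)
    (mul_nonneg (sq_nonneg _) (by linarith [hlog b]))
  set τ : Fin (n / 2) → ℝ := fun b => 1 / 2 * Real.sqrt (a b) with hτ
  have hτ2 : ∀ b, τ b ^ 2 = 1 / 4 * a b := fun b => by
    rw [hτ]; simp only; rw [mul_pow, Real.sq_sqrt (ha0 b)]; norm_num
  have hmain := le_minimaxRisk_of_blocks hσ Θ β (fun b => ?_) τ (fun b => by positivity)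
    (fun b => ?_) (fun ω => ?_)
  · refine le_trans (le_of_eq ?_) hmain
    congr 1
    simp_rw [hτ2]
    rw [← Finset.mul_sum]; ring
  · have : 0 < (Finset.univ.filter fun k => β k = b).card :=
      lt_of_lt_of_le (by simp [hN]) (hβ b)
    obtain ⟨i, hi⟩ := Finset.card_pos.1 this
    exact ⟨i, by simpa using hi⟩
  · set c : ℝ := ((Finset.univ.filter fun k => β k = b).card : ℝ)
    have hc : (N b : ℝ) ≤ c := Nat.cast_le.2 (hβ b)
    have hNx : x b / 4 ≤ N b := by
      rw [hN]; push_cast; linarith [Nat.lt_floor_add_one (x b / 4)]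
    have hN1 : (1 : ℝ) ≤ N b := by rw [hN]; push_cast; linarith [Nat.cast_nonneg (α := ℝ) ⌊x b / 4⌋₊]
    have hx0 : 0 < x b := by positivity
    have hl : Real.log (x b) ≤ Real.log 4 + Real.log c := by
      rw [← Real.log_mul (by norm_num) (by linarith)]
      exact Real.log_le_log hx0 (by linarith)
    have hl2 : Real.log ((n : ℝ) / ((b : ℕ) + 1 : ℝ)) = 2 * Real.log (x b) := by
      rw [hx]; simp only
      rw [Real.log_sqrt (by positivity)]; ring
    have hl4 : Real.log 4 ≤ 1.4 := by
      rw [show (4 : ℝ) = 2 ^ 2 by norm_num, Real.log_pow]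
      have := Real.log_two_lt_d9
      push_cast; linarith
    have hlc : 0 ≤ Real.log c := Real.log_nonneg (by linarith)
    rw [hτ2]
    have h1 : a b ≤ σ ^ 2 * (1 + Real.log ((n : ℝ) / ((b : ℕ) + 1 : ℝ))) := min_le_right _ _
    rw [hl2] at h1
    have h2 : σ ^ 2 * (1 + 2 * Real.log (x b)) ≤ σ ^ 2 * (4 * (1 + 2 * Real.log c)) :=
      mul_le_mul_of_nonneg_left (by linarith) (sq_nonneg _)
    linarith
  · have hsup : ∀ i, spikeVector β τ ω i ≠ 0 → ω (β i) = some i := by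
      intro i hi
      by_contra h
      exact hi (by simp [spikeVector, h])
    refine hΘ u hu _ (fun i => (β i).castLE (Nat.div_le_self n 2)) ?_ ?_
    · intro i hi j hj hij
      have hij : β i = β j := Fin.castLE_injective _ hij
      have h1 := hsup i hi
      have h2 := hsup j hj
      rw [hij, h2] at h1
      exact (Option.some.inj h1).symm
    · intro i hi
      have e : spikeVector β τ ω i = τ (β i) := by simp [spikeVector, hsup i hi]
      rw [e, abs_of_nonneg (by positivity)]
      refine abs_le_of_sq_le_sq' ?_ (abs_nonneg _) |>.2
      rw [hτ2, sq_abs]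
      have : a (β i) ≤ u ((β i).castLE (Nat.div_le_self n 2)) ^ 2 := min_le_left _ _
      linarith [ha0 (β i)]

theorem sum_le_three_mul_sum_half {n : ℕ} (hn : 2 ≤ n) (f : Fin n → ℝ) (hf : Antitone f)
    (h0 : ∀ i, 0 ≤ f i) :
    ∑ i, f i ≤ 3 * ∑ b : Fin (n / 2), f (b.castLE (Nat.div_le_self n 2)) := by
  set s := n / 2 with hs
  set F : ℕ → ℝ := fun k => if h : k < n then f ⟨k, h⟩ else 0 with hF
  have hF0 : ∀ k, 0 ≤ F k := fun k => by
    rw [hF]; simp only; split_ifs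
    · exact h0 _
    · exact le_rfl
  have hanti : Antitone F := by
    intro a b hab
    simp only [hF]
    split_ifs with h1 h2
    · exact hf (by simpa using hab)
    · omega
    · exact h0 _
    · exact le_rfl
  have e1 : ∑ i, f i = ∑ k ∈ Finset.range n, F k := by
    rw [Finset.sum_range]
    exact Finset.sum_congr rfl fun i _ => by simp [hF]
  have e2 : ∑ b : Fin s, f (b.castLE (Nat.div_le_self n 2)) = ∑ k ∈ Finset.range s, F k := by
    rw [Finset.sum_range]
    refine Finset.sum_congr rfl fun i _ => ?_
    have : (i : ℕ) < n := by have := i.2; omega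
    simp [hF, this]
    rfl
  rw [e1, e2]
  calc ∑ k ∈ Finset.range n, F k ≤ ∑ k ∈ Finset.range (s + s + s), F k :=
        Finset.sum_le_sum_of_subset_of_nonneg
          (Finset.range_subset_range.2 (by omega)) fun _ _ _ => hF0 _
    _ ≤ _ := by
        rw [Finset.sum_range_add, Finset.sum_range_add]
        have a1 : ∑ x ∈ Finset.range s, F (s + x) ≤ ∑ k ∈ Finset.range s, F k :=
          Finset.sum_le_sum fun k _ => hanti (by omega)
        have a2 : ∑ x ∈ Finset.range s, F (s + s + x) ≤ ∑ k ∈ Finset.range s, F k :=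
          Finset.sum_le_sum fun k _ => hanti (by omega)
        linarith

theorem antitone_trunc {n : ℕ} (σ : ℝ) {u : Fin n → ℝ} (hu : Antitone fun i => |u i|) :
    Antitone fun i : Fin n =>
      min (u i ^ 2) (σ ^ 2 * (1 + Real.log ((n : ℝ) / ((i : ℕ) + 1 : ℝ)))) := by
  intro i j hij
  have hn : (0 : ℝ) < n := by exact_mod_cast i.pos
  refine min_le_min (sq_le_sq.2 (hu hij)) (mul_le_mul_of_nonneg_left ?_ (sq_nonneg _))
  have : ((i : ℕ) : ℝ) ≤ (j : ℕ) := by exact_mod_cast hij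
  gcongr

theorem trunc_nonneg {n : ℕ} (σ : ℝ) (u : Fin n → ℝ) (i : Fin n) :
    0 ≤ min (u i ^ 2) (σ ^ 2 * (1 + Real.log ((n : ℝ) / ((i : ℕ) + 1 : ℝ)))) := by
  have := log_div_nonneg (n := n) (x := (i : ℕ) + 1) (by positivity)
    (by exact_mod_cast i.2)
  positivity

theorem IsSolid.truncEnergy_le_minimaxRisk {n : ℕ} (hn : 2 ≤ n) {σ : ℝ} (hσ : 0 < σ)
    {Θ : Set (Fin n → ℝ)} (hΘ : IsSolid Θ) {u : Fin n → ℝ} (hu : u ∈ Θ)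
    (hanti : Antitone fun i => |u i|) :
    ENNReal.ofReal (1 / 192 * truncEnergy n σ u) ≤ minimaxRisk n σ Θ := by
  refine le_trans (ENNReal.ofReal_le_ofReal ?_) (hΘ.le_minimaxRisk hn hσ hu)
  have := sum_le_three_mul_sum_half hn _ (antitone_trunc σ hanti) (trunc_nonneg σ u)
  rw [truncEnergy]
  simp only [Fin.val_castLE] at this
  linarith

/-! ### Sparsity balls are solid -/

theorem antitone_absOrdered {n : ℕ} (v : Fin n → ℝ) : Antitone (absOrdered v) := by
  intro i j hij
  have := Tuple.monotone_sort (fun k => -|v k|) hij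
  simp only [Function.comp] at this
  unfold absOrdered
  linarith

theorem absOrdered_nonneg {n : ℕ} (v : Fin n → ℝ) (i : Fin n) : 0 ≤ absOrdered v i := abs_nonneg _

theorem sum_absOrdered {n : ℕ} (v : Fin n → ℝ) (f : ℝ → ℝ) :
    ∑ i, f (absOrdered v i) = ∑ i, f |v i| :=
  Equiv.sum_comp (Tuple.sort fun k => -|v k|) fun i => f |v i|

/-- The `(i + 1)`-st largest absolute value is at most `t` iff at most `i` absolute values
exceed `t`. -/
theorem absOrdered_le_iff {n : ℕ} (v : Fin n → ℝ) (i : Fin n) (t : ℝ) :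
    absOrdered v i ≤ t ↔ (Finset.univ.filter fun k => t < |v k|).card ≤ i := by
  have h := Tuple.lt_card_gt_iff_apply_gt_of_antitone (j := i) (a := t) (antitone_absOrdered v)
  have hc : (Finset.univ.filter fun k => t < |v k|).card
      = (Finset.univ.filter fun k => t < absOrdered v k).card := by
    symm
    refine Finset.card_equiv (Tuple.sort fun k => -|v k|) fun k => ?_
    rw [Finset.mem_filter, Finset.mem_filter]
    simp only [Finset.mem_univ, true_and]
    rfl
  rw [hc, ← not_lt, ← not_lt, not_iff_not]
  convert h.symm using 2

theorem l0norm_eq_sum {n : ℕ} (v : Fin n → ℝ) :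
    (l0norm v : ℝ) = ∑ i, if |v i| = 0 then (0 : ℝ) else 1 := by
  rw [l0norm, Finset.card_filter]
  push_cast
  exact Finset.sum_congr rfl fun i _ => by by_cases h : v i = 0 <;> simp [h]

theorem l0norm_le_of_injOn {n : ℕ} {u v : Fin n → ℝ} {e : Fin n → Fin n}
    (he : Set.InjOn e {i | v i ≠ 0}) (h : ∀ i, v i ≠ 0 → |v i| ≤ |u (e i)|) :
    l0norm v ≤ l0norm u := by
  refine Finset.card_le_card_of_injOn e (fun i hi => ?_) (fun i hi j hj => he ?_ ?_)
  · have hi : v i ≠ 0 := by simpa using hi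
    have := h i hi
    simp only [Finset.coe_filter, Finset.mem_univ, true_and, Set.mem_ofPred_eq]
    intro h0
    rw [h0, abs_zero] at this
    exact hi (abs_eq_zero.1 (le_antisymm this (abs_nonneg _)))
  · simpa using hi
  · simpa using hj

theorem sum_rpow_le_of_injOn {n : ℕ} {u v : Fin n → ℝ} {e : Fin n → Fin n} {p : ℝ} (hp : 0 < p)
    (he : Set.InjOn e {i | v i ≠ 0}) (h : ∀ i, v i ≠ 0 → |v i| ≤ |u (e i)|) :
    ∑ i, |v i| ^ p ≤ ∑ i, |u i| ^ p := by
  classical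
  calc ∑ i, |v i| ^ p = ∑ i with v i ≠ 0, |v i| ^ p := by
        rw [Finset.sum_filter]
        refine Finset.sum_congr rfl fun i _ => ?_
        by_cases hi : v i = 0 <;> simp [hi, Real.zero_rpow hp.ne']
    _ ≤ ∑ i with v i ≠ 0, |u (e i)| ^ p := Finset.sum_le_sum fun i hi =>
        Real.rpow_le_rpow (abs_nonneg _) (h i (by simpa using hi)) hp.le
    _ = ∑ k ∈ (Finset.univ.filter fun i => v i ≠ 0).image e, |u k| ^ p := by
        rw [Finset.sum_image]
        intro i hi j hj
        exact he (by simpa using hi) (by simpa using hj)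
    _ ≤ _ := Finset.sum_le_sum_of_subset_of_nonneg (Finset.subset_univ _)
        fun _ _ _ => by positivity

theorem card_lt_abs_le_of_injOn {n : ℕ} {u v : Fin n → ℝ} {e : Fin n → Fin n} {t : ℝ} (ht : 0 ≤ t)
    (he : Set.InjOn e {i | v i ≠ 0}) (h : ∀ i, v i ≠ 0 → |v i| ≤ |u (e i)|) :
    (Finset.univ.filter fun k => t < |v k|).card ≤ (Finset.univ.filter fun k => t < |u k|).card := by
  have hne : ∀ i, t < |v i| → v i ≠ 0 := fun i hi h0 => by
    rw [h0, abs_zero] at hi; linarith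
  refine Finset.card_le_card_of_injOn e (fun i hi => ?_) (fun i hi j hj => he ?_ ?_)
  · have hi : t < |v i| := by simpa using hi
    simpa using hi.trans_le (h i (hne i hi))
  · exact hne i (by simpa using hi)
  · exact hne j (by simpa using hj)

theorem BallType.isSolid_ball {T : BallType} {n : ℕ} {σ η : ℝ} (hT : T.NotSuperSparse n η) :
    IsSolid (T.ball n σ η) := by
  intro u hu v e he h
  match T, hT, hu with
  | .l0, _, hu =>
    have hu : (l0norm u : ℝ) ≤ η * n := hu
    have hv : (l0norm v : ℝ) ≤ l0norm u := by exact_mod_cast l0norm_le_of_injOn he h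
    exact hv.trans hu
  | .strong p, hT, hu =>
    have hu : 1 / (n : ℝ) * ∑ i, |u i| ^ p ≤ σ ^ p * η ^ p := hu
    exact (mul_le_mul_of_nonneg_left (sum_rpow_le_of_injOn hT.1 he h) (by positivity)).trans hu
  | .weak p, hT, hu =>
    intro i
    have hi := hu i
    rw [absOrdered_le_iff] at hi ⊢
    refine (card_lt_abs_le_of_injOn ?_ he h).trans hi
    exact (absOrdered_nonneg u i).trans (hu i)

theorem strong_subset_weak {n : ℕ} {σ η p : ℝ} (hσ : 0 < σ) (hη : 0 ≤ η) (hp : 0 < p) :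
    (BallType.strong p).ball n σ η ⊆ (BallType.weak p).ball n σ η := by
  intro v hv i
  have hn : (0 : ℝ) < n := by exact_mod_cast i.pos
  have hv : 1 / (n : ℝ) * ∑ i, |v i| ^ p ≤ σ ^ p * η ^ p := hv
  rw [← sum_absOrdered v fun x => x ^ p] at hv
  have h1 : (((i : ℕ) : ℝ) + 1) * absOrdered v i ^ p ≤ ∑ k, absOrdered v k ^ p := by
    calc (((i : ℕ) : ℝ) + 1) * absOrdered v i ^ p = ∑ k ∈ Finset.Iic i, absOrdered v i ^ p := by
          rw [Finset.sum_const, Fin.card_Iic, nsmul_eq_mul]; push_cast; ring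
      _ ≤ ∑ k ∈ Finset.Iic i, absOrdered v k ^ p := Finset.sum_le_sum fun k hk =>
          Real.rpow_le_rpow (absOrdered_nonneg _ _)
            (antitone_absOrdered v (Finset.mem_Iic.1 hk)) hp.le
      _ ≤ _ := Finset.sum_le_sum_of_subset_of_nonneg (Finset.subset_univ _)
          fun k _ _ => Real.rpow_nonneg (absOrdered_nonneg _ _) _
  have hi : (0 : ℝ) < (i : ℕ) + 1 := by positivity
  have h2 : absOrdered v i ^ p ≤ (σ * η) ^ p * ((n : ℝ) / ((i : ℕ) + 1)) := by
    rw [Real.mul_rpow hσ.le hη, ← mul_div_assoc, le_div_iff₀ hi]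
    rw [one_div, inv_mul_le_iff₀ hn] at hv
    linarith
  have h3 := Real.rpow_le_rpow (Real.rpow_nonneg (absOrdered_nonneg v i) p) h2
    (by positivity : 0 ≤ 1 / p)
  rw [Real.mul_rpow (by positivity) (by positivity), ← Real.rpow_mul (absOrdered_nonneg _ _),
    ← Real.rpow_mul (by positivity), mul_one_div_cancel hp.ne', Real.rpow_one, Real.rpow_one] at h3
  exact h3

theorem minimaxRisk_mono {n : ℕ} {σ : ℝ} {Θ Θ' : Set (Fin n → ℝ)} (h : Θ ⊆ Θ') :
    minimaxRisk n σ Θ ≤ minimaxRisk n σ Θ' :=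
  iInf₂_mono fun _ _ => biSup_mono h

/-- The decreasing rearrangement of the absolute values stays in a solid set. -/
theorem IsSolid.absOrdered_mem {n : ℕ} {Θ : Set (Fin n → ℝ)} (hΘ : IsSolid Θ) {u : Fin n → ℝ}
    (hu : u ∈ Θ) : absOrdered u ∈ Θ :=
  hΘ u hu _ (Tuple.sort fun k => -|u k|) (Equiv.injective _).injOn fun i _ => by
    simp [absOrdered]

/-- The vector whose first `s` coordinates are `t` and whose other coordinates vanish. -/
def spikes (n s : ℕ) (t : ℝ) (i : Fin n) : ℝ := if (i : ℕ) < s then t else 0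

theorem antitone_abs_spikes (n s : ℕ) (t : ℝ) : Antitone fun i => |spikes n s t i| := by
  intro i j hij
  have : (i : ℕ) ≤ j := hij
  simp only [spikes]
  split_ifs with h1 h2
  · exact le_rfl
  · omega
  · simp
  · simp

theorem sum_spikes {n s : ℕ} (hs : s ≤ n) (t : ℝ) (f : ℝ → ℝ) (h0 : f 0 = 0) :
    ∑ i, f (spikes n s t i) = s * f t := by
  have : ∀ i : Fin n, f (spikes n s t i) = if (i : ℕ) < s then f t else 0 := fun i => by
    simp only [spikes]; split_ifs <;> simp [h0]
  simp_rw [this]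
  rw [← Finset.sum_filter, Finset.sum_const, nsmul_eq_mul, Fin.card_filter_val_lt,
    min_eq_right hs]

theorem le_truncEnergy_spikes {n s : ℕ} {σ t : ℝ} (hs1 : 1 ≤ s) (hs : s ≤ n) :
    s * min (t ^ 2) (σ ^ 2 * (1 + Real.log ((n : ℝ) / s))) ≤ truncEnergy n σ (spikes n s t) := by
  rw [← sum_spikes hs (min (t ^ 2) (σ ^ 2 * (1 + Real.log ((n : ℝ) / s))))
    (fun x => x) rfl, truncEnergy]
  have hs0 : (0 : ℝ) < s := by exact_mod_cast hs1
  have hn0 : (0 : ℝ) < n := by exact_mod_cast (by omega : 0 < n)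
  refine Finset.sum_le_sum fun i _ => ?_
  by_cases h : (i : ℕ) < s
  · simp only [spikes, h, if_true]
    have : ((i : ℕ) : ℝ) + 1 ≤ s := by exact_mod_cast h
    gcongr
  · have := trunc_nonneg σ (spikes n s t) i
    simp only [spikes, h, if_false] at this ⊢
    exact this

theorem spikes_mem_l0 {n s : ℕ} {σ η t : ℝ} (hs : s ≤ n) (h : (s : ℝ) ≤ η * n) :
    spikes n s t ∈ BallType.l0.ball n σ η := by
  refine le_trans ?_ h
  rw [l0norm_eq_sum, sum_spikes hs t (fun x => if |x| = 0 then (0 : ℝ) else 1) (by simp)]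
  have : (0 : ℝ) ≤ s := by positivity
  split_ifs <;> linarith

theorem spikes_mem_strong {n s : ℕ} {σ η t p : ℝ} (hs : s ≤ n) (hp : 0 < p) (ht : 0 ≤ t)
    (hn : 0 < n) (h : s * t ^ p ≤ σ ^ p * η ^ p * n) :
    spikes n s t ∈ (BallType.strong p).ball n σ η := by
  have hn0 : (0 : ℝ) < n := by exact_mod_cast hn
  show 1 / (n : ℝ) * ∑ i, |spikes n s t i| ^ p ≤ σ ^ p * η ^ p
  rw [sum_spikes hs t (fun x => |x| ^ p) (by simp [Real.zero_rpow hp.ne']), abs_of_nonneg ht,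
    one_div, inv_mul_le_iff₀ hn0]
  linarith

theorem BallType.NotSuperSparse.nonneg {T : BallType} {n : ℕ} {η : ℝ}
    (h : T.NotSuperSparse n η) : 0 ≤ η := by
  match T, h with
  | .l0, h => exact le_trans (by positivity) h
  | .strong p, h => exact le_trans (by positivity) h.2
  | .weak p, h => exact le_trans (by positivity) h.2

theorem BallType.NotSuperSparse.pos {T : BallType} {n : ℕ} {η : ℝ} (hn : 2 ≤ n)
    (h : T.NotSuperSparse n η) : 0 < η := by
  have hn0 : (0 : ℝ) < n := by exact_mod_cast (by omega : 0 < n)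
  have hl : 0 < Real.log n := Real.log_pos (by exact_mod_cast hn)
  match T, h with
  | .l0, h => exact lt_of_lt_of_le (by positivity) h
  | .strong p, h => exact lt_of_lt_of_le (by positivity) h.2
  | .weak p, h => exact lt_of_lt_of_le (by positivity) h.2

/-- A ball whose radius is not super-sparse contains a vector of truncated energy at least
`σ² log n`: a single spike if `p < 2`, a constant vector if `p ≥ 2`. No constant here depends on
`p`. -/
theorem exists_truncEnergy_ge_log {T : BallType} {n : ℕ} (hn : 2 ≤ n) {σ η : ℝ} (hσ : 0 < σ)
    (h : T.NotSuperSparse n η) :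
    ∃ u ∈ T.ball n σ η, (Antitone fun i => |u i|) ∧ σ ^ 2 * Real.log n ≤ truncEnergy n σ u := by
  have hn0 : (0 : ℝ) < n := by exact_mod_cast (by omega : 0 < n)
  have hl : 0 < Real.log n := Real.log_pos (by exact_mod_cast hn)
  have hln : Real.log n ≤ n := (Real.log_le_sub_one_of_pos hn0).trans (by linarith)
  have strong : ∀ p, (BallType.strong p).NotSuperSparse n η →
      ∃ u ∈ (BallType.strong p).ball n σ η, (Antitone fun i => |u i|) ∧
        σ ^ 2 * Real.log n ≤ truncEnergy n σ u := by
    rintro p ⟨hp, h⟩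
    have hη : 0 ≤ η := le_trans (by positivity) h
    rcases lt_or_ge p 2 with hp2 | hp2
    · rw [min_eq_left hp2.le] at h
      refine ⟨spikes n 1 (σ * η * (n : ℝ) ^ (1 / p)), spikes_mem_strong (by omega) hp
        (by positivity) (by omega) (le_of_eq ?_), antitone_abs_spikes _ _ _, ?_⟩
      · rw [Real.mul_rpow (by positivity) (by positivity), Real.mul_rpow hσ.le hη,
          ← Real.rpow_mul hn0.le, one_div_mul_cancel hp.ne', Real.rpow_one]
        simp
      · refine le_trans ?_ (le_truncEnergy_spikes le_rfl (by omega))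
        have h1 : Real.sqrt (Real.log n) ≤ η * (n : ℝ) ^ (1 / p) := by
          rw [Real.rpow_neg hn0.le, inv_mul_le_iff₀ (by positivity)] at h
          linarith
        have h2 : Real.log n ≤ (η * (n : ℝ) ^ (1 / p)) ^ 2 := by
          rw [← Real.sqrt_le_sqrt_iff (by positivity), Real.sqrt_sq (by positivity)]
          exact h1
        simp only [Nat.cast_one, one_mul, div_one]
        refine le_min ?_ (mul_le_mul_of_nonneg_left (by linarith) (sq_nonneg _))
        rw [mul_assoc σ, mul_pow]
        exact mul_le_mul_of_nonneg_left h2 (sq_nonneg _)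
    · rw [min_eq_right hp2] at h
      refine ⟨spikes n n (σ * η), spikes_mem_strong le_rfl hp
        (by positivity) (by omega) (le_of_eq ?_), antitone_abs_spikes _ _ _, ?_⟩
      · rw [Real.mul_rpow hσ.le hη]; ring
      · refine le_trans ?_ (le_truncEnergy_spikes (by omega) le_rfl)
        rw [div_self hn0.ne', Real.log_one, add_zero, mul_one, mul_pow]
        have h1 : Real.log n ≤ n * η ^ 2 := by
          rw [Real.rpow_neg hn0.le, ← Real.sqrt_eq_rpow, inv_mul_le_iff₀ (by positivity)] at h
          have := pow_le_pow_left₀ (Real.sqrt_nonneg _) h 2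
          rwa [mul_pow, Real.sq_sqrt hl.le, Real.sq_sqrt hn0.le] at this
        rw [mul_min_of_nonneg _ _ hn0.le]
        refine le_min ?_ ?_
        · nlinarith [sq_nonneg σ]
        · nlinarith [sq_nonneg σ]
  match T, h with
  | .l0, h =>
    refine ⟨spikes n 1 (σ * Real.sqrt (1 + Real.log n)), spikes_mem_l0 (by omega) ?_,
      antitone_abs_spikes _ _ _, ?_⟩
    · have h : 1 / (n : ℝ) ≤ η := h
      rw [div_le_iff₀ hn0] at h
      simpa using h
    · refine le_trans ?_ (le_truncEnergy_spikes le_rfl (by omega))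
      rw [mul_pow, Real.sq_sqrt (by linarith)]
      simp only [Nat.cast_one, one_mul, div_one, min_self]
      exact mul_le_mul_of_nonneg_left (by linarith) (sq_nonneg _)
  | .strong p, h => exact strong p h
  | .weak p, h =>
    obtain ⟨u, hu, h1, h2⟩ := strong p h
    exact ⟨u, strong_subset_weak hσ (BallType.NotSuperSparse.nonneg h) h.1 hu, h1, h2⟩

theorem one_add_log_le_minimaxRisk {T : BallType} {n : ℕ} (hn : 2 ≤ n) {σ η : ℝ} (hσ : 0 < σ)
    (h : T.NotSuperSparse n η) :
    ENNReal.ofReal (1 / 576 * (σ ^ 2 * (1 + Real.log n))) ≤ minimaxRisk n σ (T.ball n σ η) := by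
  obtain ⟨u, hu, h1, h2⟩ := exists_truncEnergy_ge_log hn hσ h
  refine le_trans (ENNReal.ofReal_le_ofReal ?_)
    ((BallType.isSolid_ball h).truncEnergy_le_minimaxRisk hn hσ hu h1)
  have hl : Real.log 2 ≤ Real.log n := Real.log_le_log (by norm_num) (by exact_mod_cast hn)
  have := Real.log_two_gt_d9
  nlinarith [sq_nonneg σ]

/-! ### Upper bounds: identity, zero and soft-threshold estimators -/

theorem integral_exp_sq_gaussianReal {σ t : ℝ} (hσ : 0 < σ) (ht : t < 1) (μ : ℝ) :
    ∫ y, Real.exp (t * (y - μ) ^ 2 / (2 * σ ^ 2)) ∂gaussianReal μ (σ ^ 2).toNNReal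
      = (Real.sqrt (1 - t))⁻¹ := by
  have hv := toNNReal_sq_ne_zero hσ
  have h1 : 0 < 1 - t := by linarith
  rw [integral_gaussianReal_eq_integral_smul hv]
  have e : ∀ y : ℝ, gaussianPDFReal μ (σ ^ 2).toNNReal y • Real.exp (t * (y - μ) ^ 2 / (2 * σ ^ 2))
      = (Real.sqrt (2 * Real.pi * σ ^ 2))⁻¹ *
        Real.exp (-((1 - t) / (2 * σ ^ 2)) * (y - μ) ^ 2) := by
    intro y
    rw [gaussianPDFReal_def, coe_toNNReal_sq, smul_eq_mul, mul_assoc, ← Real.exp_add]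
    congr 2; ring
  simp_rw [e]
  rw [integral_const_mul,
    integral_sub_right_eq_self (fun x => Real.exp (-((1 - t) / (2 * σ ^ 2)) * x ^ 2)),
    integral_gaussian, ← Real.sqrt_inv, ← Real.sqrt_inv, ← Real.sqrt_mul (by positivity)]
  congr 1
  have := Real.pi_pos
  field_simp

theorem integrable_exp_sq_gaussianReal {σ t : ℝ} (hσ : 0 < σ) (ht : t < 1) (μ : ℝ) :
    Integrable (fun y => Real.exp (t * (y - μ) ^ 2 / (2 * σ ^ 2)))
      (gaussianReal μ (σ ^ 2).toNNReal) := by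
  refine Integrable.of_integral_ne_zero ?_
  rw [integral_exp_sq_gaussianReal hσ ht]
  have h1 : 0 < 1 - t := by linarith
  positivity

theorem integrable_sq_sub_gaussianReal {σ : ℝ} (μ : ℝ) :
    Integrable (fun y => (y - μ) ^ 2) (gaussianReal μ (σ ^ 2).toNNReal) :=
  ((memLp_id_gaussianReal' 2 (by simp)).sub (memLp_const μ)).integrable_sq

theorem integral_sq_sub_gaussianReal {σ : ℝ} (μ : ℝ) :
    ∫ y, (y - μ) ^ 2 ∂gaussianReal μ (σ ^ 2).toNNReal = σ ^ 2 := by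
  have h := variance_id_gaussianReal (μ := μ) (v := (σ ^ 2).toNNReal)
  rw [variance_eq_integral aemeasurable_id, coe_toNNReal_sq] at h
  simpa using h

theorem lintegral_le_of_le {α : Type*} [MeasurableSpace α] {P : Measure α} {f g : α → ℝ} {c : ℝ}
    (hg : Integrable g P) (h0 : ∀ x, 0 ≤ g x) (hfg : ∀ x, f x ≤ g x) (hc : ∫ x, g x ∂P ≤ c) :
    ∫⁻ x, ENNReal.ofReal (f x) ∂P ≤ ENNReal.ofReal c := by
  calc ∫⁻ x, ENNReal.ofReal (f x) ∂P ≤ ∫⁻ x, ENNReal.ofReal (g x) ∂P :=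
        lintegral_mono fun x => ENNReal.ofReal_le_ofReal (hfg x)
    _ = ENNReal.ofReal (∫ x, g x ∂P) :=
        (ofReal_integral_eq_lintegral_ofReal hg (Filter.Eventually.of_forall h0)).symm
    _ ≤ _ := ENNReal.ofReal_le_ofReal hc

theorem vectorRisk_coordinatewise {n : ℕ} {σ : ℝ} {φ : ℝ → ℝ} (hφ : Measurable φ)
    (μ : Fin n → ℝ) :
    vectorRisk n σ (fun y i => φ (y i)) μ
      = ∑ i, ∫⁻ x, ENNReal.ofReal ((φ x - μ i) ^ 2) ∂gaussianReal (μ i) (σ ^ 2).toNNReal := by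
  rw [vectorRisk]
  have : ∀ y : Fin n → ℝ, ENNReal.ofReal (∑ i, (φ (y i) - μ i) ^ 2)
      = ∑ i, ENNReal.ofReal ((φ (y i) - μ i) ^ 2) := fun y =>
    ENNReal.ofReal_sum_of_nonneg fun _ _ => sq_nonneg _
  simp_rw [this]
  rw [lintegral_finsetSum _ (fun i _ => by fun_prop)]
  refine Finset.sum_congr rfl fun i _ => ?_
  exact (measurePreserving_eval (fun i => gaussianReal (μ i) (σ ^ 2).toNNReal) i).lintegral_comp
    (f := fun x => ENNReal.ofReal ((φ x - μ i) ^ 2)) (by fun_prop)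

theorem minimaxRisk_le_of_coordinatewise {n : ℕ} {σ B : ℝ} {Θ : Set (Fin n → ℝ)} {φ : ℝ → ℝ}
    (hφ : Measurable φ) (r : ℝ → ℝ) (hr0 : ∀ x, 0 ≤ r x)
    (hr : ∀ μ, ∫⁻ x, ENNReal.ofReal ((φ x - μ) ^ 2) ∂gaussianReal μ (σ ^ 2).toNNReal
      ≤ ENNReal.ofReal (r μ)) (hB : ∀ μ ∈ Θ, ∑ i, r (μ i) ≤ B) :
    minimaxRisk n σ Θ ≤ ENNReal.ofReal B := by
  refine iInf₂_le_of_le (fun y i => φ (y i)) (by fun_prop) (iSup₂_le fun μ hμ => ?_)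
  rw [vectorRisk_coordinatewise hφ]
  calc _ ≤ ∑ i, ENNReal.ofReal (r (μ i)) := Finset.sum_le_sum fun i _ => hr _
    _ = ENNReal.ofReal (∑ i, r (μ i)) := (ENNReal.ofReal_sum_of_nonneg fun _ _ => hr0 _).symm
    _ ≤ _ := ENNReal.ofReal_le_ofReal (hB μ hμ)

theorem minimaxRisk_le_denseRate {n : ℕ} {σ : ℝ} (Θ : Set (Fin n → ℝ)) :
    minimaxRisk n σ Θ ≤ ENNReal.ofReal (denseRate n σ) := by
  refine minimaxRisk_le_of_coordinatewise (φ := fun x => x) measurable_id (fun _ => σ ^ 2)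
    (fun _ => sq_nonneg _) (fun μ => ?_) (fun μ _ => ?_)
  · exact lintegral_le_of_le (integrable_sq_sub_gaussianReal μ) (fun _ => sq_nonneg _)
      (fun _ => le_rfl) (integral_sq_sub_gaussianReal μ).le
  · simp [denseRate, mul_comm]

theorem minimaxRisk_le_of_sum_sq_le {n : ℕ} {σ B : ℝ} {Θ : Set (Fin n → ℝ)}
    (hB : ∀ μ ∈ Θ, ∑ i, μ i ^ 2 ≤ B) : minimaxRisk n σ Θ ≤ ENNReal.ofReal B :=
  minimaxRisk_le_of_coordinatewise (φ := fun _ => 0) measurable_const (fun x => x ^ 2)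
    (fun _ => sq_nonneg _) (fun μ => by simp) hB

/-- Soft thresholding at level `l`. -/
def soft (l y : ℝ) : ℝ := y - max (-l) (min l y)

theorem measurable_soft (l : ℝ) : Measurable (soft l) := by
  unfold soft; fun_prop

theorem abs_soft_sub_le {l y : ℝ} (hl : 0 ≤ l) : |soft l y - y| ≤ l := by
  unfold soft
  rw [abs_le]
  constructor
  · have : max (-l) (min l y) ≤ l := max_le (by linarith) (min_le_left _ _)
    linarith
  · have := le_max_left (-l) (min l y)
    linarith

theorem abs_soft_le {l x μ : ℝ} (hl : 0 ≤ l) :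
    |soft l (μ + x)| ≤ |μ| + max (|x| - l) 0 := by
  unfold soft
  have h1 := neg_abs_le μ
  have h2 := le_abs_self μ
  have h3 := neg_abs_le x
  have h4 := le_abs_self x
  have h5 := le_max_left (|x| - l) 0
  have h6 := le_max_right (|x| - l) 0
  rw [abs_le]
  rcases le_total l (μ + x) with h | h
  · rw [min_eq_left h, max_eq_right (show -l ≤ l by linarith)]
    constructor <;> linarith
  · rw [min_eq_right h]
    rcases le_total (-l) (μ + x) with h' | h'
    · rw [max_eq_right h']
      constructor <;> linarith [abs_nonneg μ]
    · rw [max_eq_left h']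
      constructor <;> linarith

theorem sq_excess_le {σ l x : ℝ} (hσ : 0 < σ) (hl : 0 ≤ l) :
    max (|x| - l) 0 ^ 2 ≤
      8 * σ ^ 2 * Real.exp (-(l ^ 2 / (4 * σ ^ 2))) * Real.exp (3 / 4 * x ^ 2 / (2 * σ ^ 2)) := by
  rcases le_total (|x|) l with h | h
  · rw [max_eq_right (by linarith)]
    norm_num
    positivity
  · rw [max_eq_left (by linarith)]
    have h1 : (|x| - l) ^ 2 ≤ x ^ 2 := by
      rw [← sq_abs x]; exact pow_le_pow_left₀ (by linarith) (by linarith) 2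
    have h2 : l ^ 2 ≤ x ^ 2 := by
      rw [← sq_abs x]; exact pow_le_pow_left₀ hl h 2
    have h3 : x ^ 2 ≤ 8 * σ ^ 2 * Real.exp (x ^ 2 / (8 * σ ^ 2)) := by
      have := Real.add_one_le_exp (x ^ 2 / (8 * σ ^ 2))
      calc x ^ 2 = 8 * σ ^ 2 * (x ^ 2 / (8 * σ ^ 2)) := by field_simp
        _ ≤ _ := mul_le_mul_of_nonneg_left (by linarith) (by positivity)
    refine h1.trans (h3.trans ?_)
    rw [mul_assoc (8 * σ ^ 2), ← Real.exp_add]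
    refine mul_le_mul_of_nonneg_left (Real.exp_le_exp.2 ?_) (by positivity)
    have e : -(l ^ 2 / (4 * σ ^ 2)) + 3 / 4 * x ^ 2 / (2 * σ ^ 2) - x ^ 2 / (8 * σ ^ 2)
        = (x ^ 2 - l ^ 2) / (4 * σ ^ 2) := by field_simp; ring
    have : 0 ≤ (x ^ 2 - l ^ 2) / (4 * σ ^ 2) := div_nonneg (by linarith) (by positivity)
    linarith

/-- Risk of soft thresholding at level `l`: the oracle term `min (μ², l² + σ²)` up to constants, and a
false-alarm term, bounded by an exponential moment of the squared noise. -/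
theorem risk_soft_le {σ l : ℝ} (hσ : 0 < σ) (hl : 0 ≤ l) (μ : ℝ) :
    ∫⁻ y, ENNReal.ofReal ((soft l y - μ) ^ 2) ∂gaussianReal μ (σ ^ 2).toNNReal
      ≤ ENNReal.ofReal (min (8 * μ ^ 2) (2 * l ^ 2 + 2 * σ ^ 2) +
        32 * σ ^ 2 * Real.exp (-(l ^ 2 / (4 * σ ^ 2)))) := by
  set E := Real.exp (-(l ^ 2 / (4 * σ ^ 2))) with hE
  have hE0 : 0 < E := Real.exp_pos _
  rcases le_total (8 * μ ^ 2) (2 * l ^ 2 + 2 * σ ^ 2) with h | h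
  · rw [min_eq_left h]
    -- The exponential moment is `(1 - 3/4)^{-1/2} = 2`.
    have hi := (integrable_exp_sq_gaussianReal hσ (t := 3 / 4) (by norm_num) μ).const_mul
      (2 * (8 * σ ^ 2 * E))
    refine lintegral_le_of_le ((integrable_const (8 * μ ^ 2)).add hi)
      (fun y => by simp only [Pi.add_apply]; positivity) (fun y => ?_) ?_
    · have h1 := abs_soft_le (x := y - μ) (μ := μ) hl
      rw [add_sub_cancel] at h1
      have h2 := sq_excess_le (x := y - μ) hσ hl
      have h3 : |soft l y - μ| ≤ 2 * |μ| + max (|y - μ| - l) 0 := by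
        have := abs_sub (soft l y) μ
        linarith
      have h4 : (soft l y - μ) ^ 2 ≤ (2 * |μ| + max (|y - μ| - l) 0) ^ 2 := by
        rw [← sq_abs]; exact pow_le_pow_left₀ (abs_nonneg _) h3 2
      simp only [Pi.add_apply]
      nlinarith [sq_nonneg (2 * |μ| - max (|y - μ| - l) 0), sq_abs μ]
    · rw [integral_add' (integrable_const _) hi, integral_const, integral_const_mul,
        integral_exp_sq_gaussianReal hσ (by norm_num)]
      have : Real.sqrt (1 - 3 / 4) = 1 / 2 := by
        rw [show (1 - 3 / 4 : ℝ) = (1 / 2) ^ 2 by norm_num, Real.sqrt_sq (by norm_num)]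
      rw [this]
      simp
      linarith
  · rw [min_eq_right h]
    have hi := (integrable_sq_sub_gaussianReal (σ := σ) μ).const_mul 2
    refine lintegral_le_of_le ((integrable_const (2 * l ^ 2)).add hi)
      (fun y => by simp only [Pi.add_apply]; positivity) (fun y => ?_) ?_
    · have h1 := abs_soft_sub_le (y := y) hl
      have h2 : (soft l y - y) ^ 2 ≤ l ^ 2 := by
        rw [← sq_abs]; exact pow_le_pow_left₀ (abs_nonneg _) h1 2
      simp only [Pi.add_apply]
      nlinarith [sq_nonneg ((soft l y - y) - (y - μ))]
    · rw [integral_add' (integrable_const _) hi, integral_const, integral_const_mul, integral_sq_sub_gaussianReal]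
      simp
      positivity

/-- Soft thresholding at `l = 2 σ √L`. -/
theorem minimaxRisk_le_soft {n : ℕ} {σ L B : ℝ} (hσ : 0 < σ) (hL : 0 ≤ L) {Θ : Set (Fin n → ℝ)}
    (hB : ∀ μ ∈ Θ, ∑ i, min (8 * μ i ^ 2) (σ ^ 2 * (8 * L + 2)) ≤ B) :
    minimaxRisk n σ Θ ≤ ENNReal.ofReal (B + 32 * σ ^ 2 * n * Real.exp (-L)) := by
  refine minimaxRisk_le_of_coordinatewise (measurable_soft (2 * σ * Real.sqrt L)) (fun μ =>
    min (8 * μ ^ 2) (2 * (2 * σ * Real.sqrt L) ^ 2 + 2 * σ ^ 2) +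
        32 * σ ^ 2 * Real.exp (-((2 * σ * Real.sqrt L) ^ 2 / (4 * σ ^ 2)))) (fun _ => by positivity)
    (fun μ => risk_soft_le hσ (by positivity) μ) (fun μ hμ => ?_)
  have e1 : (2 * σ * Real.sqrt L) ^ 2 = 4 * σ ^ 2 * L := by
    rw [mul_pow, Real.sq_sqrt hL]; ring
  have e2 : 4 * σ ^ 2 * L / (4 * σ ^ 2) = L := by field_simp
  simp only [e1, e2]
  rw [Finset.sum_add_distrib]
  have := hB μ hμ
  have e3 : σ ^ 2 * (8 * L + 2) = 2 * (4 * σ ^ 2 * L) + 2 * σ ^ 2 := by ring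
  rw [e3] at this
  simp only [Finset.sum_const, Finset.card_univ, Fintype.card_fin, nsmul_eq_mul]
  linarith

/-! ### Lower bounds for the single-vector rates -/

theorem half_le_floor {x : ℝ} (hx : 1 ≤ x) : x / 2 ≤ (⌊x⌋₊ : ℝ) := by
  have h1 : (1 : ℝ) ≤ ⌊x⌋₊ := by exact_mod_cast (Nat.le_floor (by simpa using hx) : 1 ≤ ⌊x⌋₊)
  have h2 := Nat.lt_floor_add_one x
  linarith

theorem le_minimaxRisk_of_spikes {T : BallType} {n s : ℕ} {σ η t G : ℝ} (hn : 2 ≤ n) (hσ : 0 < σ)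
    (hT : T.NotSuperSparse n η) (hmem : spikes n s t ∈ T.ball n σ η) (hs1 : 1 ≤ s) (hs : s ≤ n)
    (hG : G ≤ s * min (t ^ 2) (σ ^ 2 * (1 + Real.log ((n : ℝ) / s)))) :
    ENNReal.ofReal (1 / 192 * G) ≤ minimaxRisk n σ (T.ball n σ η) := by
  refine le_trans (ENNReal.ofReal_le_ofReal ?_)
    ((BallType.isSolid_ball hT).truncEnergy_le_minimaxRisk hn hσ hmem (antitone_abs_spikes _ _ _))
  have := le_truncEnergy_spikes (σ := σ) (t := t) hs1 hs
  linarith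

theorem denseRate_le_minimaxRisk {T : BallType} {n : ℕ} {σ η η₀ : ℝ} (hn : 2 ≤ n) (hσ : 0 < σ)
    (h0 : 0 < η₀) (h1 : η₀ < 1) (hT : T.NotSuperSparse n η) (hη : η₀ ≤ η) :
    ENNReal.ofReal (η₀ ^ 2 / 384 * denseRate n σ) ≤ minimaxRisk n σ (T.ball n σ η) := by
  have hn0 : (0 : ℝ) < n := by exact_mod_cast (by omega : 0 < n)
  have hη0 : 0 < η := h0.trans_le hη
  have strong : ∀ p, (BallType.strong p).NotSuperSparse n η →
      ENNReal.ofReal (η₀ ^ 2 / 384 * denseRate n σ)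
        ≤ minimaxRisk n σ ((BallType.strong p).ball n σ η) := by
    intro p hp
    refine le_trans (ENNReal.ofReal_le_ofReal ?_) (le_minimaxRisk_of_spikes
      (s := n) (t := σ * η₀) (G := n * (σ ^ 2 * η₀ ^ 2)) hn hσ hp
      (spikes_mem_strong le_rfl hp.1 (by positivity) (by omega) ?_) (by omega) le_rfl ?_)
    · unfold denseRate
      have : 0 ≤ η₀ ^ 2 * (σ ^ 2 * n) := by positivity
      nlinarith
    · rw [Real.mul_rpow hσ.le h0.le]
      have := Real.rpow_le_rpow h0.le hη hp.1.le
      have h3 : 0 ≤ n * σ ^ p := by positivity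
      nlinarith
    · rw [div_self hn0.ne', Real.log_one, add_zero, mul_one, mul_pow]
      refine mul_le_mul_of_nonneg_left (le_min le_rfl ?_) hn0.le
      have : η₀ ^ 2 ≤ 1 := pow_le_one₀ h0.le h1.le
      nlinarith [sq_nonneg σ]
  match T, hT with
  | .l0, hT =>
    have hT' : 1 / (n : ℝ) ≤ η := hT
    rw [div_le_iff₀ hn0] at hT'
    set x : ℝ := min (η * n) n with hx
    have hx1 : 1 ≤ x := le_min hT' (by exact_mod_cast (by omega : 1 ≤ n))
    have hxs := Nat.floor_le (zero_le_one.trans hx1)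
    have hsn : ⌊x⌋₊ ≤ n := by
      exact_mod_cast hxs.trans (min_le_right _ _)
    have hfl := half_le_floor hx1
    have hs1 : 1 ≤ ⌊x⌋₊ := Nat.le_floor (by simpa using hx1)
    have hs0 : (0 : ℝ) < ⌊x⌋₊ := by exact_mod_cast hs1
    refine le_trans (ENNReal.ofReal_le_ofReal ?_) (le_minimaxRisk_of_spikes
      (s := ⌊x⌋₊) (t := σ) (G := ⌊x⌋₊ * σ ^ 2) hn hσ hT
      (spikes_mem_l0 hsn (hxs.trans (min_le_left _ _))) hs1 hsn ?_)
    · have h2 : η₀ * n ≤ x := le_min (by gcongr) (by nlinarith)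
      unfold denseRate
      have h3 : η₀ ^ 2 * n ≤ 2 * ⌊x⌋₊ := by nlinarith
      nlinarith [mul_le_mul_of_nonneg_left h3 (sq_nonneg σ)]
    · refine mul_le_mul_of_nonneg_left (le_min le_rfl ?_) hs0.le
      have := log_div_nonneg hs0 (show (⌊x⌋₊ : ℝ) ≤ n by exact_mod_cast hsn)
      nlinarith [sq_nonneg σ]
  | .strong p, hT => exact strong p hT
  | .weak p, hT =>
    exact (strong p hT).trans (minimaxRisk_mono (strong_subset_weak hσ hη0.le hT.1))

theorem l0_rate_le {n : ℕ} {σ η : ℝ} (hn : 2 ≤ n) (hσ : 0 < σ)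
    (hT : BallType.l0.NotSuperSparse n η) (h1 : η < 1) :
    ENNReal.ofReal (1 / 384 * (σ ^ 2 * n * η * Real.log η⁻¹))
      ≤ minimaxRisk n σ (BallType.l0.ball n σ η) := by
  have hn0 : (0 : ℝ) < n := by exact_mod_cast (by omega : 0 < n)
  have hn1 : (1 : ℝ) ≤ n := by exact_mod_cast (by omega : 1 ≤ n)
  have hη := hT.pos hn
  have hT' : 1 / (n : ℝ) ≤ η := hT
  rw [div_le_iff₀ hn0] at hT'
  have hxs := Nat.floor_le (zero_le_one.trans hT')
  have hsn : ⌊η * n⌋₊ ≤ n := by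
    have : (⌊η * n⌋₊ : ℝ) ≤ n := by nlinarith
    exact_mod_cast this
  have hfl := half_le_floor hT'
  have hs1 : 1 ≤ ⌊η * n⌋₊ := Nat.le_floor (by simpa using hT')
  have hs0 : (0 : ℝ) < ⌊η * n⌋₊ := by exact_mod_cast hs1
  have hlog : Real.log η⁻¹ ≤ Real.log ((n : ℝ) / ⌊η * n⌋₊) := by
    refine Real.log_le_log (by positivity) ?_
    rw [le_div_iff₀ hs0, inv_mul_le_iff₀ hη]
    exact hxs
  have hlog0 : 0 ≤ Real.log η⁻¹ := Real.log_nonneg (by rw [one_le_inv₀ hη]; exact h1.le)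
  have hs1' : (1 : ℝ) ≤ ⌊η * n⌋₊ := by exact_mod_cast hs1
  have hln : Real.log ((n : ℝ) / ⌊η * n⌋₊) ≤ Real.log n :=
    Real.log_le_log (by positivity) (div_le_self hn0.le hs1')
  refine le_trans (ENNReal.ofReal_le_ofReal ?_) (le_minimaxRisk_of_spikes
      (s := ⌊η * n⌋₊) (t := σ * Real.sqrt (1 + Real.log n))
      (G := ⌊η * n⌋₊ * (σ ^ 2 * Real.log η⁻¹)) hn hσ hT (spikes_mem_l0 hsn hxs) hs1 hsn ?_)
  · have := mul_le_mul_of_nonneg_right hfl (by positivity : 0 ≤ σ ^ 2 * Real.log η⁻¹)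
    linarith
  · rw [mul_pow, Real.sq_sqrt (by linarith)]
    refine mul_le_mul_of_nonneg_left (le_min ?_ ?_) hs0.le <;>
      exact mul_le_mul_of_nonneg_left (by linarith) (sq_nonneg _)

/-- For a radius that is not super-sparse, `log η^{-p}` exceeds `log n` by a factor at most `1 + p`.
The factor absorbs the term `log log n`, which is negative for `n = 2`. -/
theorem log_rpow_neg_le {n : ℕ} {p η : ℝ} (hn : 2 ≤ n) (hp : 0 < p) (hp2 : p ≤ 2)
    (hη : (n : ℝ) ^ (-(1 / min p 2)) * Real.sqrt (Real.log n) ≤ η) :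
    Real.log (η ^ (-p)) ≤ (1 + p) * Real.log n := by
  have hn0 : (0 : ℝ) < n := by exact_mod_cast (by omega : 0 < n)
  have hl2 : Real.log 2 ≤ Real.log n := Real.log_le_log (by norm_num) (by exact_mod_cast hn)
  have hl : 0.69 < Real.log n := lt_of_lt_of_le (by have := Real.log_two_gt_d9; linarith) hl2
  have hl0 : 0 < Real.log n := by linarith
  rw [min_eq_left hp2] at hη
  have h1 := Real.log_le_log (by positivity) hη
  rw [Real.log_mul (by positivity) (by positivity), Real.log_rpow hn0,
    Real.log_sqrt hl0.le] at h1
  have hη0 : 0 < η := lt_of_lt_of_le (by positivity) hη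
  rw [Real.log_rpow hη0]
  have h2 := Real.one_sub_inv_le_log_of_pos hl0
  have h3 : (Real.log n)⁻¹ ≤ 1.45 := by
    rw [inv_le_comm₀ hl0 (by norm_num)]; norm_num; linarith
  have h4 : -(Real.log (Real.log n) / 2) ≤ Real.log n := by linarith
  have h5 : p * (-(1 / p) * Real.log n + Real.log (Real.log n) / 2) ≤ p * Real.log η :=
    mul_le_mul_of_nonneg_left h1 hp.le
  have h6 : p * (-(1 / p) * Real.log n + Real.log (Real.log n) / 2)
      = -Real.log n - p * (-(Real.log (Real.log n) / 2)) := by field_simp; ring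
  nlinarith [mul_le_mul_of_nonneg_left h4 hp.le]

theorem rpow_radius_ge {n : ℕ} {p η : ℝ} (hn : 2 ≤ n) (hp : 0 < p) (hp2 : p ≤ 2)
    (hη : (n : ℝ) ^ (-(1 / min p 2)) * Real.sqrt (Real.log n) ≤ η) :
    Real.log n ^ (p / 2) ≤ n * η ^ p := by
  have hn0 : (0 : ℝ) < n := by exact_mod_cast (by omega : 0 < n)
  have hl : 0 < Real.log n := Real.log_pos (by exact_mod_cast hn)
  rw [min_eq_left hp2] at hη
  have h := Real.rpow_le_rpow (by positivity) hη hp.le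
  rw [Real.mul_rpow (by positivity) (by positivity), ← Real.rpow_mul hn0.le,
    Real.sqrt_eq_rpow, ← Real.rpow_mul hl.le, neg_mul, one_div_mul_cancel hp.ne',
    Real.rpow_neg hn0.le, Real.rpow_one, inv_mul_le_iff₀ hn0] at h
  rwa [show 1 / 2 * p = p / 2 by ring] at h

/-- A radius that is not super-sparse leaves room for at least one spike whose squared height is
`σ² log (η ^ (-p)) / (1 + p)`. -/
theorem one_le_mul_rpow_div_log {n : ℕ} {p η : ℝ} (hn : 2 ≤ n) (hp : 0 < p) (hp2 : p ≤ 2)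
    (hη : (n : ℝ) ^ (-(1 / min p 2)) * Real.sqrt (Real.log n) ≤ η)
    (hL : 0 < Real.log (η ^ (-p))) :
    1 ≤ n * η ^ p * ((1 + p) / Real.log (η ^ (-p))) ^ (p / 2) := by
  have hl : 0 < Real.log n := Real.log_pos (by exact_mod_cast hn)
  have h1 := rpow_radius_ge hn hp hp2 hη
  have h2 := log_rpow_neg_le hn hp hp2 hη
  set L := Real.log (η ^ (-p))
  have h3 : 1 ≤ Real.log n * ((1 + p) / L) := by
    rw [← mul_div_assoc, one_le_div hL]; linarith
  calc (1 : ℝ) ≤ (Real.log n * ((1 + p) / L)) ^ (p / 2) := Real.one_le_rpow h3 (by positivity)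
    _ = Real.log n ^ (p / 2) * ((1 + p) / L) ^ (p / 2) :=
        Real.mul_rpow hl.le (by positivity)
    _ ≤ _ := mul_le_mul_of_nonneg_right h1 (by positivity)

theorem log_rpow_neg_pos {η p : ℝ} (hη : 0 < η) (h1 : η < 1) (hp : 0 < p) :
    0 < Real.log (η ^ (-p)) := by
  rw [Real.log_rpow hη]
  have := Real.log_neg hη h1
  nlinarith

theorem log_rpow_neg_anti {η η₀ p : ℝ} (hη : 0 < η) (h1 : η ≤ η₀) (hp : 0 < p) :
    Real.log (η₀ ^ (-p)) ≤ Real.log (η ^ (-p)) := by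
  rw [Real.log_rpow hη, Real.log_rpow (hη.trans_le h1)]
  have := Real.log_le_log hη h1
  nlinarith

/-- The least favourable vectors have about `n η ^ p (κ / L) ^ (p / 2)` spikes of height `σ √(L / κ)`,
where `L = log (η ^ (-p))` and `κ = 1 + p`. -/
theorem strong_rate_le_of_lt_two {p η₀ : ℝ} (hp : 0 < p) (hp2 : p < 2) (h0 : 0 < η₀)
    (h1 : η₀ < 1) :
    ∃ a : ℝ, 0 < a ∧ ∀ (n : ℕ) (σ η : ℝ), 2 ≤ n → 0 < σ →
      (BallType.strong p).NotSuperSparse n η → η ≤ η₀ →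
      ENNReal.ofReal (a * (σ ^ 2 * n * η ^ p * (Real.log (η ^ (-p))) ^ (1 - p / 2)))
        ≤ minimaxRisk n σ ((BallType.strong p).ball n σ η) := by
  set κ : ℝ := 1 + p with hκ
  have hκ0 : 0 < κ := by positivity
  set L₀ := Real.log (η₀ ^ (-p)) with hL₀
  have hL₀0 : 0 < L₀ := log_rpow_neg_pos h0 h1 hp
  set K : ℝ := max 1 ((κ / L₀) ^ (p / 2)) with hK
  have hK1 : 1 ≤ K := le_max_left _ _
  refine ⟨1 / 192 * (1 / (2 * κ * K)), by positivity, ?_⟩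
  intro n σ η hn hσ hT hη
  have hn0 : (0 : ℝ) < n := by exact_mod_cast (by omega : 0 < n)
  have hn1 : (1 : ℝ) ≤ n := by exact_mod_cast (by omega : 1 ≤ n)
  have hη0 := hT.pos hn
  set L := Real.log (η ^ (-p)) with hL
  have hLL : L₀ ≤ L := log_rpow_neg_anti hη0 hη hp
  have hL0 : 0 < L := hL₀0.trans_le hLL
  set X : ℝ := n * η ^ p * (κ / L) ^ (p / 2) with hX
  have hX1 : 1 ≤ X := one_le_mul_rpow_div_log hn hp hp2.le hT.2 hL0
  have hXK : X ≤ n * K := by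
    have hηp : η ^ p ≤ 1 := Real.rpow_le_one hη0.le (hη.trans h1.le) hp.le
    have : (κ / L) ^ (p / 2) ≤ K := by
      refine le_trans ?_ (le_max_right _ _)
      exact Real.rpow_le_rpow (by positivity) (by gcongr) (by positivity)
    calc X ≤ n * 1 * K := by rw [hX]; gcongr
      _ = n * K := by ring
  set x := min X n with hx
  have hx1 : 1 ≤ x := le_min hX1 hn1
  have hxK : X / K ≤ x := le_min (div_le_self (by linarith) hK1)
    (by rw [div_le_iff₀ (by linarith)]; exact hXK)
  have hxs := Nat.floor_le (zero_le_one.trans hx1)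
  have hfl := half_le_floor hx1
  set s := ⌊x⌋₊ with hs
  have hsn : s ≤ n := by exact_mod_cast hxs.trans (min_le_right _ _)
  have hs1 : 1 ≤ s := Nat.le_floor (by simpa using hx1)
  have hs0 : (0 : ℝ) < s := by exact_mod_cast hs1
  have hsX : (s : ℝ) ≤ X := hxs.trans (min_le_left _ _)
  have hprod : (κ / L) ^ (p / 2) * (L / κ) ^ (p / 2) = 1 := by
    rw [← Real.mul_rpow (by positivity) (by positivity)]
    have : κ / L * (L / κ) = 1 := by field_simp
    rw [this, Real.one_rpow]
  have ht : (σ * Real.sqrt (L / κ)) ^ p = σ ^ p * (L / κ) ^ (p / 2) := by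
    rw [Real.mul_rpow hσ.le (Real.sqrt_nonneg _), Real.sqrt_eq_rpow,
      ← Real.rpow_mul (by positivity)]
    congr 2; ring
  -- If `L ≤ κ`, the summand `1` suffices; otherwise `log (n / X) = L + (p / 2) log (L / κ) ≥ L`.
  have hgain : L / κ ≤ 1 + Real.log ((n : ℝ) / s) := by
    have hlog0 := log_div_nonneg hs0 (show (s : ℝ) ≤ n by exact_mod_cast hsn)
    rcases le_total L κ with h | h
    · have : L / κ ≤ 1 := (div_le_one (by positivity)).2 h
      linarith
    · have h2 : Real.log ((n : ℝ) / X) ≤ Real.log ((n : ℝ) / s) :=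
        Real.log_le_log (by positivity) (by gcongr)
      have h3 : Real.log ((n : ℝ) / X) = L + p / 2 * Real.log (L / κ) := by
        have : (n : ℝ) / X = η ^ (-p) * (L / κ) ^ (p / 2) := by
          rw [div_eq_iff (by positivity), hX, Real.rpow_neg hη0.le]
          have : η ^ p ≠ 0 := by positivity
          calc (n : ℝ) = n * 1 := by ring
            _ = n * ((κ / L) ^ (p / 2) * (L / κ) ^ (p / 2)) := by rw [hprod]
            _ = _ := by field_simp
        rw [this, Real.log_mul (by positivity) (by positivity),
          Real.log_rpow (show 0 < L / κ by positivity)]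
      have h4 : 0 ≤ Real.log (L / κ) := Real.log_nonneg ((one_le_div (by positivity)).2 h)
      have h5 : L / κ ≤ L := div_le_self hL0.le (by linarith)
      have : 0 ≤ p / 2 * Real.log (L / κ) := by positivity
      linarith
  refine le_trans (ENNReal.ofReal_le_ofReal ?_) (le_minimaxRisk_of_spikes
    (s := s) (t := σ * Real.sqrt (L / κ)) (G := s * (σ ^ 2 * (L / κ))) hn hσ hT
    (spikes_mem_strong hsn hp (by positivity) (by omega) ?_) hs1 hsn ?_)
  · have e1 : L ^ (1 - p / 2) * κ ^ (p / 2) = (κ / L) ^ (p / 2) * L := by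
      rw [Real.div_rpow (by positivity) hL0.le, Real.rpow_sub hL0, Real.rpow_one]
      field_simp
    have e2 : 1 ≤ κ ^ (p / 2) := Real.one_le_rpow (by linarith) (by positivity)
    have e3 : n * η ^ p * L ^ (1 - p / 2) ≤ X * L := by
      calc n * η ^ p * L ^ (1 - p / 2) ≤ n * η ^ p * (L ^ (1 - p / 2) * κ ^ (p / 2)) := by
            refine mul_le_mul_of_nonneg_left ?_ (by positivity)
            exact le_mul_of_one_le_right (by positivity) e2
        _ = X * L := by rw [e1, hX]; ring
    have e4 : X / (2 * K) ≤ s := by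
      have : X / (2 * K) = X / K / 2 := by field_simp
      linarith
    calc 1 / 192 * (1 / (2 * κ * K)) * (σ ^ 2 * n * η ^ p * L ^ (1 - p / 2))
        = 1 / 192 * (σ ^ 2 / (2 * κ * K)) * (n * η ^ p * L ^ (1 - p / 2)) := by ring
      _ ≤ 1 / 192 * (σ ^ 2 / (2 * κ * K)) * (X * L) :=
          mul_le_mul_of_nonneg_left e3 (by positivity)
      _ = 1 / 192 * (X / (2 * K) * (σ ^ 2 * (L / κ))) := by field_simp
      _ ≤ 1 / 192 * (s * (σ ^ 2 * (L / κ))) := by gcongr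
  · rw [ht]
    calc (s : ℝ) * (σ ^ p * (L / κ) ^ (p / 2)) ≤ X * (σ ^ p * (L / κ) ^ (p / 2)) := by gcongr
      _ = σ ^ p * η ^ p * n * ((κ / L) ^ (p / 2) * (L / κ) ^ (p / 2)) := by rw [hX]; ring
      _ = σ ^ p * η ^ p * n := by rw [hprod, mul_one]
  · rw [mul_pow, Real.sq_sqrt (by positivity)]
    refine mul_le_mul_of_nonneg_left (le_min le_rfl ?_) hs0.le
    exact mul_le_mul_of_nonneg_left hgain (sq_nonneg _)

theorem strong_rate_le {n : ℕ} {σ η p : ℝ} (hn : 2 ≤ n) (hσ : 0 < σ)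
    (hT : (BallType.strong p).NotSuperSparse n η) (h1 : η ≤ 1) :
    ENNReal.ofReal (1 / 192 * (σ ^ 2 * n * η ^ 2))
      ≤ minimaxRisk n σ ((BallType.strong p).ball n σ η) := by
  have hn0 : (0 : ℝ) < n := by exact_mod_cast (by omega : 0 < n)
  have hη := hT.pos hn
  refine le_minimaxRisk_of_spikes (s := n) (t := σ * η) hn hσ hT
    (spikes_mem_strong le_rfl hT.1 (by positivity) (by omega) (le_of_eq ?_)) (by omega) le_rfl ?_
  · rw [Real.mul_rpow hσ.le hη.le]; ring
  · rw [div_self hn0.ne', Real.log_one, add_zero, mul_one, mul_pow, mul_comm (σ ^ 2), mul_assoc]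
    refine mul_le_mul_of_nonneg_left (le_min le_rfl ?_) hn0.le
    have : η ^ 2 ≤ 1 := pow_le_one₀ hη.le h1
    nlinarith [sq_nonneg σ]

theorem log_le_sum_inv {q : ℝ} (hq : 0 ≤ q) (n : ℕ) :
    Real.log ((n + 1 + q) / (1 + q)) ≤ ∑ i ∈ Finset.range n, 1 / ((i : ℝ) + 1 + q) := by
  induction n with
  | zero => simp [div_self (by positivity : (1 + q) ≠ 0)]
  | succ k ih =>
    rw [Finset.sum_range_succ]
    have h : Real.log (((k + 1 : ℕ) + 1 + q) / (1 + q))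
        = Real.log ((k + 1 + q) / (1 + q)) + Real.log (1 + 1 / ((k : ℝ) + 1 + q)) := by
      rw [← Real.log_mul (by positivity) (by positivity)]
      congr 1
      push_cast
      field_simp
      ring
    have h2 := Real.log_le_sub_one_of_pos (by positivity : 0 < 1 + 1 / ((k : ℝ) + 1 + q))
    rw [h]
    linarith

/-- The vector with coordinates `σ η √(n / i)` lies in the weak `l₂`-ball; the harmonic sum of its
truncated energy produces the additional logarithm. -/
theorem weak_two_rate_le {n : ℕ} {σ η : ℝ} (hn : 2 ≤ n) (hσ : 0 < σ)
    (hT : (BallType.weak 2).NotSuperSparse n η) :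
    ENNReal.ofReal (1 / 576 * (σ ^ 2 * n * η ^ 2 * Real.log (η ^ (-2 : ℝ))))
      ≤ minimaxRisk n σ ((BallType.weak 2).ball n σ η) := by
  have hn0 : (0 : ℝ) < n := by exact_mod_cast (by omega : 0 < n)
  have hη := hT.pos hn
  set u : Fin n → ℝ := fun i => σ * η * Real.sqrt ((n : ℝ) / ((i : ℕ) + 1 : ℝ)) with hu
  have hu0 : ∀ i, 0 ≤ u i := fun i => by positivity
  have hanti : Antitone fun i => |u i| := by
    intro i j hij
    have : ((i : ℕ) : ℝ) ≤ (j : ℕ) := by exact_mod_cast hij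
    simp only [abs_of_nonneg (hu0 _)]
    simp only [hu]
    gcongr
  have hmem : u ∈ (BallType.weak 2).ball n σ η := by
    intro i
    rw [← Real.sqrt_eq_rpow, absOrdered_le_iff]
    calc _ ≤ (Finset.Iio i).card := by
          refine Finset.card_le_card fun k hk => ?_
          rw [Finset.mem_Iio]
          by_contra hik
          have h2 := hanti (not_lt.1 hik)
          rw [Finset.mem_filter] at hk
          simp only [abs_of_nonneg (hu0 _)] at h2 hk
          exact absurd hk.2 (not_lt.2 h2)
      _ = i := Fin.card_Iio i
  refine le_trans (ENNReal.ofReal_le_ofReal ?_)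
    ((BallType.isSolid_ball hT).truncEnergy_le_minimaxRisk hn hσ hmem hanti)
  set q : ℝ := n * η ^ 2 with hq
  have hq0 : 0 < q := by positivity
  have hq2 : 1 / 2 ≤ q := by
    have := rpow_radius_ge hn (by norm_num : (0 : ℝ) < 2) le_rfl hT.2
    have h3 : Real.log 2 ≤ Real.log n := Real.log_le_log (by norm_num) (by exact_mod_cast hn)
    have h4 := Real.log_two_gt_d9
    norm_num at this
    linarith
  -- `min (x, 1) ≥ x / (1 + x)` with `x = q / (i + 1)` makes the sum telescope against a logarithm.
  have hterm : ∀ i : Fin n, σ ^ 2 * q * (1 / (((i : ℕ) : ℝ) + 1 + q)) ≤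
      min (u i ^ 2) (σ ^ 2 * (1 + Real.log ((n : ℝ) / ((i : ℕ) + 1 : ℝ)))) := by
    intro i
    have hi : (0 : ℝ) < (i : ℕ) + 1 := by positivity
    have hlog := log_div_nonneg (n := n) hi (by exact_mod_cast i.2)
    refine le_min ?_ ?_
    · have : u i ^ 2 = σ ^ 2 * q * (1 / (((i : ℕ) : ℝ) + 1)) := by
        rw [hu]; simp only
        rw [mul_pow, Real.sq_sqrt (by positivity), hq]; ring
      rw [this]
      exact mul_le_mul_of_nonneg_left (one_div_le_one_div_of_le hi (by linarith)) (by positivity)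
    · rw [mul_assoc]
      refine mul_le_mul_of_nonneg_left ?_ (sq_nonneg _)
      have : q * (1 / (((i : ℕ) : ℝ) + 1 + q)) ≤ 1 := by
        rw [mul_one_div, div_le_one (by positivity)]; linarith
      linarith
  have hsum : σ ^ 2 * q * Real.log ((n + 1 + q) / (1 + q)) ≤ truncEnergy n σ u := by
    calc _ ≤ σ ^ 2 * q * ∑ i ∈ Finset.range n, 1 / ((i : ℝ) + 1 + q) :=
          mul_le_mul_of_nonneg_left (log_le_sum_inv hq0.le n) (by positivity)
      _ = ∑ i : Fin n, σ ^ 2 * q * (1 / (((i : ℕ) : ℝ) + 1 + q)) := by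
          rw [Finset.sum_range, Finset.mul_sum]
      _ ≤ _ := Finset.sum_le_sum fun i _ => hterm i
  have hlog3 : Real.log (η ^ (-2 : ℝ)) ≤ 3 * Real.log ((n + 1 + q) / (1 + q)) := by
    have e : (3 : ℝ) * Real.log ((n + 1 + q) / (1 + q))
        = Real.log (((n + 1 + q) / (1 + q)) ^ 3) := by
      rw [Real.log_pow]; norm_num
    rw [e]
    refine Real.log_le_log (by positivity) ?_
    have h3 : 1 + (1 / 3) * (1 / η ^ 2) ≤ (n + 1 + q) / (1 + q) := by
      rw [le_div_iff₀ (by positivity)]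
      have : 1 / η ^ 2 = n / q := by rw [hq]; field_simp
      rw [this]
      have h4 : (1 / 3) * (n / q) * (1 + q) ≤ n := by
        have : (1 / 3) * (n / q) * (1 + q) = n * ((1 + q) / (3 * q)) := by field_simp
        rw [this]
        refine mul_le_of_le_one_right hn0.le ?_
        rw [div_le_one (by positivity)]; linarith
      linarith
    have h5 : η ^ (-2 : ℝ) = 1 / η ^ 2 := by
      rw [Real.rpow_neg hη.le, one_div]; norm_num
    rw [h5]
    have hz : 0 ≤ 1 / η ^ 2 := by positivity
    set z := 1 / η ^ 2
    calc z ≤ (1 + 1 / 3 * z) ^ 3 := by nlinarith [pow_nonneg hz 3, sq_nonneg z]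
      _ ≤ _ := pow_le_pow_left₀ (by positivity) h3 3
  have : σ ^ 2 * q * Real.log (η ^ (-2 : ℝ))
      ≤ σ ^ 2 * q * (3 * Real.log ((n + 1 + q) / (1 + q))) :=
    mul_le_mul_of_nonneg_left hlog3 (by positivity)
  rw [hq] at this hsum
  nlinarith

/-! ### Upper bounds for the single-vector rates -/

theorem sum_min_le_of_mem_l0 {n : ℕ} {σ η Λ : ℝ} (hΛ : 0 ≤ Λ) {v : Fin n → ℝ}
    (hv : v ∈ BallType.l0.ball n σ η) : ∑ i, min (8 * v i ^ 2) Λ ≤ η * n * Λ := by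
  have hv : (l0norm v : ℝ) ≤ η * n := hv
  refine le_trans ?_ (mul_le_mul_of_nonneg_right hv hΛ)
  rw [l0norm_eq_sum, Finset.sum_mul]
  refine Finset.sum_le_sum fun i _ => ?_
  by_cases h : v i = 0
  · simp [h, hΛ]
  · simp [h]

theorem l0_le_rate {η₀ : ℝ} (h0 : 0 < η₀) (h1 : η₀ < 1) {n : ℕ} {σ η : ℝ} (hn : 2 ≤ n)
    (hσ : 0 < σ) (hT : BallType.l0.NotSuperSparse n η) (hη : η ≤ η₀) :
    minimaxRisk n σ (BallType.l0.ball n σ η) ≤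
      ENNReal.ofReal ((8 + 34 / Real.log η₀⁻¹) * (σ ^ 2 * n * η * Real.log η⁻¹)) := by
  have hη0 := hT.pos hn
  have hL₀ : 0 < Real.log η₀⁻¹ := Real.log_pos (by rw [one_lt_inv₀ h0]; exact h1)
  have hLL : Real.log η₀⁻¹ ≤ Real.log η⁻¹ := Real.log_le_log (by positivity) (by gcongr)
  set L := Real.log η⁻¹ with hL
  have hL0 : 0 < L := hL₀.trans_le hLL
  refine (minimaxRisk_le_soft hσ hL0.le (fun μ hμ =>
    sum_min_le_of_mem_l0 (Λ := σ ^ 2 * (8 * L + 2)) (by positivity) hμ)).trans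
    (ENNReal.ofReal_le_ofReal ?_)
  have e : Real.exp (-L) = η := by rw [hL, Real.log_inv, neg_neg, Real.exp_log hη0]
  rw [e]
  have h2 : 34 ≤ 34 / Real.log η₀⁻¹ * L := by
    rw [div_mul_eq_mul_div, le_div_iff₀ hL₀]; linarith
  have := mul_le_mul_of_nonneg_left h2 (by positivity : 0 ≤ σ ^ 2 * n * η)
  nlinarith

theorem absOrdered_sq_le_of_mem_weak {n : ℕ} {σ η p : ℝ} {v : Fin n → ℝ}
    (hv : v ∈ (BallType.weak p).ball n σ η) (i : Fin n) :
    absOrdered v i ^ 2 ≤ σ ^ 2 * η ^ 2 * (n : ℝ) ^ (2 / p) * (((i : ℕ) : ℝ) + 1) ^ (-(2 / p)) := by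
  have h := pow_le_pow_left₀ (absOrdered_nonneg v i) (hv i) 2
  refine h.trans (le_of_eq ?_)
  have hi : (0 : ℝ) < (i : ℕ) + 1 := by positivity
  have : (((n : ℝ) / ((i : ℕ) + 1)) ^ (1 / p)) ^ 2
      = (n : ℝ) ^ (2 / p) * (((i : ℕ) : ℝ) + 1) ^ (-(2 / p)) := by
    rw [← Real.rpow_natCast, ← Real.rpow_mul (by positivity), Real.div_rpow (by positivity) hi.le,
      Real.rpow_neg hi.le]
    have e : 1 / p * ((2 : ℕ) : ℝ) = 2 / p := by push_cast; ring
    rw [e, div_eq_mul_inv]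
  rw [mul_pow, this]; ring

theorem sum_Ico_rpow_neg_le {q : ℝ} (hq : 0 < q) {N n : ℕ} (hN : 1 ≤ N) (hNn : N ≤ n) :
    ∑ i ∈ Finset.Ico N n, ((i : ℝ) + 1) ^ (-q) ≤ ∫ x in (N : ℝ)..n, x ^ (-q) := by
  have h := AntitoneOn.sum_le_integral_Ico (f := fun x : ℝ => x ^ (-q)) hNn (by
    intro x hx y _ hxy
    have : (0 : ℝ) < N := by exact_mod_cast hN
    exact Real.rpow_le_rpow_of_nonpos (this.trans_le hx.1) hxy (by linarith))
  simpa using h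

theorem sum_Ico_rpow_neg_le_of_one_lt {q : ℝ} (hq : 1 < q) {N n : ℕ} (hN : 1 ≤ N) :
    ∑ i ∈ Finset.Ico N n, ((i : ℝ) + 1) ^ (-q) ≤ (N : ℝ) ^ (1 - q) / (q - 1) := by
  have hN0 : (0 : ℝ) < N := by exact_mod_cast hN
  have hq1 : 0 < q - 1 := by linarith
  rcases le_total n N with h | h
  · rw [Finset.Ico_eq_empty (by omega), Finset.sum_empty]
    positivity
  · refine (sum_Ico_rpow_neg_le (by linarith) hN h).trans ?_
    have hn0 : (0 : ℝ) < n := by exact_mod_cast (by omega : 0 < n)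
    rw [integral_rpow (Or.inr ⟨by linarith, Set.notMem_uIcc_of_lt hN0 hn0⟩)]
    rw [show -q + 1 = -(q - 1) by ring, show 1 - q = -(q - 1) by ring, div_neg, ← neg_div]
    have : (0 : ℝ) ≤ (n : ℝ) ^ (-(q - 1)) := by positivity
    gcongr
    linarith

theorem sum_Ico_rpow_neg_le_of_lt_one {q : ℝ} (hq0 : 0 < q) (hq : q < 1) {n : ℕ} (hn : 1 ≤ n) :
    ∑ i ∈ Finset.Ico 1 n, ((i : ℝ) + 1) ^ (-q) ≤ (n : ℝ) ^ (1 - q) / (1 - q) := by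
  refine (sum_Ico_rpow_neg_le hq0 le_rfl hn).trans ?_
  have hq1 : 0 < 1 - q := by linarith
  rw [integral_rpow (Or.inl (by linarith)), show -q + 1 = 1 - q by ring]
  simp only [Nat.cast_one, Real.one_rpow]
  gcongr
  linarith

theorem sum_Ico_inv_le {N n : ℕ} (hN : 1 ≤ N) (hNn : N ≤ n) :
    ∑ i ∈ Finset.Ico N n, ((i : ℝ) + 1) ^ (-1 : ℝ) ≤ Real.log ((n : ℝ) / N) := by
  have hN0 : (0 : ℝ) < N := by exact_mod_cast hN
  have hn0 : (0 : ℝ) < n := by exact_mod_cast (by omega : 0 < n)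
  refine (sum_Ico_rpow_neg_le one_pos hN hNn).trans (le_of_eq ?_)
  simp_rw [Real.rpow_neg_one]
  exact integral_inv_of_pos hN0 hn0

theorem sum_fin_le_head_add_tail {n N : ℕ} {Λ : ℝ} (hΛ : 0 ≤ Λ) (f : Fin n → ℝ) (g : ℕ → ℝ)
    (hf : ∀ i, f i ≤ Λ) (hg : ∀ i : Fin n, f i ≤ g i) :
    ∑ i, f i ≤ N * Λ + ∑ i ∈ Finset.Ico N n, g i := by
  calc ∑ i, f i ≤ ∑ i : Fin n, (if (i : ℕ) < N then Λ else g i) :=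
        Finset.sum_le_sum fun i _ => by split_ifs; exacts [hf i, hg i]
    _ = ∑ i ∈ Finset.range n, (if i < N then Λ else g i) := by rw [Finset.sum_range]
    _ = ∑ i ∈ Finset.range n with i < N, Λ + ∑ i ∈ Finset.range n with ¬ i < N, g i :=
        Finset.sum_ite _ _
    _ ≤ _ := by
        refine add_le_add ?_ (le_of_eq (Finset.sum_congr ?_ fun _ _ => rfl))
        · rw [Finset.sum_const, nsmul_eq_mul]
          refine mul_le_mul_of_nonneg_right ?_ hΛ
          have : (Finset.filter (fun i => i < N) (Finset.range n)).card ≤ (Finset.range N).card :=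
            Finset.card_le_card fun i hi => by simp at hi ⊢; exact hi.2
          rw [Finset.card_range] at this
          exact_mod_cast this
        · ext i; simp; omega

/-- The first `N` ordered coordinates are bounded by the truncation level and the others by the
envelope of the weak ball. -/
theorem sum_min_le_of_mem_weak {n N : ℕ} {σ η p Λ : ℝ} (hΛ : 0 ≤ Λ) {v : Fin n → ℝ}
    (hv : v ∈ (BallType.weak p).ball n σ η) :
    ∑ i, min (8 * v i ^ 2) Λ ≤ N * Λ + 8 * (σ ^ 2 * η ^ 2 * (n : ℝ) ^ (2 / p)) *
      ∑ i ∈ Finset.Ico N n, ((i : ℝ) + 1) ^ (-(2 / p)) := by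
  have e : ∑ i, min (8 * v i ^ 2) Λ = ∑ i, min (8 * absOrdered v i ^ 2) Λ := by
    rw [sum_absOrdered v fun x => min (8 * x ^ 2) Λ]
    simp
  rw [e, Finset.mul_sum]
  refine sum_fin_le_head_add_tail hΛ _
    (fun i => 8 * (σ ^ 2 * η ^ 2 * (n : ℝ) ^ (2 / p)) * ((i : ℝ) + 1) ^ (-(2 / p)))
    (fun i => min_le_right _ _) fun i => (min_le_left _ _).trans ?_
  have := absOrdered_sq_le_of_mem_weak hv i
  linarith

theorem exp_neg_log_rpow {η p : ℝ} (hη : 0 < η) : Real.exp (-Real.log (η ^ (-p))) = η ^ p := by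
  rw [Real.exp_neg, Real.exp_log (by positivity), Real.rpow_neg hη.le, inv_inv]

theorem weak_le_rate_of_lt_two {p η₀ : ℝ} (hp : 0 < p) (hp2 : p < 2) (h0 : 0 < η₀)
    (h1 : η₀ < 1) :
    ∃ A : ℝ, 0 < A ∧ ∀ (n : ℕ) (σ η : ℝ), 2 ≤ n → 0 < σ →
      (BallType.weak p).NotSuperSparse n η → η ≤ η₀ →
      minimaxRisk n σ ((BallType.weak p).ball n σ η) ≤
        ENNReal.ofReal (A * (σ ^ 2 * n * η ^ p * (Real.log (η ^ (-p))) ^ (1 - p / 2))) := by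
  set q : ℝ := 2 / p with hq
  have hq1 : 1 < q := by rw [hq, one_lt_div hp]; exact hp2
  have hq10 : 0 < q - 1 := by linarith
  set κ : ℝ := 1 + p with hκ
  have hκ0 : 0 < κ := by positivity
  set L₀ := Real.log (η₀ ^ (-p)) with hL₀
  have hL₀0 : 0 < L₀ := log_rpow_neg_pos h0 h1 hp
  refine ⟨(1 + κ ^ (p / 2)) * (8 + 2 / L₀) + 8 / (q - 1) + 32 / L₀ ^ (1 - p / 2), by positivity, ?_⟩
  intro n σ η hn hσ hT hη
  have hn0 : (0 : ℝ) < n := by exact_mod_cast (by omega : 0 < n)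
  have hη0 := hT.pos hn
  set L := Real.log (η ^ (-p)) with hL
  have hLL : L₀ ≤ L := log_rpow_neg_anti hη0 hη hp
  have hL0 : 0 < L := hL₀0.trans_le hLL
  set x : ℝ := n * η ^ p / L ^ (p / 2) with hx
  have hx0 : 0 < x := by positivity
  have hx1 : 1 ≤ x * κ ^ (p / 2) := by
    have := one_le_mul_rpow_div_log hn hp hp2.le hT.2 hL0
    rw [Real.div_rpow hκ0.le hL0.le] at this
    calc (1 : ℝ) ≤ _ := this
      _ = x * κ ^ (p / 2) := by rw [hx]; ring
  set N := ⌈x⌉₊ with hN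
  have hN1 : 1 ≤ N := Nat.one_le_ceil_iff.2 hx0
  have hxN : x ≤ N := Nat.le_ceil x
  have hNx : (N : ℝ) ≤ (1 + κ ^ (p / 2)) * x := by
    have := Nat.ceil_lt_add_one hx0.le
    linarith
  set r := σ ^ 2 * n * η ^ p * L ^ (1 - p / 2) with hr
  have hr0 : 0 < r := by positivity
  have hxr : σ ^ 2 * (x * L) = r := by
    rw [hr, hx, Real.rpow_sub hL0, Real.rpow_one]; ring
  refine (minimaxRisk_le_soft hσ hL0.le (fun μ hμ =>
    sum_min_le_of_mem_weak (N := N) (Λ := σ ^ 2 * (8 * L + 2)) (by positivity) hμ)).trans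
    (ENNReal.ofReal_le_ofReal ?_)
  rw [exp_neg_log_rpow hη0]
  have b1 : N * (σ ^ 2 * (8 * L + 2)) ≤ (1 + κ ^ (p / 2)) * (8 + 2 / L₀) * r := by
    have h2 : 2 ≤ 2 / L₀ * L := by
      rw [div_mul_eq_mul_div, le_div_iff₀ hL₀0]; linarith
    calc N * (σ ^ 2 * (8 * L + 2)) ≤ (1 + κ ^ (p / 2)) * x * (σ ^ 2 * (8 * L + 2 / L₀ * L)) := by
          gcongr
      _ = (1 + κ ^ (p / 2)) * (8 + 2 / L₀) * (σ ^ 2 * (x * L)) := by ring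
      _ = _ := by rw [hxr]
  have b2 : 8 * (σ ^ 2 * η ^ 2 * (n : ℝ) ^ (2 / p)) *
      ∑ i ∈ Finset.Ico N n, ((i : ℝ) + 1) ^ (-(2 / p)) ≤ 8 / (q - 1) * r := by
    have h2 : ∑ i ∈ Finset.Ico N n, ((i : ℝ) + 1) ^ (-q) ≤ x ^ (1 - q) / (q - 1) := by
      refine (sum_Ico_rpow_neg_le_of_one_lt hq1 hN1).trans ?_
      exact div_le_div_of_nonneg_right (Real.rpow_le_rpow_of_nonpos hx0 hxN (by linarith)) hq10.le
    have h3 : η ^ 2 * (n : ℝ) ^ q * x ^ (1 - q) = n * η ^ p * L ^ (1 - p / 2) := by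
      rw [hx, Real.div_rpow (by positivity) (by positivity), Real.mul_rpow hn0.le (by positivity),
        ← Real.rpow_mul hη0.le, ← Real.rpow_mul hL0.le]
      have e1 : p * (1 - q) = p - 2 := by rw [hq]; field_simp
      have e2 : p / 2 * (1 - q) = -(1 - p / 2) := by rw [hq]; field_simp; ring
      rw [e1, e2, Real.rpow_neg hL0.le, Real.rpow_sub hn0, Real.rpow_one, Real.rpow_sub hη0,
        Real.rpow_two]
      field_simp
    calc _ ≤ 8 * (σ ^ 2 * η ^ 2 * (n : ℝ) ^ q) * (x ^ (1 - q) / (q - 1)) := by gcongr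
      _ = 8 / (q - 1) * (σ ^ 2 * (η ^ 2 * (n : ℝ) ^ q * x ^ (1 - q))) := by ring
      _ = 8 / (q - 1) * r := by rw [h3, hr]; ring
  have b3 : 32 * σ ^ 2 * n * η ^ p ≤ 32 / L₀ ^ (1 - p / 2) * r := by
    have h2 : L₀ ^ (1 - p / 2) ≤ L ^ (1 - p / 2) :=
      Real.rpow_le_rpow hL₀0.le hLL (by linarith)
    rw [div_mul_eq_mul_div, le_div_iff₀ (by positivity), hr]
    have := mul_le_mul_of_nonneg_left h2 (by positivity : 0 ≤ 32 * σ ^ 2 * n * η ^ p)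
    linarith
  linarith

theorem sum_sq_le_of_mem_strong {n : ℕ} {σ η p : ℝ} (hn : 0 < n) (hσ : 0 < σ) (hη : 0 ≤ η)
    (hp : 2 ≤ p) {v : Fin n → ℝ} (hv : v ∈ (BallType.strong p).ball n σ η) :
    ∑ i, v i ^ 2 ≤ σ ^ 2 * n * η ^ 2 := by
  have hn0 : (0 : ℝ) < n := by exact_mod_cast hn
  have hv : 1 / (n : ℝ) * ∑ i, |v i| ^ p ≤ σ ^ p * η ^ p := hv
  have hp0 : 0 < p := by linarith
  have h := Real.rpow_arith_mean_le_arith_mean_rpow (p := p / 2) Finset.univ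
    (fun _ : Fin n => 1 / (n : ℝ)) (fun i => v i ^ 2) (fun _ _ => by positivity)
    (by simp [hn0.ne']) (fun _ _ => sq_nonneg _) (by linarith)
  have e : ∀ i, (v i ^ 2) ^ (p / 2) = |v i| ^ p := fun i => by
    rw [← sq_abs, ← Real.rpow_natCast, ← Real.rpow_mul (abs_nonneg _)]
    congr 1; push_cast; ring
  simp_rw [e] at h
  rw [← Finset.mul_sum, ← Finset.mul_sum] at h
  have h2 := h.trans hv
  have e2 : σ ^ p * η ^ p = (σ ^ 2 * η ^ 2) ^ (p / 2) := by
    rw [← mul_pow, ← Real.mul_rpow hσ.le hη, ← Real.rpow_natCast, ← Real.rpow_mul (by positivity)]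
    congr 1; push_cast; ring
  rw [e2, Real.rpow_le_rpow_iff (by positivity) (by positivity) (by positivity), one_div,
    inv_mul_le_iff₀ hn0] at h2
  linarith

theorem sum_sq_le_of_mem_weak {n : ℕ} {σ η p : ℝ} (hn : 0 < n)
    (hp : 2 < p) {v : Fin n → ℝ} (hv : v ∈ (BallType.weak p).ball n σ η) :
    ∑ i, v i ^ 2 ≤ (1 + 1 / (1 - 2 / p)) * (σ ^ 2 * n * η ^ 2) := by
  have hn0 : (0 : ℝ) < n := by exact_mod_cast hn
  have hn1 : (1 : ℝ) ≤ n := by exact_mod_cast hn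
  set q : ℝ := 2 / p with hq
  have hq0 : 0 < q := by positivity
  have hq1 : q < 1 := by rw [hq, div_lt_one (by linarith)]; exact hp
  have hq10 : 0 < 1 - q := by linarith
  set Λ := σ ^ 2 * η ^ 2 * (n : ℝ) ^ q with hΛ
  have e : ∑ i, v i ^ 2 = ∑ i, absOrdered v i ^ 2 := by
    rw [sum_absOrdered v fun x => x ^ 2]; simp
  have hb := absOrdered_sq_le_of_mem_weak hv
  have h := sum_fin_le_head_add_tail (N := 1) (Λ := Λ) (by positivity)
    (fun i => absOrdered v i ^ 2) (fun i => Λ * ((i : ℝ) + 1) ^ (-q)) (fun i => ?_) hb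
  · rw [e]
    refine h.trans ?_
    rw [← Finset.mul_sum]
    have h2 := sum_Ico_rpow_neg_le_of_lt_one hq0 hq1 (n := n) hn
    have h3 : (n : ℝ) ^ q ≤ n := by
      calc (n : ℝ) ^ q ≤ (n : ℝ) ^ (1 : ℝ) := Real.rpow_le_rpow_of_exponent_le hn1 hq1.le
        _ = n := Real.rpow_one _
    have h4 : (n : ℝ) ^ q * (n : ℝ) ^ (1 - q) = n := by
      rw [← Real.rpow_add hn0]; simp
    calc _ ≤ Λ + Λ * ((n : ℝ) ^ (1 - q) / (1 - q)) := by
          simp only [Nat.cast_one, one_mul]; gcongr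
      _ = σ ^ 2 * η ^ 2 * (n : ℝ) ^ q
            + σ ^ 2 * η ^ 2 * ((n : ℝ) ^ q * (n : ℝ) ^ (1 - q)) / (1 - q) := by
          rw [hΛ]; ring
      _ ≤ σ ^ 2 * η ^ 2 * n + σ ^ 2 * η ^ 2 * n / (1 - q) := by
          rw [h4]; gcongr
      _ = _ := by ring
  · refine (hb i).trans (mul_le_of_le_one_right (by positivity) ?_)
    exact Real.rpow_le_one_of_one_le_of_nonpos (by linarith [Nat.cast_nonneg (α := ℝ) (i : ℕ)])
      (by linarith)

theorem weak_two_le_rate {η₀ : ℝ} (h0 : 0 < η₀) (h1 : η₀ < 1) {n : ℕ} {σ η : ℝ} (hn : 2 ≤ n)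
    (hσ : 0 < σ) (hT : (BallType.weak 2).NotSuperSparse n η) (hη : η ≤ η₀) :
    minimaxRisk n σ ((BallType.weak 2).ball n σ η) ≤
      ENNReal.ofReal ((32 + 38 / Real.log (η₀ ^ (-2 : ℝ))) *
        (σ ^ 2 * n * η ^ 2 * Real.log (η ^ (-2 : ℝ)))) := by
  have hn0 : (0 : ℝ) < n := by exact_mod_cast (by omega : 0 < n)
  have hη0 := hT.pos hn
  set L₀ := Real.log (η₀ ^ (-2 : ℝ)) with hL₀
  have hL₀0 : 0 < L₀ := log_rpow_neg_pos h0 h1 two_pos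
  set L := Real.log (η ^ (-2 : ℝ)) with hL
  have hLL : L₀ ≤ L := log_rpow_neg_anti hη0 hη two_pos
  have hL0 : 0 < L := hL₀0.trans_le hLL
  set q : ℝ := n * η ^ 2 with hq
  have hq0 : 0 < q := by positivity
  have hq2 : 1 / 2 ≤ q := by
    have := rpow_radius_ge hn (by norm_num : (0 : ℝ) < 2) le_rfl hT.2
    have h3 : Real.log 2 ≤ Real.log n := Real.log_le_log (by norm_num) (by exact_mod_cast hn)
    have h4 := Real.log_two_gt_d9
    norm_num at this
    linarith
  set N := ⌈q⌉₊ with hN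
  have hN1 : 1 ≤ N := Nat.one_le_ceil_iff.2 hq0
  have hqN : q ≤ N := Nat.le_ceil q
  have hN3 : (N : ℝ) ≤ 3 * q := by
    have := Nat.ceil_lt_add_one hq0.le
    linarith
  have hNn : N ≤ n := Nat.ceil_le.2 (by
    have : η ^ 2 ≤ 1 := pow_le_one₀ hη0.le (hη.trans h1.le)
    rw [hq]; nlinarith)
  refine (minimaxRisk_le_soft hσ hL0.le (fun μ hμ =>
    sum_min_le_of_mem_weak (N := N) (Λ := σ ^ 2 * (8 * L + 2)) (by positivity) hμ)).trans
    (ENNReal.ofReal_le_ofReal ?_)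
  rw [exp_neg_log_rpow hη0, show (2 : ℝ) / 2 = 1 by norm_num, Real.rpow_one, Real.rpow_two]
  have hlog : ∑ i ∈ Finset.Ico N n, ((i : ℝ) + 1) ^ (-1 : ℝ) ≤ L := by
    refine (sum_Ico_inv_le hN1 hNn).trans ?_
    have e : (n : ℝ) / q = η ^ (-2 : ℝ) := by
      rw [Real.rpow_neg hη0.le, Real.rpow_two, hq]; field_simp
    rw [hL, ← e]
    refine Real.log_le_log (div_pos hn0 (by linarith)) (by gcongr)
  have h2 : 38 ≤ 38 / L₀ * L := by
    rw [div_mul_eq_mul_div, le_div_iff₀ hL₀0]; linarith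
  calc _ ≤ 3 * q * (σ ^ 2 * (8 * L + 2)) + 8 * (σ ^ 2 * η ^ 2 * n) * L + 32 * σ ^ 2 * n * η ^ 2 := by
        gcongr
    _ = σ ^ 2 * q * (32 * L + 38) := by rw [hq]; ring
    _ ≤ σ ^ 2 * q * (32 * L + 38 / L₀ * L) := by gcongr
    _ = _ := by rw [hq]; ring

/-- In the sparse regime the minimax risk is of the order of `BallType.sparseRate`. -/
theorem sparseRate_bounds (T : BallType) {η₀ : ℝ} (h0 : 0 < η₀) (h1 : η₀ < 1) :
    ∃ a A : ℝ, 0 < a ∧ 0 < A ∧ ∀ (n : ℕ) (σ η : ℝ), 2 ≤ n → 0 < σ → T.NotSuperSparse n η →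
      η ≤ η₀ →
      ENNReal.ofReal (a * T.sparseRate n σ η) ≤ minimaxRisk n σ (T.ball n σ η) ∧
        minimaxRisk n σ (T.ball n σ η) ≤ ENNReal.ofReal (A * T.sparseRate n σ η) := by
  match T with
  | .l0 =>
    have hL₀ : 0 < Real.log η₀⁻¹ := Real.log_pos (by rw [one_lt_inv₀ h0]; exact h1)
    exact ⟨1 / 384, 8 + 34 / Real.log η₀⁻¹, by norm_num, by positivity, fun n σ η hn hσ hT hη =>
      ⟨l0_rate_le hn hσ hT (hη.trans_lt h1), l0_le_rate h0 h1 hn hσ hT hη⟩⟩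
  | .strong p =>
    rcases le_or_gt p 0 with hp | hp
    · exact ⟨1, 1, one_pos, one_pos, fun n σ η _ _ hT => absurd hT.1 (not_lt.2 hp)⟩
    rcases lt_or_ge p 2 with hp2 | hp2
    · obtain ⟨a, ha, hlow⟩ := strong_rate_le_of_lt_two hp hp2 h0 h1
      obtain ⟨A, hA, hup⟩ := weak_le_rate_of_lt_two hp hp2 h0 h1
      refine ⟨a, A, ha, hA, fun n σ η hn hσ hT hη => ?_⟩
      simp only [BallType.sparseRate, if_pos hp2]
      exact ⟨hlow n σ η hn hσ hT hη,
        (minimaxRisk_mono (strong_subset_weak hσ hT.nonneg hp)).trans (hup n σ η hn hσ hT hη)⟩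
    · refine ⟨1 / 192, 1, by norm_num, one_pos, fun n σ η hn hσ hT hη => ?_⟩
      simp only [BallType.sparseRate, if_neg (not_lt.2 hp2)]
      refine ⟨strong_rate_le hn hσ hT (hη.trans h1.le), ?_⟩
      rw [one_mul]
      exact minimaxRisk_le_of_sum_sq_le fun v hv =>
        sum_sq_le_of_mem_strong (by omega) hσ hT.nonneg hp2 hv
  | .weak p =>
    rcases le_or_gt p 0 with hp | hp
    · exact ⟨1, 1, one_pos, one_pos, fun n σ η _ _ hT => absurd hT.1 (not_lt.2 hp)⟩
    rcases lt_trichotomy p 2 with hp2 | rfl | hp2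
    · obtain ⟨a, ha, hlow⟩ := strong_rate_le_of_lt_two hp hp2 h0 h1
      obtain ⟨A, hA, hup⟩ := weak_le_rate_of_lt_two hp hp2 h0 h1
      refine ⟨a, A, ha, hA, fun n σ η hn hσ hT hη => ?_⟩
      simp only [BallType.sparseRate, if_pos hp2]
      exact ⟨(hlow n σ η hn hσ hT hη).trans
        (minimaxRisk_mono (strong_subset_weak hσ hT.nonneg hp)), hup n σ η hn hσ hT hη⟩
    · have hL₀0 : 0 < Real.log (η₀ ^ (-2 : ℝ)) := log_rpow_neg_pos h0 h1 two_pos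
      refine ⟨1 / 576, 32 + 38 / Real.log (η₀ ^ (-2 : ℝ)), by norm_num, by positivity,
        fun n σ η hn hσ hT hη => ?_⟩
      simp only [BallType.sparseRate, lt_irrefl, if_false, if_true]
      exact ⟨weak_two_rate_le hn hσ hT, weak_two_le_rate h0 h1 hn hσ hT hη⟩
    · have hq1 : 2 / p < 1 := by rw [div_lt_one hp]; exact hp2
      have hq10 : 0 < 1 - 2 / p := by linarith
      refine ⟨1 / 192, 1 + 1 / (1 - 2 / p), by norm_num, by positivity,
        fun n σ η hn hσ hT hη => ?_⟩
      simp only [BallType.sparseRate, if_neg (not_lt.2 hp2.le), if_neg hp2.ne']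
      refine ⟨(strong_rate_le hn hσ hT (hη.trans h1.le)).trans
        (minimaxRisk_mono (strong_subset_weak hσ hT.nonneg hp)), ?_⟩
      exact minimaxRisk_le_of_sum_sq_le fun v hv => sum_sq_le_of_mem_weak (by omega) hp2 hv

theorem minimaxRisk_bounds (T : BallType) (η₀ : ℝ) (h0 : 0 < η₀) (h1 : η₀ < 1) :
    ∃ a A : ℝ, 0 < a ∧ 0 < A ∧
      ∀ (n : ℕ) (σ η : ℝ), 2 ≤ n → 0 < σ → T.NotSuperSparse n η →
        (η₀ ≤ η →
          ENNReal.ofReal (a * denseRate n σ) ≤ minimaxRisk n σ (T.ball n σ η) ∧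
            minimaxRisk n σ (T.ball n σ η) ≤ ENNReal.ofReal (A * denseRate n σ)) ∧
        (η ≤ η₀ →
          ENNReal.ofReal (a * T.sparseRate n σ η) ≤ minimaxRisk n σ (T.ball n σ η) ∧
            minimaxRisk n σ (T.ball n σ η) ≤ ENNReal.ofReal (A * T.sparseRate n σ η)) := by
  obtain ⟨a, A, ha, hA, h⟩ := sparseRate_bounds T h0 h1
  refine ⟨min a (η₀ ^ 2 / 384), max A 1, by positivity, by positivity, fun n σ η hn hσ hT => ?_⟩
  have hd : 0 ≤ denseRate n σ := by unfold denseRate; positivity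
  refine ⟨fun hη => ⟨?_, ?_⟩, fun hη => ?_⟩
  · refine le_trans (ENNReal.ofReal_le_ofReal ?_) (denseRate_le_minimaxRisk hn hσ h0 h1 hT hη)
    exact mul_le_mul_of_nonneg_right (min_le_right _ _) hd
  · refine (minimaxRisk_le_denseRate _).trans (ENNReal.ofReal_le_ofReal ?_)
    exact le_mul_of_one_le_left hd (le_max_right _ _)
  · obtain ⟨hlow, hup⟩ := h n σ η hn hσ hT hη
    have hr : 0 ≤ T.sparseRate n σ η := by
      have hη0 := hT.pos hn
      have hη1 : η < 1 := hη.trans_lt h1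
      unfold BallType.sparseRate
      match T, hT with
      | .l0, hT =>
        have := Real.log_nonneg (by rw [one_le_inv₀ hη0]; exact hη1.le : 1 ≤ η⁻¹)
        simp only
        positivity
      | .strong p, hT =>
        have := (log_rpow_neg_pos hη0 hη1 hT.1).le
        simp only
        split_ifs <;> positivity
      | .weak p, hT =>
        have := (log_rpow_neg_pos hη0 hη1 hT.1).le
        have := (log_rpow_neg_pos hη0 hη1 two_pos).le
        simp only
        split_ifs <;> positivity
    refine ⟨le_trans (ENNReal.ofReal_le_ofReal ?_) hlow, hup.trans (ENNReal.ofReal_le_ofReal ?_)⟩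
    · exact mul_le_mul_of_nonneg_right (min_le_left _ _) hr
    · exact mul_le_mul_of_nonneg_right (le_max_left _ _) hr

/-! ### The exponential mixture and control of the noise on random supports -/

/-- The mixture over all subsets `S` of the products `∏_{i ∈ S} F i (x i)`, where `S` has weight
`w |S|`. -/
def sparseMixture {ι : Type*} [Fintype ι] {X : ι → Type*} (w : ℕ → ℝ) (F : ∀ i, X i → ℝ)
    (x : ∀ i, X i) : ℝ :=
  ∑ S : Finset ι, w S.card * ∏ i ∈ S, F i (x i)

section Mixture

variable {ι : Type*} [Fintype ι] {X : ι → Type*} {w : ℕ → ℝ} {F : ∀ i, X i → ℝ}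

theorem le_sparseMixture (hw : ∀ k, 0 ≤ w k) (hF : ∀ i x, 0 ≤ F i x) (x : ∀ i, X i)
    (S : Finset ι) : w S.card * ∏ i ∈ S, F i (x i) ≤ sparseMixture w F x :=
  Finset.single_le_sum (f := fun S : Finset ι => w S.card * ∏ i ∈ S, F i (x i))
    (fun _ _ => mul_nonneg (hw _) (Finset.prod_nonneg fun i _ => hF i _)) (Finset.mem_univ S)

theorem sparseMixture_nonneg (hw : ∀ k, 0 ≤ w k) (hF : ∀ i x, 0 ≤ F i x) (x : ∀ i, X i) :
    0 ≤ sparseMixture w F x :=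
  Finset.sum_nonneg fun _ _ => mul_nonneg (hw _) (Finset.prod_nonneg fun i _ => hF i _)

variable [∀ i, MeasurableSpace (X i)] {P : ∀ i, Measure (X i)} [∀ i, IsProbabilityMeasure (P i)]

theorem integrable_prod_subset (hF : ∀ i, Integrable (F i) (P i)) (S : Finset ι) :
    Integrable (fun x : ∀ i, X i => ∏ i ∈ S, F i (x i)) (Measure.pi P) := by
  classical
  have h := Integrable.fintype_prod_dep (f := fun i x => if i ∈ S then F i x else 1) (μ := P)
    (fun i => by by_cases h : i ∈ S <;> simp [h, hF i])
  convert h using 2 with x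
  rw [Finset.prod_ite_mem, Finset.univ_inter]

theorem integral_prod_subset (hF1 : ∀ i, ∫ x, F i x ∂P i = 1) (S : Finset ι) :
    ∫ x : ∀ i, X i, ∏ i ∈ S, F i (x i) ∂Measure.pi P = 1 := by
  classical
  have h := integral_fintype_prod_eq_prod (𝕜 := ℝ) (fun i x => if i ∈ S then F i x else 1) (μ := P)
  have e : ∀ x : ∀ i, X i, ∏ i ∈ S, F i (x i) = ∏ i, if i ∈ S then F i (x i) else 1 := fun x => by
    rw [Finset.prod_ite_mem, Finset.univ_inter]
  simp_rw [e]
  rw [h]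
  refine Finset.prod_eq_one fun i _ => ?_
  by_cases h : i ∈ S <;> simp [h, hF1 i]

theorem integrable_sparseMixture (hF : ∀ i, Integrable (F i) (P i)) :
    Integrable (sparseMixture w F) (Measure.pi P) :=
  integrable_finsetSum _ fun S _ => (integrable_prod_subset hF S).const_mul _

theorem integral_sparseMixture (hF : ∀ i, Integrable (F i) (P i))
    (hF1 : ∀ i, ∫ x, F i x ∂P i = 1)
    (hw : ∑ k ∈ Finset.range (Fintype.card ι + 1), ((Fintype.card ι).choose k : ℝ) * w k = 1) :
    ∫ x, sparseMixture w F x ∂Measure.pi P = 1 := by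
  unfold sparseMixture
  rw [integral_finsetSum _ fun S _ => (integrable_prod_subset hF S).const_mul _]
  simp_rw [integral_const_mul, integral_prod_subset hF1, mul_one]
  rw [← Finset.powerset_univ, Finset.sum_powerset_apply_card]
  simpa [nsmul_eq_mul] using hw

end Mixture

/-- The variable `√(1 - t) exp (t (y - μ)² / (2σ²))` with `t = 2γ / (1 + 2γ)`, which has mean one under
`N(μ, σ²)`. -/
def expSq (γ σ μ y : ℝ) : ℝ :=
  Real.sqrt (1 - 2 * γ / (1 + 2 * γ)) *
    Real.exp (2 * γ / (1 + 2 * γ) * (y - μ) ^ 2 / (2 * σ ^ 2))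

theorem one_sub_tilt {γ : ℝ} (hγ : 0 < γ) : 1 - 2 * γ / (1 + 2 * γ) = (1 + 2 * γ)⁻¹ := by
  field_simp; ring

theorem expSq_pos {γ σ μ y : ℝ} (hγ : 0 < γ) : 0 < expSq γ σ μ y := by
  unfold expSq
  rw [one_sub_tilt hγ]
  positivity

theorem log_expSq {γ σ μ y : ℝ} (hγ : 0 < γ) : Real.log (expSq γ σ μ y) =
    2 * γ / (1 + 2 * γ) * (y - μ) ^ 2 / (2 * σ ^ 2) - Real.log (1 + 2 * γ) / 2 := by
  unfold expSq
  rw [one_sub_tilt hγ, Real.log_mul (by positivity) (Real.exp_pos _).ne', Real.log_exp,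
    Real.log_sqrt (by positivity), Real.log_inv]
  ring

theorem integrable_expSq {γ σ : ℝ} (hγ : 0 < γ) (hσ : 0 < σ) (μ : ℝ) :
    Integrable (expSq γ σ μ) (gaussianReal μ (σ ^ 2).toNNReal) :=
  (integrable_exp_sq_gaussianReal hσ ((div_lt_one (by positivity)).2 (by linarith)) μ).const_mul _

theorem integral_expSq {γ σ : ℝ} (hγ : 0 < γ) (hσ : 0 < σ) (μ : ℝ) :
    ∫ y, expSq γ σ μ y ∂gaussianReal μ (σ ^ 2).toNNReal = 1 := by
  unfold expSq
  rw [integral_const_mul, integral_exp_sq_gaussianReal hσ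
    ((div_lt_one (by positivity)).2 (by linarith)), one_sub_tilt hγ]
  exact mul_inv_cancel₀ (by positivity)

/-- Prior weight `ϖ(h) / (n choose h)` of a single nonempty support of size `h`, and `0` for the empty
support. -/
def withinWeight (n : ℕ) (ϖ : ℕ → ℝ) (h : ℕ) : ℝ :=
  if h ∈ Finset.Icc 1 n then ϖ h / n.choose h else 0

/-- Prior weight `ϖ₀(k) / (m choose k)` of a single set of `k` nonzero groups. -/
def betweenWeight (m : ℕ) (ϖ₀ : ℕ → ℝ) (k : ℕ) : ℝ :=
  if k ∈ Finset.range (m + 1) then ϖ₀ k / m.choose k else 0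

theorem withinWeight_nonneg {n : ℕ} {ϖ : ℕ → ℝ} (h : IsPrior (Finset.Icc 1 n) ϖ) (k : ℕ) :
    0 ≤ withinWeight n ϖ k := by
  unfold withinWeight
  split_ifs with hk
  · exact div_nonneg (h.1 k hk).le (by positivity)
  · exact le_rfl

theorem betweenWeight_nonneg {m : ℕ} {ϖ₀ : ℕ → ℝ} (h : IsPrior (Finset.range (m + 1)) ϖ₀) (k : ℕ) :
    0 ≤ betweenWeight m ϖ₀ k := by
  unfold betweenWeight
  split_ifs with hk
  · exact div_nonneg (h.1 k hk).le (by positivity)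
  · exact le_rfl

theorem choose_cast_pos {n k : ℕ} (h : k ≤ n) : (0 : ℝ) < n.choose k := by
  exact_mod_cast Nat.choose_pos h

theorem sum_withinWeight {n : ℕ} {ϖ : ℕ → ℝ} (h : IsPrior (Finset.Icc 1 n) ϖ) :
    ∑ k ∈ Finset.range (n + 1), (n.choose k : ℝ) * withinWeight n ϖ k = 1 := by
  rw [← h.2]
  symm
  refine Finset.sum_subset_zero_on_sdiff (fun k hk => ?_) (fun k hk => ?_) fun k hk => ?_
  · simp at hk ⊢; omega
  · rw [Finset.mem_sdiff] at hk
    rw [withinWeight, if_neg hk.2, mul_zero]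
  · have := choose_cast_pos (Finset.mem_Icc.1 hk).2
    rw [withinWeight, if_pos hk]
    field_simp

theorem sum_betweenWeight {m : ℕ} {ϖ₀ : ℕ → ℝ} (h : IsPrior (Finset.range (m + 1)) ϖ₀) :
    ∑ k ∈ Finset.range (m + 1), (m.choose k : ℝ) * betweenWeight m ϖ₀ k = 1 := by
  rw [← h.2]
  refine Finset.sum_congr rfl fun k hk => ?_
  have := choose_cast_pos (Nat.lt_succ_iff.1 (Finset.mem_range.1 hk))
  rw [betweenWeight, if_pos hk]
  field_simp

/-- The mixture of the variables `expSq` over all group supports, weighted by the prior: first over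
the supports within each nonzero group, then over the sets of nonzero groups. -/
def evidence (m n : ℕ) (γ σ : ℝ) (ϖ₀ : ℕ → ℝ) (ϖ : Fin m → ℕ → ℝ) (μ y : Fin m → Fin n → ℝ) : ℝ :=
  sparseMixture (betweenWeight m ϖ₀)
    (fun j => sparseMixture (withinWeight n (ϖ j)) fun i => expSq γ σ (μ j i)) y

/-- The total penalty of `ν`. -/
def totalPen (m n : ℕ) (γ σ : ℝ) (ϖ₀ : ℕ → ℝ) (ϖ : Fin m → ℕ → ℝ) (ν : Fin m → Fin n → ℝ) : ℝ :=
  ∑ j, penWithin n γ σ (ϖ j) (l0norm (ν j))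
    + penBetween m γ σ ϖ₀ (Finset.univ.filter fun j => l0norm (ν j) ≠ 0).card

section Evidence

variable {m n : ℕ} {γ σ : ℝ} {ϖ₀ : ℕ → ℝ} {ϖ : Fin m → ℕ → ℝ}

theorem integrable_evidence (hγ : 0 < γ) (hσ : 0 < σ) (μ : Fin m → Fin n → ℝ) :
    Integrable (evidence m n γ σ ϖ₀ ϖ μ) (groupLaw m n σ μ) :=
  integrable_sparseMixture (P := fun j => vectorLaw n σ (μ j)) fun j =>
    integrable_sparseMixture (P := fun i => gaussianReal (μ j i) (σ ^ 2).toNNReal) fun i =>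
      integrable_expSq hγ hσ (μ j i)

theorem integral_evidence (hγ : 0 < γ) (hσ : 0 < σ)
    (h0 : IsPrior (Finset.range (m + 1)) ϖ₀) (h : ∀ j, IsPrior (Finset.Icc 1 n) (ϖ j))
    (μ : Fin m → Fin n → ℝ) : ∫ y, evidence m n γ σ ϖ₀ ϖ μ y ∂groupLaw m n σ μ = 1 :=
  integral_sparseMixture (P := fun j => vectorLaw n σ (μ j))
    (fun j => integrable_sparseMixture (P := fun i => gaussianReal (μ j i) (σ ^ 2).toNNReal)
      fun i => integrable_expSq hγ hσ (μ j i))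
    (fun j => integral_sparseMixture (P := fun i => gaussianReal (μ j i) (σ ^ 2).toNNReal)
      (fun i => integrable_expSq hγ hσ (μ j i)) (fun i => integral_expSq hγ hσ (μ j i))
      (by simpa using sum_withinWeight (h j)))
    (by simpa using sum_betweenWeight h0)

theorem evidence_nonneg (hγ : 0 < γ) (h0 : IsPrior (Finset.range (m + 1)) ϖ₀)
    (h : ∀ j, IsPrior (Finset.Icc 1 n) (ϖ j)) (μ y : Fin m → Fin n → ℝ) :
    0 ≤ evidence m n γ σ ϖ₀ ϖ μ y :=
  sparseMixture_nonneg (betweenWeight_nonneg h0) (fun j _ =>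
    sparseMixture_nonneg (withinWeight_nonneg (h j)) (fun _ _ => (expSq_pos hγ).le) _) _

theorem penWithin_eq {h : ℕ} {q : ℕ → ℝ} (hγ : 0 < γ) (hq : IsPrior (Finset.Icc 1 n) q)
    (hh : h ∈ Finset.Icc 1 n) :
    penWithin n γ σ q h = 2 * σ ^ 2 * (1 + 1 / γ) *
      (-Real.log (withinWeight n q h) + h / 2 * Real.log (1 + γ)) := by
  have h1 := Finset.mem_Icc.1 hh
  have hq0 := hq.1 h hh
  have hc := choose_cast_pos h1.2
  rw [penWithin, if_neg (by omega), withinWeight, if_pos hh,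
    Real.log_mul (by positivity) (by positivity), Real.log_mul (by positivity) (by positivity),
    Real.log_inv, Real.log_div hq0.ne' hc.ne', Real.log_rpow (by positivity)]
  ring

theorem penBetween_eq {k : ℕ} (h0 : IsPrior (Finset.range (m + 1)) ϖ₀)
    (hk : k ∈ Finset.range (m + 1)) :
    penBetween m γ σ ϖ₀ k = 2 * σ ^ 2 * (1 + 1 / γ) * -Real.log (betweenWeight m ϖ₀ k) := by
  have hc := choose_cast_pos (Nat.lt_succ_iff.1 (Finset.mem_range.1 hk))
  have hq0 := h0.1 k hk
  rw [penBetween, betweenWeight, if_pos hk, Real.log_mul (by positivity) (by positivity),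
    Real.log_inv, Real.log_div hq0.ne' hc.ne']
  ring

theorem cGamma_mul_le_neg_log {c₁ c₂ : ℝ} {q : ℕ → ℝ} {h : ℕ} (hq : IsPrior (Finset.Icc 1 n) q)
    (hc : WithinPriorCondition n γ c₁ c₂ q) (hh : h ∈ Finset.Icc 1 n) :
    cGamma γ * h ≤ -Real.log (withinWeight n q h) := by
  have h1 := Finset.mem_Icc.1 hh
  have hq0 := hq.1 h hh
  have hch := choose_cast_pos h1.2
  have := hc.1 h h1.1 h1.2
  rw [withinWeight, if_pos hh, le_neg, Real.log_le_iff_le_exp (by positivity), div_le_iff₀ hch]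
  linarith

theorem neg_log_betweenWeight_nonneg {k : ℕ} (h0 : IsPrior (Finset.range (m + 1)) ϖ₀)
    (hk : k ∈ Finset.range (m + 1)) : 0 ≤ -Real.log (betweenWeight m ϖ₀ k) := by
  have hq0 := h0.1 k hk
  have hle : ϖ₀ k ≤ 1 := h0.2 ▸ Finset.single_le_sum (fun i hi => (h0.1 i hi).le) hk
  have hc : (1 : ℝ) ≤ m.choose k := by
    exact_mod_cast Nat.choose_pos (Nat.lt_succ_iff.1 (Finset.mem_range.1 hk))
  rw [betweenWeight, if_pos hk, neg_nonneg]
  exact Real.log_nonpos (div_nonneg hq0.le (by linarith)) ((div_le_one (by linarith)).2 (by linarith))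

/-- The penalty with parameter `2γ` is at most `(4γ + 3) / (4γ + 4)` times the penalty with parameter
`γ`, because `log (1 / π)` is at least `c(γ) h`; the common factor `2σ²` and the factor `1 + 1/γ` are
multiplied out. -/
theorem tilted_penalty_le {γ ℓ h : ℝ} (hγ : 0 < γ) (hh : 0 ≤ h) (hℓ : cGamma γ * h ≤ ℓ) :
    (1 + 1 / (2 * γ)) * (ℓ + h / 2 * Real.log (1 + 2 * γ)) ≤
      (1 + 3 / (4 * γ)) * (ℓ + h / 2 * Real.log (1 + γ)) := by
  have hlog : Real.log (1 + 2 * γ) ≤ Real.log (1 + γ) + γ / (1 + γ) := by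
    have h1 := Real.log_le_sub_one_of_pos (by positivity : 0 < (1 + 2 * γ) / (1 + γ))
    rw [Real.log_div (by positivity) (by positivity)] at h1
    have : (1 + 2 * γ) / (1 + γ) - 1 = γ / (1 + γ) := by field_simp; ring
    linarith
  have hl0 : 0 ≤ Real.log (1 + γ) := Real.log_nonneg (by linarith)
  have h1 : (1 + 1 / (2 * γ)) * (γ / (1 + γ)) ≤ 1 := by
    have : (1 + 1 / (2 * γ)) * (γ / (1 + γ)) = (2 * γ + 1) / (2 * (1 + γ)) := by field_simp
    rw [this, div_le_one (by positivity)]; linarith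
  have h2 : 24 * γ * h ≤ ℓ := by
    refine le_trans (mul_le_mul_of_nonneg_right ?_ hh) hℓ
    unfold cGamma; nlinarith [sq_nonneg (γ - 3 / 4)]
  have h3 : 6 * h ≤ 1 / (4 * γ) * ℓ := by
    rw [div_mul_eq_mul_div, le_div_iff₀ (by positivity)]; linarith
  have e1 : (1 + 1 / (2 * γ)) * (ℓ + h / 2 * Real.log (1 + 2 * γ)) ≤
      (1 + 1 / (2 * γ)) * (ℓ + h / 2 * (Real.log (1 + γ) + γ / (1 + γ))) := by gcongr
  have e2 : (1 + 1 / (2 * γ)) * (ℓ + h / 2 * (Real.log (1 + γ) + γ / (1 + γ)))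
      = (1 + 1 / (2 * γ)) * (ℓ + h / 2 * Real.log (1 + γ))
        + h / 2 * ((1 + 1 / (2 * γ)) * (γ / (1 + γ))) := by ring
  have e3 : (1 + 3 / (4 * γ)) * (ℓ + h / 2 * Real.log (1 + γ))
      = (1 + 1 / (2 * γ)) * (ℓ + h / 2 * Real.log (1 + γ)) + 1 / (4 * γ) * ℓ
        + 1 / (4 * γ) * (h / 2 * Real.log (1 + γ)) := by field_simp; ring
  have e4 : h / 2 * ((1 + 1 / (2 * γ)) * (γ / (1 + γ))) ≤ h / 2 * 1 := by gcongr
  have e5 : 0 ≤ 1 / (4 * γ) * (h / 2 * Real.log (1 + γ)) := by positivity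
  linarith

/-- Noise on the support of an arbitrary `ν`, which may depend on the data: it is bounded by a fixed
fraction of the penalty and the mixture `evidence`, as each support contributes one term to the
mixture and `log Z ≤ Z`. -/
theorem sum_sq_support_le (hγ : 0 < γ) (hσ : 0 < σ) {c₁ c₂ : ℝ}
    (h0 : IsPrior (Finset.range (m + 1)) ϖ₀) (h : ∀ j, IsPrior (Finset.Icc 1 n) (ϖ j))
    (hc : ∀ j, WithinPriorCondition n γ c₁ c₂ (ϖ j)) (μ y ν : Fin m → Fin n → ℝ) :
    ∑ j, ∑ i, (if ν j i ≠ 0 then (y j i - μ j i) ^ 2 else 0) ≤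
      (4 * γ + 3) / (4 * γ + 4) * totalPen m n γ σ ϖ₀ ϖ ν +
        2 * σ ^ 2 * (1 + 1 / (2 * γ)) * evidence m n γ σ ϖ₀ ϖ μ y := by
  classical
  set X : Fin m → ℝ := fun j =>
    sparseMixture (withinWeight n (ϖ j)) (fun i => expSq γ σ (μ j i)) (y j) with hX
  set J : Finset (Fin m) := Finset.univ.filter fun j => l0norm (ν j) ≠ 0 with hJ
  set ℓ : Fin m → ℝ := fun j => -Real.log (withinWeight n (ϖ j) (l0norm (ν j))) with hℓ
  have hmem : ∀ j ∈ J, l0norm (ν j) ∈ Finset.Icc 1 n := fun j hj => by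
    have h1 : l0norm (ν j) ≠ 0 := (Finset.mem_filter.1 hj).2
    have h2 : l0norm (ν j) ≤ n := by
      unfold l0norm; exact (Finset.card_le_univ _).trans (by simp)
    rw [Finset.mem_Icc]; omega
  have hkm : J.card ∈ Finset.range (m + 1) := by
    rw [Finset.mem_range, Nat.lt_succ_iff]; exact (Finset.card_le_univ _).trans (by simp)
  have hwpos : ∀ j ∈ J, 0 < withinWeight n (ϖ j) (l0norm (ν j)) := fun j hj => by
    rw [withinWeight, if_pos (hmem j hj)]
    exact div_pos ((h j).1 _ (hmem j hj)) (choose_cast_pos (Finset.mem_Icc.1 (hmem j hj)).2)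
  have hgpos : 0 < betweenWeight m ϖ₀ J.card := by
    rw [betweenWeight, if_pos hkm]
    exact div_pos (h0.1 _ hkm) (choose_cast_pos (Nat.lt_succ_iff.1 (Finset.mem_range.1 hkm)))
  have hXj : ∀ j ∈ J, 0 < X j ∧ 1 / (2 * σ ^ 2) * (2 * γ / (1 + 2 * γ)) *
      (∑ i, (if ν j i ≠ 0 then (y j i - μ j i) ^ 2 else 0)) ≤
      Real.log (X j) + (ℓ j + l0norm (ν j) / 2 * Real.log (1 + 2 * γ)) := by
    intro j hj
    have hle := le_sparseMixture (withinWeight_nonneg (h j))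
      (F := fun i => expSq γ σ (μ j i)) (fun _ _ => (expSq_pos hγ).le) (y j)
      (Finset.univ.filter fun i => ν j i ≠ 0)
    have hprod : 0 < ∏ i with ν j i ≠ 0, expSq γ σ (μ j i) (y j i) :=
      Finset.prod_pos fun _ _ => expSq_pos hγ
    have hw := hwpos j hj
    have hpos : 0 < withinWeight n (ϖ j) (l0norm (ν j)) *
        ∏ i with ν j i ≠ 0, expSq γ σ (μ j i) (y j i) := mul_pos hw hprod
    refine ⟨hpos.trans_le hle, ?_⟩
    have hlog := Real.log_le_log hpos hle
    rw [Real.log_mul hw.ne' hprod.ne', Real.log_prod fun _ _ => (expSq_pos hγ).ne'] at hlog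
    simp_rw [log_expSq hγ] at hlog
    rw [Finset.sum_sub_distrib, Finset.sum_const, nsmul_eq_mul] at hlog
    have e : ∑ i with ν j i ≠ 0, 2 * γ / (1 + 2 * γ) * (y j i - μ j i) ^ 2 / (2 * σ ^ 2)
        = 1 / (2 * σ ^ 2) * (2 * γ / (1 + 2 * γ)) *
          ∑ i, (if ν j i ≠ 0 then (y j i - μ j i) ^ 2 else 0) := by
      rw [← Finset.sum_filter, Finset.mul_sum]
      exact Finset.sum_congr rfl fun i _ => by ring
    rw [e] at hlog
    have e2 : ((Finset.univ.filter fun i => ν j i ≠ 0).card : ℝ) = l0norm (ν j) := rfl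
    rw [e2] at hlog
    simp only [hℓ]
    have e3 : Real.log (X j) = Real.log (sparseMixture (withinWeight n (ϖ j))
      (fun i => expSq γ σ (μ j i)) (y j)) := rfl
    rw [e3]
    linarith
  have hZ : 0 < evidence m n γ σ ϖ₀ ϖ μ y ∧ ∑ j ∈ J, Real.log (X j) ≤
      Real.log (evidence m n γ σ ϖ₀ ϖ μ y) + -Real.log (betweenWeight m ϖ₀ J.card) := by
    have hle := le_sparseMixture (betweenWeight_nonneg h0)
      (F := fun j => sparseMixture (withinWeight n (ϖ j)) fun i => expSq γ σ (μ j i))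
      (fun j _ => sparseMixture_nonneg (withinWeight_nonneg (h j))
        (fun _ _ => (expSq_pos hγ).le) _) y J
    have hprod : 0 < ∏ j ∈ J, X j := Finset.prod_pos fun j hj => (hXj j hj).1
    have hpos := mul_pos hgpos hprod
    refine ⟨hpos.trans_le hle, ?_⟩
    have hlog := Real.log_le_log hpos hle
    rw [Real.log_mul hgpos.ne' hprod.ne', Real.log_prod fun j hj => (hXj j hj).1.ne'] at hlog
    have e3 : Real.log (evidence m n γ σ ϖ₀ ϖ μ y) = Real.log (sparseMixture (betweenWeight m ϖ₀)
      (fun j => sparseMixture (withinWeight n (ϖ j)) fun i => expSq γ σ (μ j i)) y) := rfl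
    rw [e3]
    linarith
  set Z := evidence m n γ σ ϖ₀ ϖ μ y with hZdef
  have hlogZ : Real.log Z ≤ Z := (Real.log_le_sub_one_of_pos hZ.1).trans (by linarith)
  have hrest : ∀ j, j ∉ J → ∀ i, ν j i = 0 := by
    intro j hj i
    have : l0norm (ν j) = 0 := by
      by_contra h1; exact hj (Finset.mem_filter.2 ⟨Finset.mem_univ _, h1⟩)
    rw [l0norm, Finset.card_eq_zero, Finset.filter_eq_empty_iff] at this
    simpa using this (Finset.mem_univ i)
  have hsum : ∑ j, ∑ i, (if ν j i ≠ 0 then (y j i - μ j i) ^ 2 else 0)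
      = ∑ j ∈ J, ∑ i, (if ν j i ≠ 0 then (y j i - μ j i) ^ 2 else 0) := by
    symm
    refine Finset.sum_subset (Finset.subset_univ _) fun j _ hj => ?_
    exact Finset.sum_eq_zero fun i _ => by simp [hrest j hj i]
  have hpen : ∑ j, penWithin n γ σ (ϖ j) (l0norm (ν j)) = ∑ j ∈ J, 2 * σ ^ 2 * (1 + 1 / γ) *
      (ℓ j + l0norm (ν j) / 2 * Real.log (1 + γ)) := by
    have : ∑ j, penWithin n γ σ (ϖ j) (l0norm (ν j))
        = ∑ j ∈ J, penWithin n γ σ (ϖ j) (l0norm (ν j)) := by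
      symm
      refine Finset.sum_subset (Finset.subset_univ _) fun j _ hj => ?_
      have : l0norm (ν j) = 0 := by simp [l0norm, hrest j hj]
      simp [penWithin, this]
    rw [this]
    exact Finset.sum_congr rfl fun j hj => penWithin_eq hγ (h j) (hmem j hj)
  have ht : 1 + 1 / (2 * γ) = (1 + 2 * γ) / (2 * γ) := by field_simp; ring
  have hA : ∑ j ∈ J, ∑ i, (if ν j i ≠ 0 then (y j i - μ j i) ^ 2 else 0) ≤
      2 * σ ^ 2 * (1 + 1 / (2 * γ)) * (∑ j ∈ J, (Real.log (X j) +
        (ℓ j + l0norm (ν j) / 2 * Real.log (1 + 2 * γ)))) := by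
    have := Finset.sum_le_sum fun j hj => (hXj j hj).2
    rw [← Finset.mul_sum] at this
    have h2 := mul_le_mul_of_nonneg_left this
      (by positivity : 0 ≤ 2 * σ ^ 2 * (1 + 1 / (2 * γ)))
    refine le_trans (le_of_eq ?_) h2
    rw [ht]
    field_simp
  have hB : ∑ j ∈ J, (1 + 1 / (2 * γ)) * (ℓ j + l0norm (ν j) / 2 * Real.log (1 + 2 * γ)) ≤
      ∑ j ∈ J, (1 + 3 / (4 * γ)) * (ℓ j + l0norm (ν j) / 2 * Real.log (1 + γ)) :=
    Finset.sum_le_sum fun j hj => tilted_penalty_le hγ (Nat.cast_nonneg _)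
      (cGamma_mul_le_neg_log (h j) (hc j) (hmem j hj))
  have hg := neg_log_betweenWeight_nonneg h0 hkm
  have hconst : (4 * γ + 3) / (4 * γ + 4) * (1 + 1 / γ) = 1 + 3 / (4 * γ) := by
    field_simp
  have hC : (1 + 1 / (2 * γ)) * -Real.log (betweenWeight m ϖ₀ J.card) ≤
      (1 + 3 / (4 * γ)) * -Real.log (betweenWeight m ϖ₀ J.card) := by
    refine mul_le_mul_of_nonneg_right ?_ hg
    have : 1 / (2 * γ) = 2 / (4 * γ) := by field_simp; norm_num
    rw [this]
    gcongr
    norm_num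
  rw [hsum]
  refine hA.trans ?_
  rw [Finset.sum_add_distrib]
  rw [← Finset.mul_sum, ← Finset.mul_sum] at hB
  have e1 : totalPen m n γ σ ϖ₀ ϖ ν = 2 * σ ^ 2 * (1 + 1 / γ) *
      (∑ j ∈ J, (ℓ j + l0norm (ν j) / 2 * Real.log (1 + γ))
        + -Real.log (betweenWeight m ϖ₀ J.card)) := by
    rw [totalPen, hpen, ← Finset.mul_sum, penBetween_eq h0 hkm]; ring
  have e2 : (4 * γ + 3) / (4 * γ + 4) * totalPen m n γ σ ϖ₀ ϖ ν = 2 * σ ^ 2 *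
      ((1 + 3 / (4 * γ)) * ∑ j ∈ J, (ℓ j + l0norm (ν j) / 2 * Real.log (1 + γ))
        + (1 + 3 / (4 * γ)) * -Real.log (betweenWeight m ϖ₀ J.card)) := by
    rw [e1, ← hconst]; ring
  rw [e2]
  have hD : (1 + 1 / (2 * γ)) * ∑ j ∈ J, Real.log (X j) ≤
      (1 + 1 / (2 * γ)) * (Z + -Real.log (betweenWeight m ϖ₀ J.card)) :=
    mul_le_mul_of_nonneg_left (by linarith [hZ.2]) (by positivity)
  have hE := mul_le_mul_of_nonneg_left (add_le_add (add_le_add hD hB) hC)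
    (by positivity : 0 ≤ 2 * σ ^ 2)
  linarith

end Evidence

/-! ### The oracle inequality for the sparse group MAP estimator -/

/-- The basic inequality for one coordinate: the cross term `2 (y - μ) (d - v)` vanishes unless the
coordinate lies in one of the two supports, and is otherwise split by Young's inequality. -/
theorem coordinate_oracle {a y μ d v : ℝ} (ha0 : 0 < a) (ha1 : a < 1) :
    (1 - a) / 2 * (d - μ) ^ 2 ≤ (y - d) ^ 2 - (y - v) ^ 2
      + (1 + a * (1 + a) / (1 - a)) * (μ - v) ^ 2
      + 1 / a * (if d ≠ 0 then (y - μ) ^ 2 else 0) + 1 / a * (if v ≠ 0 then (y - μ) ^ 2 else 0) := by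
  have h1a : 0 < 1 - a := by linarith
  have hN : 2 * (y - μ) * (d - v) ≤ a * (d - v) ^ 2
      + 1 / a * (if d ≠ 0 then (y - μ) ^ 2 else 0)
      + 1 / a * (if v ≠ 0 then (y - μ) ^ 2 else 0) := by
    by_cases h : d = 0 ∧ v = 0
    · simp [h.1, h.2]
    · have h1 : (y - μ) ^ 2 ≤ (if d ≠ 0 then (y - μ) ^ 2 else 0)
          + (if v ≠ 0 then (y - μ) ^ 2 else 0) := by
        have := sq_nonneg (y - μ)
        by_cases hd : d = 0
        · have hv : v ≠ 0 := fun hv => h ⟨hd, hv⟩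
          simp [hd, hv]
        · by_cases hv : v = 0
          · simp [hd, hv]
          · simp [hd, hv]; linarith
      have h2 : 2 * (y - μ) * (d - v) ≤ a * (d - v) ^ 2 + 1 / a * (y - μ) ^ 2 := by
        have : a * (d - v) ^ 2 + 1 / a * (y - μ) ^ 2 - 2 * (y - μ) * (d - v)
            = 1 / a * (a * (d - v) - (y - μ)) ^ 2 := by field_simp; ring
        have h3 : 0 ≤ 1 / a * (a * (d - v) - (y - μ)) ^ 2 := by positivity
        linarith
      have h3 := mul_le_mul_of_nonneg_left h1 (by positivity : 0 ≤ 1 / a)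
      linarith
  have hY : a * (d - v) ^ 2 ≤ (1 + a) / 2 * (d - μ) ^ 2 + a * (1 + a) / (1 - a) * (μ - v) ^ 2 := by
    have : (1 + a) / 2 * (d - μ) ^ 2 + a * (1 + a) / (1 - a) * (μ - v) ^ 2 - a * (d - v) ^ 2
        = 1 / (2 * (1 - a)) * ((1 - a) * (d - μ) - 2 * a * (μ - v)) ^ 2 := by
      field_simp; ring
    have h3 : 0 ≤ 1 / (2 * (1 - a)) * ((1 - a) * (d - μ) - 2 * a * (μ - v)) ^ 2 := by positivity
    linarith
  nlinarith

section Oracle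

variable {m n : ℕ} {γ σ : ℝ} {ϖ₀ : ℕ → ℝ} {ϖ : Fin m → ℕ → ℝ}

theorem criterion_eq (y ν : Fin m → Fin n → ℝ) : criterion m n γ σ ϖ₀ ϖ y ν
    = ∑ j, ∑ i, (y j i - ν j i) ^ 2 + totalPen m n γ σ ϖ₀ ϖ ν := by
  rw [criterion, totalPen, Finset.sum_add_distrib, add_assoc]

theorem integrable_sq_coordinate (μ : Fin m → Fin n → ℝ) (j : Fin m) (i : Fin n) :
    Integrable (fun y : Fin m → Fin n → ℝ => (y j i - μ j i) ^ 2) (groupLaw m n σ μ) :=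
  (measurePreserving_eval (fun j => vectorLaw n σ (μ j)) j).integrable_comp_of_integrable
    ((measurePreserving_eval (fun i => gaussianReal (μ j i) (σ ^ 2).toNNReal) i
      ).integrable_comp_of_integrable (integrable_sq_sub_gaussianReal (μ j i)))

theorem integral_sq_coordinate (μ : Fin m → Fin n → ℝ) (j : Fin m) (i : Fin n) :
    ∫ y : Fin m → Fin n → ℝ, (y j i - μ j i) ^ 2 ∂groupLaw m n σ μ = σ ^ 2 := by
  have h1 : Integrable (fun x : ℝ => (x - μ j i) ^ 2)
      (gaussianReal (μ j i) (σ ^ 2).toNNReal) := integrable_sq_sub_gaussianReal (μ j i)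
  have e1 := measurePreserving_eval (fun j => vectorLaw n σ (μ j)) j
  have e2 := measurePreserving_eval (fun i => gaussianReal (μ j i) (σ ^ 2).toNNReal) i
  have e := e2.comp e1
  rw [← integral_sq_sub_gaussianReal (σ := σ) (μ j i), ← e.map_eq, integral_map]
  · rfl
  · exact e.measurable.aemeasurable
  · exact (by fun_prop : Continuous fun x : ℝ => (x - μ j i) ^ 2).aestronglyMeasurable

theorem groupRisk_eq {δ : (Fin m → Fin n → ℝ) → Fin m → Fin n → ℝ} (hδ : Measurable δ)
    (μ : Fin m → Fin n → ℝ) :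
    groupRisk m n σ δ μ =
      ∫⁻ y, ENNReal.ofReal (∑ j, ∑ i, (δ y j i - μ j i) ^ 2) ∂groupLaw m n σ μ := by
  rw [groupRisk, ← lintegral_finsetSum _ fun j _ => ?_]
  · refine lintegral_congr fun y => ?_
    exact (ENNReal.ofReal_sum_of_nonneg fun j _ => Finset.sum_nonneg fun i _ => sq_nonneg _).symm
  · have : ∀ i, Measurable fun y => δ y j i := fun i => by fun_prop
    exact (Finset.measurable_fun_sum _ fun i _ => by
      have := this i; fun_prop).ennreal_ofReal

theorem totalPen_nonneg (hγ : 0 < γ) {c₁ c₂ : ℝ}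
    (h0 : IsPrior (Finset.range (m + 1)) ϖ₀) (h : ∀ j, IsPrior (Finset.Icc 1 n) (ϖ j))
    (hc : ∀ j, WithinPriorCondition n γ c₁ c₂ (ϖ j)) (ν : Fin m → Fin n → ℝ) :
    0 ≤ totalPen m n γ σ ϖ₀ ϖ ν := by
  refine add_nonneg (Finset.sum_nonneg fun j _ => ?_) ?_
  · by_cases h1 : l0norm (ν j) = 0
    · simp [penWithin, h1]
    · have h2 : l0norm (ν j) ≤ n := by
        unfold l0norm; exact (Finset.card_le_univ _).trans (by simp)
      have hmem : l0norm (ν j) ∈ Finset.Icc 1 n := by rw [Finset.mem_Icc]; omega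
      have h3 := cGamma_mul_le_neg_log (h j) (hc j) hmem
      have h4 : 0 ≤ cGamma γ * l0norm (ν j) := by unfold cGamma; positivity
      have h5 : 0 ≤ Real.log (1 + γ) := Real.log_nonneg (by linarith)
      rw [penWithin_eq hγ (h j) hmem]
      have : 0 ≤ -Real.log (withinWeight n (ϖ j) (l0norm (ν j))) := h4.trans h3
      positivity
  · have hkm : (Finset.univ.filter fun j => l0norm (ν j) ≠ 0).card ∈ Finset.range (m + 1) := by
      rw [Finset.mem_range, Nat.lt_succ_iff]; exact (Finset.card_le_univ _).trans (by simp)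
    rw [penBetween_eq h0 hkm]
    have := neg_log_betweenWeight_nonneg h0 hkm
    positivity

theorem pathwise_oracle (hγ : 0 < γ) (hσ : 0 < σ) {c₁ c₂ : ℝ}
    (h0 : IsPrior (Finset.range (m + 1)) ϖ₀) (h : ∀ j, IsPrior (Finset.Icc 1 n) (ϖ j))
    (hc : ∀ j, WithinPriorCondition n γ c₁ c₂ (ϖ j)) {μ y d ν : Fin m → Fin n → ℝ}
    (hd : criterion m n γ σ ϖ₀ ϖ y d ≤ criterion m n γ σ ϖ₀ ϖ y ν) {a : ℝ}
    (ha : a = (4 * γ + 3) / (4 * γ + 4)) :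
    (1 - a) / 2 * ∑ j, ∑ i, (d j i - μ j i) ^ 2 ≤
      (1 + a * (1 + a) / (1 - a)) * ∑ j, ∑ i, (μ j i - ν j i) ^ 2 + totalPen m n γ σ ϖ₀ ϖ ν
      + 1 / a * ∑ j, ∑ i, (if ν j i ≠ 0 then (y j i - μ j i) ^ 2 else 0)
      + 1 / a * (2 * σ ^ 2 * (1 + 1 / (2 * γ))) * evidence m n γ σ ϖ₀ ϖ μ y := by
  have ha0 : 0 < a := by rw [ha]; positivity
  have ha1 : a < 1 := by rw [ha, div_lt_one (by positivity)]; linarith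
  have h1 : ∑ j, ∑ i, (1 - a) / 2 * (d j i - μ j i) ^ 2 ≤ ∑ j, ∑ i,
      ((y j i - d j i) ^ 2 - (y j i - ν j i) ^ 2
        + (1 + a * (1 + a) / (1 - a)) * (μ j i - ν j i) ^ 2
        + 1 / a * (if d j i ≠ 0 then (y j i - μ j i) ^ 2 else 0)
        + 1 / a * (if ν j i ≠ 0 then (y j i - μ j i) ^ 2 else 0)) :=
    Finset.sum_le_sum fun j _ => Finset.sum_le_sum fun i _ => coordinate_oracle ha0 ha1
  simp only [Finset.sum_add_distrib, Finset.sum_sub_distrib, ← Finset.mul_sum] at h1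
  rw [criterion_eq, criterion_eq] at hd
  have h2 := sum_sq_support_le hγ hσ h0 h hc μ y d
  rw [← ha] at h2
  have h3 := mul_le_mul_of_nonneg_left h2 (by positivity : 0 ≤ 1 / a)
  have h4 : 1 / a * (a * totalPen m n γ σ ϖ₀ ϖ d +
        2 * σ ^ 2 * (1 + 1 / (2 * γ)) * evidence m n γ σ ϖ₀ ϖ μ y)
      = totalPen m n γ σ ϖ₀ ϖ d
        + 1 / a * (2 * σ ^ 2 * (1 + 1 / (2 * γ))) * evidence m n γ σ ϖ₀ ϖ μ y := by
    field_simp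
  rw [h4] at h3
  linarith

theorem integrable_support_noise (μ ν : Fin m → Fin n → ℝ) (j : Fin m) (i : Fin n) :
    Integrable (fun y : Fin m → Fin n → ℝ => if ν j i ≠ 0 then (y j i - μ j i) ^ 2 else 0)
      (groupLaw m n σ μ) := by
  by_cases h : ν j i = 0
  · simp [h]
  · simpa [h] using integrable_sq_coordinate μ j i

theorem integral_support_noise (μ ν : Fin m → Fin n → ℝ) :
    ∫ y : Fin m → Fin n → ℝ, ∑ j, ∑ i, (if ν j i ≠ 0 then (y j i - μ j i) ^ 2 else 0)
      ∂groupLaw m n σ μ = σ ^ 2 * ∑ j, (l0norm (ν j) : ℝ) := by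
  rw [integral_finsetSum _ fun j _ => integrable_finsetSum _ fun i _ =>
    integrable_support_noise μ ν j i, Finset.mul_sum]
  refine Finset.sum_congr rfl fun j _ => ?_
  rw [integral_finsetSum _ fun i _ => integrable_support_noise μ ν j i, l0norm,
    Finset.card_filter]
  push_cast
  rw [Finset.mul_sum]
  refine Finset.sum_congr rfl fun i _ => ?_
  by_cases h : ν j i = 0
  · simp [h]
  · simpa [h] using integral_sq_coordinate μ j i

end Oracle

/-- Oracle inequality: up to a constant depending on `γ` only, the risk of the sparse group MAP
estimator is at most the penalized squared distance of `μ` to any fixed `ν`. -/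
theorem groupRisk_le_oracle {γ : ℝ} (hγ : 0 < γ) :
    ∃ K : ℝ, 0 < K ∧ ∀ (m n : ℕ) (σ c₁ c₂ : ℝ) (ϖ₀ : ℕ → ℝ) (ϖ : Fin m → ℕ → ℝ)
      (δ : (Fin m → Fin n → ℝ) → Fin m → Fin n → ℝ), 0 < σ →
      IsPrior (Finset.range (m + 1)) ϖ₀ → (∀ j, IsPrior (Finset.Icc 1 n) (ϖ j)) →
      (∀ j, WithinPriorCondition n γ c₁ c₂ (ϖ j)) → IsSparseGroupMAP m n γ σ ϖ₀ ϖ δ →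
      ∀ μ ν : Fin m → Fin n → ℝ,
        groupRisk m n σ δ μ ≤ ENNReal.ofReal (K * (∑ j, ∑ i, (μ j i - ν j i) ^ 2
          + totalPen m n γ σ ϖ₀ ϖ ν + σ ^ 2 * ∑ j, (l0norm (ν j) : ℝ) + σ ^ 2)) := by
  set a : ℝ := (4 * γ + 3) / (4 * γ + 4) with ha
  have ha0 : 0 < a := by positivity
  have ha1 : a < 1 := by rw [ha, div_lt_one (by positivity)]; linarith
  have h1a : 0 < 1 - a := by linarith
  set C₁ : ℝ := 1 + a * (1 + a) / (1 - a) with hC₁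
  set C₂ : ℝ := 1 / a * (2 * (1 + 1 / (2 * γ))) with hC₂
  have hC₁0 : 0 < C₁ := by positivity
  have hC₂0 : 0 < C₂ := by positivity
  refine ⟨2 / (1 - a) * (C₁ + 1 + 1 / a + C₂), by positivity, ?_⟩
  intro m n σ c₁ c₂ ϖ₀ ϖ δ hσ h0 h hc hδ μ ν
  have hpen := totalPen_nonneg (σ := σ) hγ h0 h hc ν
  set D := ∑ j, ∑ i, (μ j i - ν j i) ^ 2 with hD
  have hD0 : 0 ≤ D := Finset.sum_nonneg fun _ _ => Finset.sum_nonneg fun _ _ => sq_nonneg _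
  set pen := totalPen m n γ σ ϖ₀ ϖ ν with hpendef
  set G : (Fin m → Fin n → ℝ) → ℝ := fun y => 2 / (1 - a) * (C₁ * D + pen
      + 1 / a * ∑ j, ∑ i, (if ν j i ≠ 0 then (y j i - μ j i) ^ 2 else 0)
      + C₂ * σ ^ 2 * evidence m n γ σ ϖ₀ ϖ μ y) with hG
  have hnoise0 : ∀ y : Fin m → Fin n → ℝ,
      0 ≤ ∑ j, ∑ i, (if ν j i ≠ 0 then (y j i - μ j i) ^ 2 else 0) := fun y =>
    Finset.sum_nonneg fun _ _ => Finset.sum_nonneg fun _ _ => by positivity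
  have hG0 : ∀ y, 0 ≤ G y := fun y => by
    have h1 := hnoise0 y
    have h2 := evidence_nonneg (σ := σ) hγ h0 h μ y
    simp only [hG]
    positivity
  have hi1 : Integrable (fun y : Fin m → Fin n → ℝ =>
      1 / a * ∑ j, ∑ i, (if ν j i ≠ 0 then (y j i - μ j i) ^ 2 else 0)) (groupLaw m n σ μ) :=
    (integrable_finsetSum _ fun j _ => integrable_finsetSum _ fun i _ =>
      integrable_support_noise μ ν j i).const_mul _
  have hi0 : Integrable (fun y : Fin m → Fin n → ℝ => C₁ * D + pen +
      1 / a * ∑ j, ∑ i, (if ν j i ≠ 0 then (y j i - μ j i) ^ 2 else 0)) (groupLaw m n σ μ) :=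
    (integrable_const _).add hi1
  have hi2 : Integrable (fun y => C₂ * σ ^ 2 * evidence m n γ σ ϖ₀ ϖ μ y) (groupLaw m n σ μ) :=
    (integrable_evidence hγ hσ μ).const_mul _
  have hGi : Integrable G (groupLaw m n σ μ) :=
    (hi0.add hi2).const_mul _
  have hGint : ∫ y, G y ∂groupLaw m n σ μ = 2 / (1 - a) * (C₁ * D + pen
      + 1 / a * (σ ^ 2 * ∑ j, (l0norm (ν j) : ℝ)) + C₂ * σ ^ 2) := by
    simp only [hG]
    rw [integral_const_mul, integral_add hi0 hi2,
      integral_add (integrable_const _) hi1, integral_const, integral_const_mul,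
      integral_const_mul, integral_support_noise, integral_evidence hγ hσ h0 h]
    simp
  rw [groupRisk_eq hδ.1]
  have hae : ∀ᵐ y ∂groupLaw m n σ μ,
      ∑ j, ∑ i, (δ y j i - μ j i) ^ 2 ≤ G y := by
    filter_upwards [(groupLaw_absolutelyContinuous hσ μ).ae_le hδ.2] with y hy
    have h1 := pathwise_oracle hγ hσ h0 h hc (μ := μ) (hy ν) ha
    have h2 := mul_le_mul_of_nonneg_left h1 (by positivity : 0 ≤ 2 / (1 - a))
    refine le_trans (le_of_eq ?_) (h2.trans (le_of_eq ?_))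
    · field_simp
    · simp only [hG, hC₂]; ring
  calc _ ≤ ∫⁻ y, ENNReal.ofReal (G y) ∂groupLaw m n σ μ :=
        lintegral_mono_ae (hae.mono fun y hy => ENNReal.ofReal_le_ofReal hy)
    _ ≤ _ := by
        refine lintegral_le_of_le hGi hG0 (fun _ => le_rfl) ?_
        rw [hGint, mul_assoc (2 / (1 - a))]
        refine mul_le_mul_of_nonneg_left ?_ (by positivity)
        set d := σ ^ 2 * ∑ j, (l0norm (ν j) : ℝ) with hd
        have hd0 : 0 ≤ d := by positivity
        have hσ2 : 0 ≤ σ ^ 2 := sq_nonneg _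
        have h1a' : 0 < 1 / a := by positivity
        set e := 1 / a
        have e1 : 0 ≤ C₁ * (pen + d + σ ^ 2) := by positivity
        have e2 : 0 ≤ 1 * (D + d + σ ^ 2) := by positivity
        have e3 : 0 ≤ e * (D + pen + σ ^ 2) := by positivity
        have e4 : 0 ≤ C₂ * (D + pen + d) := by positivity
        nlinarith

/-! ### Sparse approximants and the risk bound -/

theorem log_choose_le {n h : ℕ} (h1 : 1 ≤ h) (hn : h ≤ n) :
    Real.log (n.choose h) ≤ h * (1 + Real.log ((n : ℝ) / h)) := by
  have hh0 : (0 : ℝ) < h := by exact_mod_cast h1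
  have hn0 : (0 : ℝ) < n := by exact_mod_cast (by omega : 0 < n)
  have h2 : (n.choose h : ℝ) ≤ ((n : ℝ) / h) ^ h * Real.exp h := by
    calc (n.choose h : ℝ) ≤ (n : ℝ) ^ h / (h.factorial : ℝ) := Nat.choose_le_pow_div h n
      _ = ((n : ℝ) / h) ^ h * ((h : ℝ) ^ h / h.factorial) := by
          rw [div_pow]; field_simp
      _ ≤ _ := mul_le_mul_of_nonneg_left (Real.pow_div_factorial_le_exp _ hh0.le h) (by positivity)
  refine (Real.log_le_log (choose_cast_pos hn) h2).trans (le_of_eq ?_)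
  rw [Real.log_mul (by positivity) (Real.exp_pos _).ne', Real.log_pow, Real.log_exp]
  ring

/-- The size `h` of a support can be increased to some `h'` whose penalty is of the order
`σ² h (1 + log (n / h))`. The prior is bounded below only at `h ≤ n e^{-c(γ)}`, where `h' = h`, and at
`n`, where `n ≤ e^{c(γ)} h`. -/
theorem exists_penWithin_le {γ c₁ c₂ : ℝ} (hγ : 0 < γ) (hc₁ : 0 < c₁) (hc₂ : 0 < c₂) :
    ∃ C : ℝ, 0 < C ∧ ∀ (n h : ℕ) (σ : ℝ) (q : ℕ → ℝ), IsPrior (Finset.Icc 1 n) q →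
      WithinPriorCondition n γ c₁ c₂ q → 1 ≤ h → h ≤ n →
      ∃ h', h ≤ h' ∧ h' ≤ n ∧ penWithin n γ σ q h' + σ ^ 2 * h' ≤
        C * (σ ^ 2 * (h * (1 + Real.log ((n : ℝ) / h)))) := by
  set c := cGamma γ with hc
  have hc0 : 0 < c := by rw [hc, cGamma]; positivity
  set A : ℝ := 2 * (1 + 1 / γ) * (c₁ + c₂ + 1 + γ) + 1 with hA
  have hA0 : 0 < A := by positivity
  refine ⟨A * Real.exp c, by positivity, fun n h σ q hq hcond h1 hhn => ?_⟩
  have hh0 : (0 : ℝ) < h := by exact_mod_cast h1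
  have hn0 : (0 : ℝ) < n := by exact_mod_cast (by omega : 0 < n)
  have hhn' : (h : ℝ) ≤ n := by exact_mod_cast hhn
  have hlog := log_div_nonneg hh0 hhn'
  have hlγ : Real.log (1 + γ) ≤ 2 * γ := by
    have := Real.log_le_sub_one_of_pos (by positivity : 0 < 1 + γ); linarith
  set l := Real.log ((n : ℝ) / h) with hl
  have pen_le : ∀ k ∈ Finset.Icc 1 n, ∀ b : ℝ, -Real.log (q k) + Real.log (n.choose k) ≤
      (c₁ + c₂ + 1) * b → (k : ℝ) ≤ b →
      penWithin n γ σ q k + σ ^ 2 * k ≤ σ ^ 2 * (A * b) := by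
    intro k hk b hb hkb
    have hk1 := Finset.mem_Icc.1 hk
    have hq0 := hq.1 k hk
    have hch := choose_cast_pos hk1.2
    rw [penWithin_eq hγ hq hk, withinWeight, if_pos hk, Real.log_div hq0.ne' hch.ne']
    have h3 : (k : ℝ) / 2 * Real.log (1 + γ) ≤ b * γ := by
      calc (k : ℝ) / 2 * Real.log (1 + γ) ≤ (k : ℝ) / 2 * (2 * γ) := by gcongr
        _ = k * γ := by ring
        _ ≤ b * γ := by gcongr
    have h4 : 2 * (1 + 1 / γ) * (-(Real.log (q k) - Real.log (n.choose k))
        + (k : ℝ) / 2 * Real.log (1 + γ)) ≤ 2 * (1 + 1 / γ) * ((c₁ + c₂ + 1 + γ) * b) :=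
      mul_le_mul_of_nonneg_left (by linarith) (by positivity)
    have h5 := mul_le_mul_of_nonneg_left (add_le_add h4 hkb) (sq_nonneg σ)
    rw [hA]
    linarith
  by_cases hsmall : h ≤ ⌊(n : ℝ) * Real.exp (-c)⌋₊
  · refine ⟨h, le_rfl, hhn, ?_⟩
    have hmem := Finset.mem_Icc.2 ⟨h1, hhn⟩
    have hb := pen_le h hmem (h * (1 + l)) ?_ (by nlinarith)
    · refine hb.trans ?_
      have he : 1 ≤ Real.exp c := Real.one_le_exp hc0.le
      have h6 : 0 ≤ σ ^ 2 * (A * (h * (1 + l))) := by positivity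
      nlinarith
    · have h2 := hcond.2.1 h h1 hsmall
      have hq0 := hq.1 h hmem
      have h3 := Real.log_le_log (by positivity) h2
      rw [Real.log_rpow (by positivity)] at h3
      have h4 : Real.log ((h : ℝ) / n) = -l := by
        rw [hl, ← Real.log_inv, inv_div]
      rw [h4] at h3
      have h5 := log_choose_le h1 hhn
      have h6 : 0 ≤ c₁ * h := by positivity
      have h7 : 0 ≤ c₂ * (h * (1 + l)) := by positivity
      nlinarith
  · refine ⟨n, hhn, le_rfl, ?_⟩
    have hmem : n ∈ Finset.Icc 1 n := Finset.mem_Icc.2 ⟨by omega, le_rfl⟩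
    have h2 : (n : ℝ) ≤ Real.exp c * h := by
      have := (Nat.lt_of_floor_lt (not_le.1 hsmall)).le
      rw [Real.exp_neg, ← div_eq_mul_inv, div_le_iff₀ (Real.exp_pos _)] at this
      linarith
    have hb := pen_le n hmem (Real.exp c * (h * (1 + l))) ?_ ?_
    · linarith
    · have hq0 := hq.1 n hmem
      have h3 := Real.log_le_log (Real.exp_pos _) hcond.2.2
      rw [Real.log_exp] at h3
      rw [Nat.choose_self]
      simp only [Nat.cast_one, Real.log_one, add_zero]
      have h5 : (n : ℝ) ≤ Real.exp c * (h * (1 + l)) :=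
        h2.trans (mul_le_mul_of_nonneg_left (by nlinarith) (Real.exp_pos _).le)
      have h6 := mul_le_mul_of_nonneg_left h5 hc₂.le
      have h7 : 0 ≤ (c₁ + 1) * (Real.exp c * (h * (1 + l))) := by positivity
      nlinarith
    · exact h2.trans (mul_le_mul_of_nonneg_left (by nlinarith) (Real.exp_pos _).le)

/-- The cutoff `h` is the last index at which `u` exceeds the truncation level, or `1` if there is
none. The energy beyond the cutoff and the cost `σ² h (1 + log (n / h))` are both bounded by the
truncated energy, the latter up to `σ² (1 + log n)` for the case without exceedance. -/
theorem exists_cutoff {n : ℕ} (hn : 1 ≤ n) (σ : ℝ) (u : Fin n → ℝ) (hu : Antitone fun i => |u i|) :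
    ∃ h, 1 ≤ h ∧ h ≤ n ∧ ∑ i : Fin n, (if h ≤ (i : ℕ) then u i ^ 2 else 0) ≤ truncEnergy n σ u ∧
      σ ^ 2 * (h * (1 + Real.log ((n : ℝ) / h))) ≤
        truncEnergy n σ u + σ ^ 2 * (1 + Real.log n) := by
  classical
  set thr : Fin n → ℝ := fun i => σ ^ 2 * (1 + Real.log ((n : ℝ) / ((i : ℕ) + 1 : ℝ))) with hthr
  have hlog1 : 0 ≤ σ ^ 2 * (1 + Real.log n) := by
    have : 0 ≤ Real.log n := Real.log_nonneg (by exact_mod_cast hn)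
    positivity
  have tail : ∀ h : ℕ, (∀ i : Fin n, h ≤ (i : ℕ) → u i ^ 2 ≤ thr i) →
      ∑ i : Fin n, (if h ≤ (i : ℕ) then u i ^ 2 else 0) ≤ truncEnergy n σ u := by
    intro h hh
    refine Finset.sum_le_sum fun i _ => ?_
    split_ifs with hi
    · exact le_min le_rfl (hh i hi)
    · exact trunc_nonneg σ u i
  have hTE : 0 ≤ truncEnergy n σ u := Finset.sum_nonneg fun i _ => trunc_nonneg σ u i
  set H := Finset.univ.filter fun i : Fin n => thr i < u i ^ 2 with hH
  -- Up to the last exceedance `k`, all of `u` is at least the truncation level at `k`.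
  by_cases hne : H.Nonempty
  · set k := H.max' hne with hk
    have hkH : thr k < u k ^ 2 := (Finset.mem_filter.1 (H.max'_mem hne)).2
    refine ⟨(k : ℕ) + 1, by omega, k.2, tail _ fun i hi => ?_, ?_⟩
    · by_contra hlt
      have : i ≤ k := H.le_max' i (Finset.mem_filter.2 ⟨Finset.mem_univ _, not_le.1 hlt⟩)
      have : (i : ℕ) ≤ k := this
      omega
    · refine le_trans ?_ (le_add_of_nonneg_right hlog1)
      calc σ ^ 2 * (((k : ℕ) + 1 : ℕ) * (1 + Real.log ((n : ℝ) / ((k : ℕ) + 1 : ℕ))))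
          = ∑ i ∈ Finset.Iic k, thr k := by
            rw [Finset.sum_const, Fin.card_Iic, nsmul_eq_mul, hthr]; push_cast; ring
        _ ≤ ∑ i ∈ Finset.Iic k, min (u i ^ 2) (thr i) := by
            refine Finset.sum_le_sum fun i hi => le_trans ?_
              (antitone_trunc σ hu (Finset.mem_Iic.1 hi))
            exact le_min hkH.le le_rfl
        _ ≤ _ := Finset.sum_le_sum_of_subset_of_nonneg (Finset.subset_univ _)
            fun i _ _ => trunc_nonneg σ u i
  · refine ⟨1, le_rfl, hn, tail _ fun i _ => ?_, ?_⟩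
    · by_contra hlt
      exact hne ⟨i, Finset.mem_filter.2 ⟨Finset.mem_univ _, not_le.1 hlt⟩⟩
    · simp only [Nat.cast_one, one_mul, div_one]
      linarith

/-- Every vector has a nonzero approximant whose penalized squared distance is bounded by the truncated
energy and `σ² (1 + log n)`. Vanishing entries on the kept support are replaced by `σ / √n`, so that
the support has exactly the size whose penalty is controlled, at a cost of at most `σ²`. -/
theorem exists_approximant {γ c₁ c₂ : ℝ} (hγ : 0 < γ) (hc₁ : 0 < c₁) (hc₂ : 0 < c₂) :
    ∃ C : ℝ, 0 < C ∧ ∀ (n : ℕ) (σ : ℝ) (q : ℕ → ℝ), 1 ≤ n → 0 < σ → IsPrior (Finset.Icc 1 n) q →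
      WithinPriorCondition n γ c₁ c₂ q → ∀ μ : Fin n → ℝ, ∃ ν : Fin n → ℝ, l0norm ν ≠ 0 ∧
        ∑ i, (μ i - ν i) ^ 2 + penWithin n γ σ q (l0norm ν) + σ ^ 2 * l0norm ν ≤
          C * (truncEnergy n σ (absOrdered μ) + σ ^ 2 * (1 + Real.log n)) := by
  obtain ⟨C, hC, hpen⟩ := exists_penWithin_le hγ hc₁ hc₂
  refine ⟨1 + C, by positivity, fun n σ q hn hσ hq hcond μ => ?_⟩
  have hn0 : (0 : ℝ) < n := by exact_mod_cast hn
  have hanti : Antitone fun i => |absOrdered μ i| := fun i j hij => by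
    simp only [abs_of_nonneg (absOrdered_nonneg μ _)]
    exact antitone_absOrdered μ hij
  obtain ⟨h, h1, hhn, htail, hcost⟩ := exists_cutoff hn σ (absOrdered μ) hanti
  obtain ⟨h', hh', hh'n, hp⟩ := hpen n h σ q hq hcond h1 hhn
  set s : Equiv.Perm (Fin n) := Tuple.sort fun k => -|μ k| with hs
  set ν : Fin n → ℝ := fun k => if ((s.symm k : Fin n) : ℕ) < h' then
    (if μ k = 0 then σ / Real.sqrt n else μ k) else 0 with hν
  have hl0 : l0norm ν = h' := by
    have e : (Finset.univ.filter fun k => ν k ≠ 0).card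
        = (Finset.univ.filter fun i : Fin n => (i : ℕ) < h').card := by
      symm
      refine Finset.card_equiv s fun i => ?_
      rw [Finset.mem_filter, Finset.mem_filter]
      simp only [Finset.mem_univ, true_and, hν, Equiv.symm_apply_apply]
      constructor
      · intro hi
        rw [if_pos hi]
        split_ifs with h0
        · positivity
        · exact h0
      · intro hi
        by_contra hlt
        exact hi (if_neg hlt)
    rw [l0norm, e, Fin.card_filter_val_lt, min_eq_right hh'n]
  refine ⟨ν, by omega, ?_⟩
  have herr : ∑ i, (μ i - ν i) ^ 2 ≤ truncEnergy n σ (absOrdered μ) + σ ^ 2 := by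
    rw [← Equiv.sum_comp s]
    have hi : ∀ i, (μ (s i) - ν (s i)) ^ 2 ≤
        (if h ≤ (i : ℕ) then absOrdered μ i ^ 2 else 0) + σ ^ 2 / n := by
      intro i
      have habs : absOrdered μ i ^ 2 = μ (s i) ^ 2 := by
        rw [absOrdered, sq_abs]
      have hσn : 0 ≤ σ ^ 2 / n := by positivity
      simp only [hν, Equiv.symm_apply_apply]
      by_cases hlt : (i : ℕ) < h'
      · rw [if_pos hlt]
        have h0 : 0 ≤ (if h ≤ (i : ℕ) then absOrdered μ i ^ 2 else 0) := by positivity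
        by_cases hz : μ (s i) = 0
        · rw [if_pos hz, hz, zero_sub, neg_sq, div_pow, Real.sq_sqrt hn0.le]
          linarith
        · rw [if_neg hz, sub_self]
          linarith [h0, hσn]
      · rw [if_neg hlt, sub_zero, if_pos (by omega), habs]
        linarith
    refine (Finset.sum_le_sum fun i _ => hi i).trans ?_
    rw [Finset.sum_add_distrib, Finset.sum_const, Finset.card_univ, Fintype.card_fin, nsmul_eq_mul,
      mul_div_cancel₀ _ hn0.ne']
    linarith
  rw [hl0]
  have hlogn : 0 ≤ Real.log n := Real.log_nonneg (by exact_mod_cast hn)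
  have h2 := mul_le_mul_of_nonneg_left hcost hC.le
  nlinarith [sq_nonneg σ]

/-- For `n ≤ 1` there is no prior that satisfies the upper bound `ϖ(h) ≤ (n choose h) e^{-c(γ) h}`. -/
theorem two_le_of_prior {n : ℕ} {γ c₁ c₂ : ℝ} (hγ : 0 < γ) {q : ℕ → ℝ}
    (hq : IsPrior (Finset.Icc 1 n) q) (hcond : WithinPriorCondition n γ c₁ c₂ q) : 2 ≤ n := by
  by_contra hlt
  have hn : n = 0 ∨ n = 1 := by omega
  rcases hn with rfl | rfl
  · simpa using hq.2
  · have h1 := hq.2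
    have h2 := hcond.1 1 le_rfl le_rfl
    simp at h1
    rw [h1] at h2
    have hc : 0 < cGamma γ := by unfold cGamma; positivity
    simp at h2
    linarith

theorem truncEnergy_add_log_le {T : BallType} {n : ℕ} {σ η : ℝ} (hn : 2 ≤ n) (hσ : 0 < σ)
    (hT : T.NotSuperSparse n η) {μ : Fin n → ℝ} (hμ : μ ∈ T.ball n σ η) :
    truncEnergy n σ (absOrdered μ) + σ ^ 2 * (1 + Real.log n) ≤
      768 * (minimaxRisk n σ (T.ball n σ η)).toReal := by
  have htop : minimaxRisk n σ (T.ball n σ η) ≠ ⊤ :=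
    ((minimaxRisk_le_denseRate _).trans_lt ENNReal.ofReal_lt_top).ne
  have hanti : Antitone fun i => |absOrdered μ i| := fun i j hij => by
    simp only [abs_of_nonneg (absOrdered_nonneg μ _)]
    exact antitone_absOrdered μ hij
  have hsolid := BallType.isSolid_ball (σ := σ) hT
  have h1 := (ENNReal.ofReal_le_iff_le_toReal htop).1
    (hsolid.truncEnergy_le_minimaxRisk hn hσ (hsolid.absOrdered_mem hμ) hanti)
  have h2 := (ENNReal.ofReal_le_iff_le_toReal htop).1 (one_add_log_le_minimaxRisk hn hσ hT)
  linarith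

theorem truncEnergy_absOrdered_zero {n : ℕ} (σ : ℝ) :
    truncEnergy n σ (absOrdered (0 : Fin n → ℝ)) = 0 := by
  refine Finset.sum_eq_zero fun i _ => ?_
  have h0 : absOrdered (0 : Fin n → ℝ) i = 0 := by simp [absOrdered]
  have h := trunc_nonneg σ (absOrdered (0 : Fin n → ℝ)) i
  rw [h0] at h ⊢
  exact le_antisymm ((min_le_left _ _).trans (by simp)) h

theorem penBetween_le_of_le_floor {m k : ℕ} {γ σ c₀ : ℝ} {ϖ₀ : ℕ → ℝ} (hγ : 0 < γ)
    (h0 : IsPrior (Finset.range (m + 1)) ϖ₀) (hcond : BetweenPriorCondition m c₀ ϖ₀) (hk1 : 1 ≤ k)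
    (hk : k ≤ ⌊(m : ℝ) / Real.exp 1⌋₊) :
    penBetween m γ σ ϖ₀ k ≤
      2 * (1 + 1 / γ) * (c₀ + 2) * (σ ^ 2 * k * Real.log ((m : ℝ) / k)) := by
  have hk0 : (0 : ℝ) < k := by exact_mod_cast hk1
  have hke : (k : ℝ) ≤ m / Real.exp 1 := (Nat.le_floor_iff (by positivity)).1 hk
  have hke' : (k : ℝ) * Real.exp 1 ≤ m := by rwa [le_div_iff₀ (Real.exp_pos _)] at hke
  have hkm' : (k : ℝ) ≤ m := by nlinarith [Real.one_le_exp (zero_le_one (α := ℝ))]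
  have hkm : k ≤ m := by exact_mod_cast hkm'
  have hm0 : (0 : ℝ) < m := hk0.trans_le hkm'
  have hl1 : 1 ≤ Real.log ((m : ℝ) / k) := by
    rw [Real.le_log_iff_exp_le (by positivity), le_div_iff₀ hk0]; linarith
  have hmem : k ∈ Finset.range (m + 1) := Finset.mem_range.2 (by omega)
  have h3 := Real.log_le_log (by positivity) (hcond.1 k hk1 hk)
  rw [Real.log_rpow (by positivity), ← inv_div, Real.log_inv] at h3
  have h4 := log_choose_le hk1 hkm
  rw [penBetween_eq h0 hmem, betweenWeight, if_pos hmem,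
    Real.log_div (h0.1 k hmem).ne' (choose_cast_pos hkm).ne']
  set l := Real.log ((m : ℝ) / k)
  have h5 : -(Real.log (ϖ₀ k) - Real.log (m.choose k)) ≤ (c₀ + 2) * (k * l) := by nlinarith
  have h6 := mul_le_mul_of_nonneg_left h5 (by positivity : 0 ≤ 2 * σ ^ 2 * (1 + 1 / γ))
  linarith

theorem penBetween_self_le {m : ℕ} {γ σ c₀ : ℝ} {ϖ₀ : ℕ → ℝ} (hγ : 0 < γ)
    (h0 : IsPrior (Finset.range (m + 1)) ϖ₀) (hcond : BetweenPriorCondition m c₀ ϖ₀) :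
    penBetween m γ σ ϖ₀ m ≤ 2 * (1 + 1 / γ) * c₀ * (σ ^ 2 * m) := by
  have hmem : m ∈ Finset.range (m + 1) := Finset.mem_range.2 (by omega)
  have h3 := Real.log_le_log (Real.exp_pos _) hcond.2
  rw [Real.log_exp] at h3
  rw [penBetween_eq h0 hmem, betweenWeight, if_pos hmem, Nat.choose_self, Nat.cast_one, div_one]
  have h6 := mul_le_mul_of_nonneg_left (by linarith : -Real.log (ϖ₀ m) ≤ c₀ * m)
    (by positivity : 0 ≤ 2 * σ ^ 2 * (1 + 1 / γ))
  linarith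

/-- The bound for the maximal risk of the sparse group MAP estimator. -/
theorem groupRisk_sup_le {γ c₀ c₁ c₂ : ℝ} (hγ : 0 < γ) (hc₀ : 0 < c₀) (hc₁ : 0 < c₁)
    (hc₂ : 0 < c₂) :
    ∃ C₁ : ℝ, 0 < C₁ ∧
      ∀ (m n : ℕ) (σ : ℝ) (ϖ₀ : ℕ → ℝ) (ϖ : Fin m → ℕ → ℝ)
        (μhat : (Fin m → Fin n → ℝ) → Fin m → Fin n → ℝ),
        0 < σ → IsPrior (Finset.range (m + 1)) ϖ₀ → (∀ j, IsPrior (Finset.Icc 1 n) (ϖ j)) →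
        BetweenPriorCondition m c₀ ϖ₀ → (∀ j, WithinPriorCondition n γ c₁ c₂ (ϖ j)) →
        IsSparseGroupMAP m n γ σ ϖ₀ ϖ μhat →
        ∀ (J : Finset (Fin m)) (T : Fin m → BallType) (η : Fin m → ℝ),
          J.Nonempty → (∀ j ∈ J, (T j).NotSuperSparse n (η j)) →
          (⨆ μ ∈ {μ : Fin m → Fin n → ℝ |
              (∀ j ∈ J, μ j ∈ (T j).ball n σ (η j)) ∧ ∀ j ∉ J, μ j = 0},
            groupRisk m n σ μhat μ) ≤
            ENNReal.ofReal C₁ *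
              max (∑ j ∈ J, minimaxRisk n σ ((T j).ball n σ (η j)))
                (ENNReal.ofReal (σ ^ 2 * (J.card : ℝ) * Real.log ((m : ℝ) / (J.card : ℝ)))) := by
  classical
  obtain ⟨K, hK, horacle⟩ := groupRisk_le_oracle hγ
  obtain ⟨C, hC, happrox⟩ := exists_approximant hγ hc₁ hc₂
  set P : ℝ := 2 * (1 + 1 / γ) * (c₀ + 2) with hP
  have hP0 : 0 < P := by positivity
  refine ⟨K * (768 * (4 * C + 1) + P * (1 + 3 * 768)), by positivity, ?_⟩
  intro m n σ ϖ₀ ϖ μhat hσ h0 h hb hw hδ J T η hJ hT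
  obtain ⟨j₀, hj₀⟩ := hJ
  have hn2 : 2 ≤ n := two_le_of_prior hγ (h j₀) (hw j₀)
  have hn0 : (1 : ℝ) ≤ n := by exact_mod_cast (by omega : 1 ≤ n)
  have hlogn : 0 ≤ Real.log n := Real.log_nonneg hn0
  set r : Fin m → ℝ := fun j => (minimaxRisk n σ ((T j).ball n σ (η j))).toReal with hr
  have hr0 : ∀ j, 0 ≤ r j := fun j => ENNReal.toReal_nonneg
  have hrR : ∑ j ∈ J, minimaxRisk n σ ((T j).ball n σ (η j)) = ENNReal.ofReal (∑ j ∈ J, r j) := by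
    rw [ENNReal.ofReal_sum_of_nonneg fun j _ => hr0 j]
    refine Finset.sum_congr rfl fun j _ => (ENNReal.ofReal_toReal ?_).symm
    exact ((minimaxRisk_le_denseRate _).trans_lt ENNReal.ofReal_lt_top).ne
  set W : ℝ := σ ^ 2 * (J.card : ℝ) * Real.log ((m : ℝ) / (J.card : ℝ)) with hW
  have hJm : J.card ≤ m := (Finset.card_le_univ _).trans (by simp)
  have hJ1 : 1 ≤ J.card := Finset.card_pos.2 ⟨j₀, hj₀⟩
  have hJ0 : (0 : ℝ) < J.card := by exact_mod_cast hJ1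
  have hW0 : 0 ≤ W := by
    have := log_div_nonneg hJ0 (show (J.card : ℝ) ≤ m by exact_mod_cast hJm)
    positivity
  rw [hrR, ← ENNReal.ofReal_max, ← ENNReal.ofReal_mul (by positivity)]
  refine iSup₂_le fun μ hμ => ?_
  obtain ⟨hμJ, hμ0⟩ : (∀ j ∈ J, μ j ∈ (T j).ball n σ (η j)) ∧ ∀ j ∉ J, μ j = 0 := hμ
  set S : ℝ := ∑ j ∈ J, r j with hS
  have hS0 : 0 ≤ S := Finset.sum_nonneg fun j _ => hr0 j
  set E : Fin m → ℝ := fun j => truncEnergy n σ (absOrdered (μ j)) + σ ^ 2 * (1 + Real.log n) with hE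
  have hEr : ∀ j ∈ J, E j ≤ 768 * r j := fun j hj =>
    truncEnergy_add_log_le hn2 hσ (hT j hj) (hμJ j hj)
  have hTE : ∀ j, σ ^ 2 * (1 + Real.log n) ≤ E j := fun j =>
    le_add_of_nonneg_left (Finset.sum_nonneg fun i _ => trunc_nonneg σ _ i)
  have hES : ∑ j ∈ J, E j ≤ 768 * S := by
    rw [hS, Finset.mul_sum]; exact Finset.sum_le_sum hEr
  have hσlog : σ ^ 2 ≤ σ ^ 2 * (1 + Real.log n) := by nlinarith [sq_nonneg σ]
  have hJS : J.card * (σ ^ 2 * (1 + Real.log n)) ≤ 768 * S := by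
    refine le_trans ?_ hES
    rw [← nsmul_eq_mul, ← Finset.sum_const]
    exact Finset.sum_le_sum fun j _ => hTE j
  have hσS : σ ^ 2 ≤ 768 * S := by
    have : (1 : ℝ) ≤ J.card := by exact_mod_cast hJ1
    nlinarith [sq_nonneg σ]
  choose ν hν0 hν using fun j => happrox n σ (ϖ j) (by omega) hσ (h j) (hw j) (μ j)
  have hmaxS : S ≤ max S W := le_max_left _ _
  have hmaxW : W ≤ max S W := le_max_right _ _
  have reduce : ∀ ν' : Fin m → Fin n → ℝ,
      ∑ j, (∑ i, (μ j i - ν' j i) ^ 2 + penWithin n γ σ (ϖ j) (l0norm (ν' j))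
        + σ ^ 2 * l0norm (ν' j))
        + penBetween m γ σ ϖ₀ (Finset.univ.filter fun j => l0norm (ν' j) ≠ 0).card + σ ^ 2
        ≤ (768 * (4 * C + 1) + P * (1 + 3 * 768)) * max S W →
      groupRisk m n σ μhat μ ≤
        ENNReal.ofReal (K * (768 * (4 * C + 1) + P * (1 + 3 * 768)) * max S W) := by
    intro ν' hν'
    refine (horacle m n σ c₁ c₂ ϖ₀ ϖ μhat hσ h0 h hw hδ μ ν').trans
      (ENNReal.ofReal_le_ofReal ?_)
    rw [mul_assoc]
    refine mul_le_mul_of_nonneg_left (le_trans (le_of_eq ?_) hν') hK.le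
    rw [totalPen, Finset.sum_add_distrib, Finset.sum_add_distrib, Finset.mul_sum]
    ring
  -- Sparse case: `ϖ₀` is controlled at `m₀`. Dense case: only at `m`, so every group gets a nonzero
  -- approximant, at the cost `σ² (1 + log n)` for each of the at most `2 m₀` groups outside `J`.
  by_cases hcase : J.card ≤ ⌊(m : ℝ) / Real.exp 1⌋₊
  · refine reduce (fun j => if j ∈ J then ν j else 0) ?_
    have hcard : (Finset.univ.filter fun j => l0norm (if j ∈ J then ν j else 0) ≠ 0) = J := by
      ext j
      by_cases hj : j ∈ J
      · simp [hj, hν0 j]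
      · simp [hj, l0norm]
    rw [hcard]
    have hpen := penBetween_le_of_le_floor (σ := σ) hγ h0 hb hJ1 hcase
    have hsum : ∑ j, (∑ i, (μ j i - (if j ∈ J then ν j else 0) i) ^ 2
        + penWithin n γ σ (ϖ j) (l0norm (if j ∈ J then ν j else 0))
        + σ ^ 2 * l0norm (if j ∈ J then ν j else 0)) ≤ C * (768 * S) := by
      calc _ ≤ ∑ j, (if j ∈ J then C * E j else 0) := by
            refine Finset.sum_le_sum fun j _ => ?_
            by_cases hj : j ∈ J
            · simpa only [if_pos hj] using hν j
            · simp [if_neg hj, hμ0 j hj, l0norm, penWithin]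
        _ = C * ∑ j ∈ J, E j := by
            rw [Finset.mul_sum, Finset.sum_ite_mem, Finset.univ_inter]
        _ ≤ _ := mul_le_mul_of_nonneg_left hES hC.le
    rw [← hP, ← hW] at hpen
    have e1 : C * S ≤ C * max S W := by gcongr
    have e2 : P * W ≤ P * max S W := by gcongr
    have e3 : 0 ≤ C * max S W := by positivity
    have e4 : 0 ≤ P * max S W := by positivity
    linarith
  · refine reduce ν ?_
    have hcard : (Finset.univ.filter fun j => l0norm (ν j) ≠ 0).card = m := by
      rw [Finset.filter_true_of_mem fun j _ => hν0 j]; simp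
    rw [hcard]
    have hm3 : (m : ℝ) ≤ 3 * J.card := by
      have := (Nat.lt_of_floor_lt (not_le.1 hcase)).le
      rw [div_le_iff₀ (Real.exp_pos _)] at this
      have h3 := Real.exp_one_lt_d9
      nlinarith
    have hpen := penBetween_self_le (σ := σ) hγ h0 hb
    have hsum : ∑ j, (∑ i, (μ j i - ν j i) ^ 2 + penWithin n γ σ (ϖ j) (l0norm (ν j))
        + σ ^ 2 * l0norm (ν j)) ≤ C * (4 * (768 * S)) := by
      have h1 : ∑ j, E j ≤ ∑ j ∈ J, E j + m * (σ ^ 2 * (1 + Real.log n)) := by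
        rw [← Finset.sum_add_sum_compl J]
        refine add_le_add le_rfl ?_
        calc ∑ j ∈ Jᶜ, E j = ∑ j ∈ Jᶜ, σ ^ 2 * (1 + Real.log n) := by
              refine Finset.sum_congr rfl fun j hj => ?_
              simp only [hE]
              rw [hμ0 j (Finset.mem_compl.1 hj), truncEnergy_absOrdered_zero, zero_add]
          _ ≤ ∑ _j : Fin m, σ ^ 2 * (1 + Real.log n) :=
              Finset.sum_le_sum_of_subset_of_nonneg (Finset.subset_univ _)
                fun _ _ _ => by positivity
          _ = _ := by simp
      have h2 : m * (σ ^ 2 * (1 + Real.log n)) ≤ 3 * J.card * (σ ^ 2 * (1 + Real.log n)) := by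
        gcongr
      calc _ ≤ ∑ j, C * E j := Finset.sum_le_sum fun j _ => hν j
        _ = C * ∑ j, E j := by rw [Finset.mul_sum]
        _ ≤ _ := mul_le_mul_of_nonneg_left (by linarith) hC.le
    have hpen2 : penBetween m γ σ ϖ₀ m ≤ P * (3 * (768 * S)) := by
      have h1 : σ ^ 2 * m ≤ 3 * (768 * S) := by
        have : σ ^ 2 * m ≤ σ ^ 2 * (3 * J.card) := by gcongr
        have h4 : J.card * σ ^ 2 ≤ J.card * (σ ^ 2 * (1 + Real.log n)) := by gcongr
        linarith
      have h2 : 2 * (1 + 1 / γ) * c₀ ≤ P := by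
        rw [hP]; gcongr; linarith
      exact hpen.trans (mul_le_mul h2 h1 (by positivity) hP0.le)
    have e1 : C * S ≤ C * max S W := by gcongr
    have e2 : P * S ≤ P * max S W := by gcongr
    have e4 : 0 ≤ P * max S W := by positivity
    linarith

end

end SparseGroup

theorem theorem2 :
    -- the risk bound: `C₁` depends only on `γ` and on the constants of the prior conditions
    (∀ γ c₀ c₁ c₂ : ℝ, 0 < γ → 0 < c₀ → 0 < c₁ → SparseGroup.cGamma γ < c₂ →
      ∃ C₁ : ℝ, 0 < C₁ ∧
        ∀ (m n : ℕ) (σ : ℝ) (ϖ₀ : ℕ → ℝ) (ϖ : Fin m → ℕ → ℝ)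
          (μhat : (Fin m → Fin n → ℝ) → Fin m → Fin n → ℝ),
          0 < σ →
          SparseGroup.IsPrior (Finset.range (m + 1)) ϖ₀ →
          (∀ j, SparseGroup.IsPrior (Finset.Icc 1 n) (ϖ j)) →
          SparseGroup.BetweenPriorCondition m c₀ ϖ₀ →
          (∀ j, SparseGroup.WithinPriorCondition n γ c₁ c₂ (ϖ j)) →
          SparseGroup.IsSparseGroupMAP m n γ σ ϖ₀ ϖ μhat →
          ∀ (J : Finset (Fin m)) (T : Fin m → SparseGroup.BallType) (η : Fin m → ℝ),
            J.Nonempty →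
            (∀ j ∈ J, (T j).NotSuperSparse n (η j)) →
            (⨆ μ ∈ {μ : Fin m → Fin n → ℝ |
                (∀ j ∈ J, μ j ∈ (T j).ball n σ (η j)) ∧ ∀ j ∉ J, μ j = 0},
              SparseGroup.groupRisk m n σ μhat μ) ≤
              ENNReal.ofReal C₁ *
                max (∑ j ∈ J, SparseGroup.minimaxRisk n σ ((T j).ball n σ (η j)))
                  (ENNReal.ofReal (σ ^ 2 * (J.card : ℝ) * Real.log ((m : ℝ) / (J.card : ℝ))))) ∧
    -- the single-vector minimax risks, up to multiplying constants
    (∀ (T : SparseGroup.BallType) (η₀ : ℝ), 0 < η₀ → η₀ < 1 →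
      ∃ a A : ℝ, 0 < a ∧ 0 < A ∧
        ∀ (n : ℕ) (σ η : ℝ), 2 ≤ n → 0 < σ → T.NotSuperSparse n η →
          (η₀ ≤ η →
            ENNReal.ofReal (a * SparseGroup.denseRate n σ) ≤
                SparseGroup.minimaxRisk n σ (T.ball n σ η) ∧
              SparseGroup.minimaxRisk n σ (T.ball n σ η) ≤
                ENNReal.ofReal (A * SparseGroup.denseRate n σ)) ∧
          (η ≤ η₀ →
            ENNReal.ofReal (a * T.sparseRate n σ η) ≤
                SparseGroup.minimaxRisk n σ (T.ball n σ η) ∧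
              SparseGroup.minimaxRisk n σ (T.ball n σ η) ≤
                ENNReal.ofReal (A * T.sparseRate n σ η))) := by
  refine ⟨fun γ c₀ c₁ c₂ hγ hc₀ hc₁ hc₂ => ?_, SparseGroup.minimaxRisk_bounds⟩
  have hc : 0 < SparseGroup.cGamma γ := by unfold SparseGroup.cGamma; positivity
  exact SparseGroup.groupRisk_sup_le hγ hc₀ hc₁ (hc.trans hc₂)
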